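/- Let $\mathbb L$ be the Lazard ring, $F(u,v)=u+v+\sum_{i,j\ge1}a_{i,j}u^iv^j$ the universal commutative one-dimensional formal group law over $\mathbb L$; write $a+_Fb=F(a,b)$, and $\bar a$ for the formal inverse, $F(a,\bar a)=0$. Let $\mathcal{SP}$ be the set of strict partitions $\lambda=(\lambda_1>\cdots>\lambda_r>0)$, $r=\ell(\lambda)\ge0$. For $r\le n$ define power series in $\mathbb L[[x_1,\dots,x_n]]$ by $$P^{\mathbb L}_\lambda(x_1,\dots,x_n)=\frac1{(n-r)!}\sum_{w\in S_n}w\Big[\prod_{i=1}^r x_i^{\lambda_i}\prod_{i=1}^r\prod_{j=i+1}^n\frac{x_i+_Fx_j}{x_i+_F\bar x_j}\Big],$$ $$Q^{\mathbb L}_\lambda(x_1,\dots,x_n)=\frac1{(n-r)!}\sum_{w\in S_n}w\Big[\prod_{i=1}^r (x_i+_Fx_i)x_i^{\lambda_i-1}\prod_{i=1}^r\prod_{j=i+1}^n\frac{x_i+_Fx_j}{x_i+_F\bar x_j}\Big],$$ where $w$ permutes $x_1,\dots,x_n$, and set both equal to $0$ if $r>n$; let $P^{\mathbb L}_\lambda(x)$,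 $Q^{\mathbb L}_\lambda(x)$ be the inverse limits of these under $x_{n+1}\mapsto0$. Let $\Lambda_{\mathbb L}(y)$ be the ring of symmetric functions of bounded degree in $y=(y_1,y_2,\dots)$ over $\mathbb L$. Put $\Delta(t;y)=\prod_{j\ge1}\frac{1-\bar t y_j}{1-ty_j}$ and $\Delta(x;y)=\prod_{i\ge1}\Delta(x_i;y)$, the latter again as the inverse limit over $n$ of $\Delta(x_1,\dots,x_n;y)=\prod_{i=1}^n\Delta(x_i;y)$. Define $\hat q_k(y),\hat p_k(y)\in\Lambda_{\mathbb L}(y)$ by $$\Delta(t;y)=\sum_{k\ge0}\hat q_k(y)t^k=1+(t+_Ft)\sum_{k\ge1}\hat p_k(y)t^{k-1},\qquad \hat p_0(y)=1,$$ and let $\Gamma_{\mathbb L}(y)$ and $\Gamma^+_{\mathbb L}(y)$ be the $\mathbb L$-subalgebras of $\Lambda_{\mathbb L}(y)$ generated by the $\hat p_k(y)$, $k\ge1$, and by the $\hat q_k(y)$, $k\ge1$, respectively. Then all these objects are well defined, and there are unique families $\hat p^{\mathbb L}_\lambda(y),\hat q^{\mathbb L}_\lambda(y)\in\Lambda_{\mathbb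 L}(y)$, $\lambda\in\mathcal{SP}$, with $$\Delta(x;y)=\sum_{\lambda\in\mathcal{SP}}Q^{\mathbb L}_\lambda(x)\,\hat p^{\mathbb L}_\lambda(y)=\sum_{\lambda\in\mathcal{SP}}P^{\mathbb L}_\lambda(x)\,\hat q^{\mathbb L}_\lambda(y),$$ and: (1) the $\hat p^{\mathbb L}_\lambda(y)$, $\lambda\in\mathcal{SP}$, are linearly independent over $\mathbb L$ and form an $\mathbb L$-basis of $\Gamma_{\mathbb L}(y)$; (2) the $\hat q^{\mathbb L}_\lambda(y)$, $\lambda\in\mathcal{SP}$, are linearly independent over $\mathbb L$ and form an $\mathbb L$-basis of $\Gamma^+_{\mathbb L}(y)$. -/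

import Mathlib

open scoped MvPowerSeries.WithPiTopology

noncomputable section

namespace UnivSchur

/-! ### The Lazard ring and the universal formal group law -/

/-- The generic series `u + v + ∑_{i, j ≥ 1} a_{i, j} u ^ i v ^ j`, whose coefficient `a_{i, j}`
(for `i, j ≥ 1`) is the polynomial variable with index `(i - 1, j - 1)`. -/
def genericSeries : MvPowerSeries (Fin 2) (MvPolynomial (ℕ × ℕ) ℤ) := fun d =>
  if d 0 = 0 ∨ d 1 = 0 then (if d 0 + d 1 = 1 then 1 else 0)
  else MvPolynomial.X (d 0 - 1, d 1 - 1)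

/-- `G(G(u, v), w)` for the generic series `G`. -/
def genericAssocLeft : MvPowerSeries (Fin 3) (MvPolynomial (ℕ × ℕ) ℤ) :=
  genericSeries.subst ![genericSeries.subst ![MvPowerSeries.X 0, MvPowerSeries.X 1],
    (MvPowerSeries.X 2 : MvPowerSeries (Fin 3) (MvPolynomial (ℕ × ℕ) ℤ))]

/-- `G(u, G(v, w))` for the generic series `G`. -/
def genericAssocRight : MvPowerSeries (Fin 3) (MvPolynomial (ℕ × ℕ) ℤ) :=
  genericSeries.subst ![(MvPowerSeries.X 0 : MvPowerSeries (Fin 3) (MvPolynomial (ℕ × ℕ) ℤ)),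
    genericSeries.subst ![MvPowerSeries.X 1, MvPowerSeries.X 2]]

/-- The ideal of relations which say that the generic series is associative and commutative. -/
def lazardIdeal : Ideal (MvPolynomial (ℕ × ℕ) ℤ) :=
  Ideal.span
    (Set.range (fun d => MvPowerSeries.coeff d genericAssocLeft -
        MvPowerSeries.coeff d genericAssocRight) ∪
      Set.range (fun ij : ℕ × ℕ =>
        (MvPolynomial.X (ij.1, ij.2) - MvPolynomial.X (ij.2, ij.1) :
          MvPolynomial (ℕ × ℕ) ℤ)))

/-- The Lazard ring `𝕃`. -/
def Lazard : Type := MvPolynomial (ℕ × ℕ) ℤ ⧸ lazardIdeal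

instance : CommRing Lazard := inferInstanceAs (CommRing (MvPolynomial (ℕ × ℕ) ℤ ⧸ lazardIdeal))

/-- The Lazard ring carries the discrete topology, so that convergence of formal power series over
it is coefficientwise stabilisation. -/
instance : TopologicalSpace Lazard := ⊥

instance : DiscreteTopology Lazard := ⟨rfl⟩

/-- The quotient map onto the Lazard ring. -/
def lazardMk : MvPolynomial (ℕ × ℕ) ℤ →+* Lazard := Ideal.Quotient.mk lazardIdeal

theorem lazardMk_eq {p q : MvPolynomial (ℕ × ℕ) ℤ} (h : p - q ∈ lazardIdeal) :
    lazardMk p = lazardMk q := Ideal.Quotient.eq.2 h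

theorem genericSeries_constantCoeff : MvPowerSeries.constantCoeff genericSeries = 0 := by
  rw [← MvPowerSeries.coeff_zero_eq_constantCoeff_apply]
  change genericSeries 0 = 0
  simp [genericSeries]

/-- The universal formal group law `F_𝕃`. -/
def lazardFGL : FormalGroup Lazard where
  toPowerSeries := genericSeries.map lazardMk
  zero_constantCoeff := by
    rw [MvPowerSeries.constantCoeff_map, genericSeries_constantCoeff, map_zero]
  lin_coeff_X := by
    rw [MvPowerSeries.coeff_map]
    have : MvPowerSeries.coeff (Finsupp.single 0 1) genericSeries = 1 := by
      change genericSeries _ = 1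
      simp [genericSeries]
    rw [this, map_one]
  lin_coeff_Y := by
    rw [MvPowerSeries.coeff_map]
    have : MvPowerSeries.coeff (Finsupp.single 1 1) genericSeries = 1 := by
      change genericSeries _ = 1
      simp [genericSeries]
    rw [this, map_one]
  assoc := by
    have key : genericAssocLeft.map lazardMk = genericAssocRight.map lazardMk := by
      ext d
      rw [MvPowerSeries.coeff_map, MvPowerSeries.coeff_map]
      exact lazardMk_eq (Ideal.subset_span (Or.inl ⟨d, rfl⟩))
    have aux (g₁ g₂ : MvPowerSeries (Fin 3) (MvPolynomial (ℕ × ℕ) ℤ)) :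
        ![g₁.map lazardMk, g₂.map lazardMk] = fun i => (![g₁, g₂] i).map lazardMk := by
      ext1 i; fin_cases i <;> simp
    have h1 := MvPowerSeries.HasSubst.cons_subst_zero_left (0 : Fin 3) 1 2
      genericSeries_constantCoeff
    have h2 := MvPowerSeries.HasSubst.cons_subst_zero_right (0 : Fin 3) 1 2
      genericSeries_constantCoeff
    simp_rw [(MvPowerSeries.map_X lazardMk _).symm, aux,
      ← MvPowerSeries.map_subst MvPowerSeries.HasSubst.X_X, aux,
      ← MvPowerSeries.map_subst h1, ← MvPowerSeries.map_subst h2]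
    exact key

/-- The formal sum `a +_F b`. -/
def fadd {σ : Type} (a b : MvPowerSeries σ Lazard) : MvPowerSeries σ Lazard :=
  lazardFGL.toPowerSeries.subst ![a, b]

/-- The coefficients of the formal inverse `χ(t) ∈ 𝕃[[t]]`, the series with `F(t, χ(t)) = 0`:
its `n`-th coefficient is forced by the earlier ones, because
`F(t, ∑_{k ≤ n} c_k t ^ k) ≡ F(t, ∑_{k < n} c_k t ^ k) + c_n t ^ n` modulo `t ^ (n + 1)`. -/
def finvCoeff (n : ℕ) : Lazard :=
  - PowerSeries.coeff n (fadd (PowerSeries.X : PowerSeries Lazard)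
      (∑ k : Fin n, PowerSeries.monomial (k : ℕ) (finvCoeff k) : PowerSeries Lazard))
termination_by n
decreasing_by exact k.isLt

/-- The formal inverse `χ(t) = - t + ⋯`. -/
def finvSeries : PowerSeries Lazard := PowerSeries.mk finvCoeff

/-- The formal inverse `ā = χ(a)` of a power series `a` without constant term. -/
def finv {σ : Type} (a : MvPowerSeries σ Lazard) : MvPowerSeries σ Lazard :=
  PowerSeries.subst a finvSeries
theorem lazardFGL_coeff (d : Fin 2 →₀ ℕ) :
    MvPowerSeries.coeff d lazardFGL.toPowerSeries = lazardMk (genericSeries d) := rfl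

theorem finvCoeff_zero : finvCoeff 0 = 0 := by
  rw [finvCoeff]
  have : fadd (PowerSeries.X : PowerSeries Lazard)
      (∑ k : Fin 0, PowerSeries.monomial (k : ℕ) (finvCoeff k) : PowerSeries Lazard) =
      PowerSeries.X := by
    simpa [fadd] using! lazardFGL.add_zero (PowerSeries.HasSubst.X' (R := Lazard))
  rw [this]; simp

theorem fadd_finvSeries : fadd (PowerSeries.X : PowerSeries Lazard) finvSeries = 0 := by
  have hs : ∀ g : PowerSeries Lazard, PowerSeries.constantCoeff g = 0 →
      MvPowerSeries.HasSubst ![(PowerSeries.X : PowerSeries Lazard), g] := by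
    intro g hg
    refine MvPowerSeries.hasSubst_of_constantCoeff_zero fun s => ?_
    fin_cases s
    · exact PowerSeries.constantCoeff_X
    · exact hg
  ext n
  set g' : PowerSeries Lazard :=
    ∑ k : Fin n, PowerSeries.monomial (k : ℕ) (finvCoeff k) with hg'
  have hc : ∀ m, PowerSeries.coeff m g' = if m < n then finvCoeff m else 0 := by
    intro m
    rw [hg', map_sum]
    simp only [PowerSeries.coeff_monomial]
    split_ifs with h
    · rw [Finset.sum_eq_single ⟨m, h⟩] <;> simp
      intro b hb h'
      exact absurd (Fin.ext h'.symm) hb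
    · refine Finset.sum_eq_zero fun k _ => if_neg ?_
      have := k.isLt
      omega
  have h0 : PowerSeries.constantCoeff finvSeries = 0 := by
    rw [← PowerSeries.coeff_zero_eq_constantCoeff_apply, finvSeries, PowerSeries.coeff_mk,
      finvCoeff_zero]
  have h0' : PowerSeries.constantCoeff g' = 0 := by
    rw [← PowerSeries.coeff_zero_eq_constantCoeff_apply, hc, finvCoeff_zero, ite_self]
  have hdvd : (PowerSeries.X : PowerSeries Lazard) ^ n ∣ finvSeries - g' := by
    rw [PowerSeries.X_pow_dvd_iff]
    intro m hm
    rw [map_sub, hc, if_pos hm, finvSeries, PowerSeries.coeff_mk, sub_self]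
  have hn : finvCoeff n = - PowerSeries.coeff n (fadd (PowerSeries.X : PowerSeries Lazard) g') := by
    rw [finvCoeff]
  have hd : PowerSeries.coeff n (fadd (PowerSeries.X : PowerSeries Lazard) finvSeries) -
      PowerSeries.coeff n (fadd (PowerSeries.X : PowerSeries Lazard) g') = finvCoeff n := by
    simp only [fadd, PowerSeries.coeff]
    rw [MvPowerSeries.coeff_subst (hs _ h0), MvPowerSeries.coeff_subst (hs _ h0'),
      ← finsum_sub_distrib (MvPowerSeries.coeff_subst_finite (hs _ h0) _ _)
        (MvPowerSeries.coeff_subst_finite (hs _ h0') _ _),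
      finsum_eq_single _ (Finsupp.single 1 1)]
    · rw [lazardFGL.lin_coeff_Y]
      have e1 := hc n
      rw [if_neg (lt_irrefl n)] at e1
      have e2 : PowerSeries.coeff n finvSeries = finvCoeff n := PowerSeries.coeff_mk _ _
      simp only [PowerSeries.coeff] at e1 e2
      simp [e1, e2]
    · intro d hd
      have hprod : ∀ g : PowerSeries Lazard,
          (d.prod fun s e => (![(PowerSeries.X : PowerSeries Lazard), g] s) ^ e) =
          PowerSeries.X ^ d 0 * g ^ d 1 := by
        intro g
        rw [Finsupp.prod_fintype _ _ (by simp), Fin.prod_univ_two]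
        rfl
      rw [hprod, hprod, ← smul_sub, ← map_sub, ← mul_sub]
      by_cases hd0 : d 0 = 0
      · have : MvPowerSeries.coeff d lazardFGL.toPowerSeries = 0 ∨ d 1 = 0 := by
          by_cases h1 : d 1 = 0
          · exact Or.inr h1
          · left
            have h2 : d 1 ≠ 1 := by
              intro h2
              apply hd
              ext s
              fin_cases s <;> simp [hd0, h2]
            rw [lazardFGL_coeff]
            simp [genericSeries, hd0, h2]
        rcases this with h | h
        · rw [h, zero_smul]
        · simp [h]
      · have hX : (PowerSeries.X : PowerSeries Lazard) ^ (n + 1) ∣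
            PowerSeries.X ^ d 0 * (finvSeries ^ d 1 - g' ^ d 1) := by
          obtain ⟨k, hk⟩ := Nat.exists_eq_succ_of_ne_zero hd0
          rw [pow_succ', hk, pow_succ', mul_assoc]
          exact mul_dvd_mul_left _
            ((hdvd.trans (sub_dvd_pow_sub_pow _ _ _)).trans (Dvd.intro_left _ rfl))
        have := PowerSeries.X_pow_dvd_iff.1 hX n (Nat.lt_succ_self n)
        simp only [PowerSeries.coeff] at this
        rw [this, smul_zero]
  rw [map_zero]
  linear_combination hd + hn

instance : lazardFGL.IsComm where
  comm := by
    have hX : (![MvPowerSeries.X 1, MvPowerSeries.X 0] :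
        Fin 2 → MvPowerSeries (Fin 2) Lazard) =
        MvPowerSeries.X ∘ (Equiv.swap (0 : Fin 2) 1).toEmbedding := by
      funext i; fin_cases i <;> simp
    rw [hX, ← MvPowerSeries.rename_eq_subst]
    ext d
    have hd : d = Finsupp.embDomain (Equiv.swap (0 : Fin 2) 1).toEmbedding
        (Finsupp.equivMapDomain (Equiv.swap (0 : Fin 2) 1) d) := by
      ext i; fin_cases i <;> simp [Finsupp.embDomain_eq_mapDomain, Finsupp.mapDomain_equiv_apply]
    conv_rhs => rw [hd, MvPowerSeries.coeff_embDomain_rename]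
    rw [lazardFGL_coeff, lazardFGL_coeff]
    by_cases h0 : d 0 = 0
    · simp [genericSeries, h0]
    by_cases h1 : d 1 = 0
    · simp [genericSeries, h1]
    simp only [genericSeries, h0, h1, or_self, if_false, Finsupp.equivMapDomain_apply,
      Equiv.symm_swap, Equiv.swap_apply_left, Equiv.swap_apply_right]
    exact lazardMk_eq (Ideal.subset_span (Or.inr ⟨(d 0 - 1, d 1 - 1), rfl⟩))

/-! ### Symmetric functions in `y` and the Cauchy kernel -/

/-- `Λ_𝕃(y)`: the formal power series in `y_1, y_2, …` (indexed from `0`) over `𝕃` which are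
symmetric and of bounded degree. -/
def SymY : Subalgebra Lazard (MvPowerSeries ℕ Lazard) where
  carrier := {f | (∀ s : Equiv.Perm ℕ, MvPowerSeries.renameEquiv Lazard s f = f) ∧
    ∃ N : ℕ, ∀ d : ℕ →₀ ℕ, N < d.degree → MvPowerSeries.coeff d f = 0}
  mul_mem' := by
    rintro f g ⟨hf, N, hN⟩ ⟨hg, M, hM⟩
    refine ⟨fun s => by rw [map_mul, hf, hg], N + M, fun d hd => ?_⟩
    rw [MvPowerSeries.coeff_mul]
    refine Finset.sum_eq_zero fun p hp => ?_
    have hdeg : p.1.degree + p.2.degree = d.degree := by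
      rw [← Finset.HasAntidiagonal.mem_antidiagonal.1 hp, map_add]
    by_cases h : N < p.1.degree
    · rw [hN _ h, zero_mul]
    · rw [hM _ (by omega), mul_zero]
  add_mem' := by
    rintro f g ⟨hf, N, hN⟩ ⟨hg, M, hM⟩
    refine ⟨fun s => by rw [map_add, hf, hg], max N M, fun d hd => ?_⟩
    rw [map_add, hN _ (lt_of_le_of_lt (le_max_left _ _) hd),
      hM _ (lt_of_le_of_lt (le_max_right _ _) hd), add_zero]
  algebraMap_mem' := by
    intro r
    refine ⟨fun s => AlgEquiv.commutes _ r, 0, fun d hd => ?_⟩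
    have hd0 : d ≠ 0 := by rintro rfl; simp at hd
    classical
    rw [MvPowerSeries.algebraMap_apply, MvPowerSeries.coeff_C, if_neg hd0]

/-- A power series in `x`-variables over `𝕃`, as a power series in them over `𝕃[[y]]`. -/
def liftX {σ : Type} (f : MvPowerSeries σ Lazard) : MvPowerSeries σ (MvPowerSeries ℕ Lazard) :=
  f.map MvPowerSeries.C

/-- A power series in `y`, as a constant power series in further variables. -/
def constY {σ : Type} (g : MvPowerSeries ℕ Lazard) : MvPowerSeries σ (MvPowerSeries ℕ Lazard) :=
  MvPowerSeries.C g

/-- The factor `(1 - t̄ y_j) / (1 - t y_j)`. -/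
def kernelFactor {σ : Type} (t : MvPowerSeries σ Lazard) (j : ℕ) :
    MvPowerSeries σ (MvPowerSeries ℕ Lazard) :=
  (1 - liftX (finv t) * constY (MvPowerSeries.X j)) *
    MvPowerSeries.invOfUnit (1 - liftX t * constY (MvPowerSeries.X j)) 1

/-- The infinite product `Δ(t; y) = ∏_j (1 - t̄ y_j) / (1 - t y_j)`. -/
def kernel {σ : Type} (t : MvPowerSeries σ Lazard) : MvPowerSeries σ (MvPowerSeries ℕ Lazard) :=
  ∏' j : ℕ, kernelFactor t j

/-- The infinite product converges. -/
theorem multipliable_kernelFactor {σ : Type} (t : MvPowerSeries σ Lazard)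
    (ht : MvPowerSeries.constantCoeff t = 0) : Multipliable (kernelFactor t) := by
  have hform : ∀ j, ∃ v, kernelFactor t j = 1 + constY (MvPowerSeries.X j) * v := by
    intro j
    have hu : (1 - liftX t * constY (MvPowerSeries.X j)) *
        MvPowerSeries.invOfUnit (1 - liftX t * constY (MvPowerSeries.X j)) 1 = 1 := by
      apply MvPowerSeries.mul_invOfUnit
      simp [liftX, MvPowerSeries.constantCoeff_map, ht]
    refine ⟨(liftX t - liftX (finv t)) *
      MvPowerSeries.invOfUnit (1 - liftX t * constY (MvPowerSeries.X j)) 1, ?_⟩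
    rw [kernelFactor]
    linear_combination hu
  have hstep : ∀ (g : MvPowerSeries σ (MvPowerSeries ℕ Lazard)) (d : σ →₀ ℕ) (e : ℕ →₀ ℕ) (j : ℕ),
      e j = 0 → MvPowerSeries.coeff e (MvPowerSeries.coeff d (g * kernelFactor t j)) =
        MvPowerSeries.coeff e (MvPowerSeries.coeff d g) := by
    intro g d e j hj
    obtain ⟨v, hv⟩ := hform j
    have : g * kernelFactor t j = g + MvPowerSeries.C (MvPowerSeries.X j) * (g * v) := by
      rw [hv, constY]; ring
    rw [this, map_add, MvPowerSeries.coeff_C_mul, map_add, add_eq_left]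
    exact MvPowerSeries.X_dvd_iff.1 (Dvd.intro _ rfl) e hj
  have hstab : ∀ (d : σ →₀ ℕ) (e : ℕ →₀ ℕ) (s : Finset ℕ), e.support ⊆ s →
      MvPowerSeries.coeff e (MvPowerSeries.coeff d (∏ j ∈ s, kernelFactor t j)) =
      MvPowerSeries.coeff e (MvPowerSeries.coeff d (∏ j ∈ e.support, kernelFactor t j)) := by
    intro d e s hs
    rw [← Finset.union_sdiff_of_subset hs, Finset.prod_union Finset.disjoint_sdiff]
    have : ∀ r : Finset ℕ, (∀ j ∈ r, e j = 0) → ∀ g : MvPowerSeries σ (MvPowerSeries ℕ Lazard),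
        MvPowerSeries.coeff e (MvPowerSeries.coeff d (g * ∏ j ∈ r, kernelFactor t j)) =
        MvPowerSeries.coeff e (MvPowerSeries.coeff d g) := by
      intro r
      induction r using Finset.induction_on with
      | empty => intro _ g; simp
      | insert a r ha ih =>
        intro h g
        rw [Finset.prod_insert ha, ← mul_assoc, ih (fun j hj => h j (Finset.mem_insert_of_mem hj)),
          hstep _ _ _ _ (h a (Finset.mem_insert_self _ _))]
    exact this _ (fun j hj => by simpa using (Finset.mem_sdiff.1 hj).2) _
  let lim : MvPowerSeries σ (MvPowerSeries ℕ Lazard) := fun d =>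
    (fun e => MvPowerSeries.coeff e (MvPowerSeries.coeff d (∏ j ∈ e.support, kernelFactor t j)) :
      MvPowerSeries ℕ Lazard)
  have hlim : Filter.Tendsto (fun s : Finset ℕ => ∏ j ∈ s, kernelFactor t j) Filter.atTop
      (nhds lim) := by
    rw [MvPowerSeries.WithPiTopology.tendsto_iff_coeff_tendsto]
    intro d
    rw [MvPowerSeries.WithPiTopology.tendsto_iff_coeff_tendsto]
    intro e
    refine tendsto_const_nhds.congr' ?_
    filter_upwards [Filter.eventually_ge_atTop e.support] with s hs
    exact (hstab d e s hs).symm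
  refine ⟨lim, ?_⟩
  unfold HasProd
  rw [SummationFilter.unconditional_filter]
  exact hlim

/-- `Δ(t; y) ∈ 𝕃[[y]][[t]]` in one variable `t`. -/
def kernelOne : PowerSeries (MvPowerSeries ℕ Lazard) :=
  kernel (PowerSeries.X : PowerSeries Lazard)

/-- `Δ(x_1, …, x_n; y) = ∏_{i ≤ n} ∏_j (1 - x̄_i y_j) / (1 - x_i y_j)`. -/
def kernelX (n : ℕ) : MvPowerSeries (Fin n) (MvPowerSeries ℕ Lazard) :=
  ∏ i : Fin n, kernel (MvPowerSeries.X i)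

/-! ### The rings `Γ_𝕃(y)` and `Γ⁺_𝕃(y)` -/

/-- `q_0, q_1, q_2, …` are the coefficients in `Δ(t; y) = ∑_{k ≥ 0} q_k(y) t ^ k`. -/
def IsOneRowQ (q : ℕ → SymY) : Prop :=
  kernelOne = PowerSeries.mk fun k => (q k : MvPowerSeries ℕ Lazard)

/-- `p_0, p_1, p_2, …` are given by `p_0 = 1` and the expansion
`Δ(t; y) = 1 + (t +_F t) ∑_{k ≥ 1} p_k(y) t ^ (k - 1)`. -/
def IsOneRowP (p : ℕ → SymY) : Prop :=
  p 0 = 1 ∧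
  kernelOne = 1 + liftX (fadd (PowerSeries.X : PowerSeries Lazard) PowerSeries.X) *
    PowerSeries.mk fun k => (p (k + 1) : MvPowerSeries ℕ Lazard)

/-- The one-row functions `q̂_k(y)`. -/
def oneRowQ : ℕ → SymY := Classical.epsilon IsOneRowQ

/-- The one-row functions `p̂_k(y)`. -/
def oneRowP : ℕ → SymY := Classical.epsilon IsOneRowP

/-- `Γ_𝕃(y)`: the `𝕃`-subalgebra of `Λ_𝕃(y)` generated by `p̂_1(y), p̂_2(y), …`. -/
def GammaY : Subalgebra Lazard SymY := Algebra.adjoin Lazard {f | ∃ k ≥ 1, oneRowP k = f}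

/-- `Γ⁺_𝕃(y)`: the `𝕃`-subalgebra of `Λ_𝕃(y)` generated by `q̂_1(y), q̂_2(y), …`. -/
def GammaPlusY : Subalgebra Lazard SymY := Algebra.adjoin Lazard {f | ∃ k ≥ 1, oneRowQ k = f}

/-! ### Universal Schur `P`- and `Q`-functions -/

/-- Strict partitions `λ_1 > λ_2 > ⋯ > λ_r > 0`, including the empty one. -/
structure StrictPartition where
  /-- The parts, in decreasing order. -/
  parts : List ℕ
  strict : parts.Pairwise (· > ·)
  pos : ∀ k ∈ parts, 0 < k

/-- The length `r`. -/
def StrictPartition.length (l : StrictPartition) : ℕ := l.parts.length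

/-- The `i`-th part, indexed from `0`; it is `0` for `i ≥ r`. -/
def StrictPartition.part (l : StrictPartition) (i : ℕ) : ℕ := l.parts.getD i 0

/-- The power `t ^ k` used for the `P`-functions. -/
def rowP {n : ℕ} (k : ℕ) (t : MvPowerSeries (Fin n) Lazard) : MvPowerSeries (Fin n) Lazard :=
  t ^ k

/-- The power used for the `Q`-functions: `(t +_F t) t ^ (k - 1)` for `k ≥ 1`, and `1` for
`k = 0`. -/
def rowQ {n : ℕ} (k : ℕ) (t : MvPowerSeries (Fin n) Lazard) : MvPowerSeries (Fin n) Lazard :=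
  if k = 0 then 1 else fadd t t * t ^ (k - 1)

/-- The quotient `a / b` in the total ring of fractions of `𝕃[[x_1, …, x_n]]`. -/
def frac {n : ℕ} (a b : MvPowerSeries (Fin n) Lazard) :
    FractionRing (MvPowerSeries (Fin n) Lazard) :=
  algebraMap _ _ a * Ring.inverse (algebraMap _ _ b)

/-- The symmetrization
`1 / (n - r)! ∑_{w ∈ S_n} w [∏_{i ≤ r} row λ_i x_i
  ∏_{i ≤ r} ∏_{i < j ≤ n} (x_i +_F x_j) / (x_i +_F x̄_j)]`,
where `w` replaces each `x_i` by `x_{w(i)}`. -/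
def symmetrization (n : ℕ)
    (row : ℕ → MvPowerSeries (Fin n) Lazard → MvPowerSeries (Fin n) Lazard)
    (l : StrictPartition) : FractionRing (MvPowerSeries (Fin n) Lazard) :=
  Ring.inverse ((n - l.length).factorial : FractionRing (MvPowerSeries (Fin n) Lazard)) *
    ∑ w : Equiv.Perm (Fin n),
      (∏ i : Fin n with i.val < l.length,
        algebraMap _ _ (row (l.part i) (MvPowerSeries.X (w i)))) *
      ∏ i : Fin n with i.val < l.length, ∏ j : Fin n with i < j,
        frac (fadd (MvPowerSeries.X (w i)) (MvPowerSeries.X (w j)))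
          (fadd (MvPowerSeries.X (w i)) (finv (MvPowerSeries.X (w j))))

/-- `P^𝕃_λ(x_1, …, x_n)`: the power series whose image in the total ring of fractions is the
symmetrization; it is `0` if the length of `λ` exceeds `n`. -/
def schurP (l : StrictPartition) (n : ℕ) : MvPowerSeries (Fin n) Lazard :=
  if l.length ≤ n then Function.invFun
    (algebraMap (MvPowerSeries (Fin n) Lazard) (FractionRing (MvPowerSeries (Fin n) Lazard)))
    (symmetrization n rowP l)
  else 0

/-- `Q^𝕃_λ(x_1, …, x_n)`: the power series whose image in the total ring of fractions is the
symmetrization; it is `0` if the length of `λ` exceeds `n`. -/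
def schurQ (l : StrictPartition) (n : ℕ) : MvPowerSeries (Fin n) Lazard :=
  if l.length ≤ n then Function.invFun
    (algebraMap (MvPowerSeries (Fin n) Lazard) (FractionRing (MvPowerSeries (Fin n) Lazard)))
    (symmetrization n rowQ l)
  else 0

/-! ### The dual functions -/

/-- The Cauchy identity `Δ(x; y) = ∑_λ Q^𝕃_λ(x) p_λ(y)`. Both sides are elements of an inverse
limit over the number `n` of variables `x_1, …, x_n`, so it says that
`Δ(x_1, …, x_n; y) = ∑_λ Q^𝕃_λ(x_1, …, x_n) p_λ(y)` for every `n`, as a convergent sum of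
formal power series. -/
def IsDualP (p : StrictPartition → SymY) : Prop :=
  ∀ n : ℕ, HasSum (fun l => liftX (schurQ l n) * constY (p l : MvPowerSeries ℕ Lazard)) (kernelX n)

/-- The Cauchy identity `Δ(x; y) = ∑_λ P^𝕃_λ(x) q_λ(y)`, in the same sense. -/
def IsDualQ (q : StrictPartition → SymY) : Prop :=
  ∀ n : ℕ, HasSum (fun l => liftX (schurP l n) * constY (q l : MvPowerSeries ℕ Lazard)) (kernelX n)

/-- The dual universal Schur `P`-functions `p̂^𝕃_λ(y)`. -/
def dualP : StrictPartition → SymY := Classical.epsilon IsDualP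

/-- The dual universal Schur `Q`-functions `q̂^𝕃_λ(y)`. -/
def dualQ : StrictPartition → SymY := Classical.epsilon IsDualQ

end UnivSchur

end

/-! Both cases are instances of one statement about a row series `g`: `g = t` gives the
`P`-functions in `x` and the `q̂` in `y`, while `g = t +_F t` gives the `Q`-functions and the `p̂`.
The row factor is `g(x_i) x_i ^ (λ_i - 1)`, and `t - t̄ = g v` with `v(0)` equal to `2` and `1`
respectively. The two choices are `exists_isRow_X` and `exists_isRow_doubleSeries`.

The functions `S_λ(x)` (`schurFn g`) and the coefficients of the monomials `y ^ e` in the kernel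
belong to one class of families in `x`, `IsGammaFamily`. Its members are symmetric, stable under
`x_n ↦ 0` and free of `x_i` after `x_j ↦ x̄_i`; moreover the part involving all of `x_1, …, x_n` is
divisible by `g(x_1) ⋯ g(x_n)`. Such a family is determined by its strict coefficients, those of `x
^ (λ - (1, …, 1))` in that quotient for strict `λ` (`IsGammaFamily.coeff_eq_zero`). Ordered by `∑ i
λ_i`, the matrix of strict coefficients of the `S_λ` is unitriangular (`IsRow.strictCoeff_schurFn`).
For the kernel, the strict coefficient at `λ` is the product of the one-row functions of the parts
of `λ` (`IsRow.coeff_quotG_deltaFam`).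

Hence the dual functions are obtained from these products by inverting a unitriangular matrix
(`dualFam`). The error of a partial sum of the Cauchy identity is again a family of the class, its
strict coefficients vanish up to a large weight, and so it vanishes in low degrees. Uniqueness
follows from the leading terms of the `S_λ`. For the span, the Cauchy identity is divided by `g(x_1)
⋯ g(x_n)` and an arbitrary coefficient is read off: every product of one-row functions is a finite
combination of dual functions (`IsRow.exists_prod_rowFn_eq`). For independence it is enough to treat
the products over strict partitions. Their top degree parts in `y` are `v(0) ^ ℓ(λ)` times integral
symmetric functions, which modulo `2` become products of power sums with distinct exponents; the
resulting matrix is triangular with odd determinant (`linearIndependent_rowProd`).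

The arithmetic input is Lazard's theorem that `𝕃` is a polynomial ring over `ℤ`. It makes `𝕃` a
domain of characteristic zero, which is used for the integrality of the symmetrizations and
throughout. It also shows that `2` is prime and does not divide `a_{1,1}`, which makes `g(x_j)` a
non-zero-divisor modulo `g(x_i)` when `g = t +_F t`. Surjectivity of the polynomial presentation
rests on the comparison lemma for symmetric cocycles (`IsSymmCocycle.eq_zero`), injectivity on the
group law `E(l(u) + l(v))` with generic exponential `E`. -/

namespace UnivSchur
open MvPowerSeries

/-! ### Symmetric additive cocycles -/

/-- The coefficients of a homogeneous symmetric additive `2`-cocycle of degree `N`: `f i` is the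
coefficient of `x ^ i y ^ (N - i)`. -/
def IsSymmCocycle {M : Type*} [AddCommGroup M] (N : ℕ) (f : ℕ → M) : Prop :=
  (∀ i, 0 < i → i < N → f i = f (N - i)) ∧
    ∀ i j, 0 < i → 0 < j → i + j < N → (i + j).choose i • f (i + j) = (N - i).choose j • f i

/-- Lucas' congruence with last digits zero. It makes the restriction of a cocycle of degree `p m`
to the multiples of `p` a cocycle of degree `m`. -/
theorem natCast_choose_mul_mul (p : ℕ) [Fact p.Prime] (a b : ℕ) :
    (((p * a).choose (p * b) : ℕ) : ZMod p) = (a.choose b : ℕ) := by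
  have hp : 0 < p := (Fact.out : p.Prime).pos
  have h := Choose.choose_modEq_choose_mod_mul_choose_div_nat (p := p) (n := p * a) (k := p * b)
  rw [Nat.mul_mod_right, Nat.mul_mod_right, Nat.mul_div_cancel_left _ hp,
    Nat.mul_div_cancel_left _ hp, Nat.choose_self, one_mul] at h
  exact (ZMod.natCast_eq_natCast_iff _ _ _).2 h

theorem natCast_choose_pred_pred (p : ℕ) [Fact p.Prime] {N : ℕ} (hN : 0 < N) (hp : p ∣ N) :
    (((N - 1).choose (p - 1) : ℕ) : ZMod p) = 1 := by
  have hp0 : 0 < p := (Fact.out : p.Prime).pos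
  obtain ⟨m, rfl⟩ := hp
  have hm : 0 < m := Nat.pos_of_mul_pos_left hN
  obtain ⟨m, rfl⟩ := Nat.exists_eq_succ_of_ne_zero hm.ne'
  have e : p * m.succ - 1 = (p - 1) + p * m := by rw [Nat.mul_succ]; omega
  have h := Choose.choose_modEq_choose_mod_mul_choose_div_nat (p := p) (n := p * m.succ - 1)
    (k := p - 1)
  rw [e, Nat.add_mul_mod_self_left, Nat.mod_eq_of_lt (by omega : p - 1 < p), Nat.choose_self,
    Nat.div_eq_of_lt (by omega : p - 1 < p), Nat.choose_zero_right, one_mul] at h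
  rw [e]
  simpa using (ZMod.natCast_eq_natCast_iff _ _ _).2 h

/-- Over `ℤ / p` the cocycles of degree `N` form a space of dimension at most one. The relation with
`i = 1` determines `f m` from `f 1` when `p ∤ m`. If `p ∤ N`, symmetry reaches the multiples of `p`;
if `N = p` there are none in range; if `N = p m` with `m ≥ 2`, then `f 1 = 0` automatically and the
multiples of `p` carry a cocycle of degree `m`. -/
theorem IsSymmCocycle.exists_index (p : ℕ) [Fact p.Prime] (N : ℕ) (hN : 2 ≤ N) :
    ∃ i₀, 0 < i₀ ∧ i₀ < N ∧ ∀ f : ℕ → ZMod p, IsSymmCocycle N f → f i₀ = 0 →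
      ∀ i, 0 < i → i < N → f i = 0 := by
  have hp : p.Prime := Fact.out
  induction N using Nat.strong_induction_on with
  | _ N ih =>
    have base : ∀ f : ℕ → ZMod p, IsSymmCocycle N f → f 1 = 0 →
        ∀ m, 0 < m → m < N → ¬ p ∣ m → f m = 0 := by
      intro f hf h1 m hm hmN hpm
      rcases Nat.lt_or_ge 1 m with h | h
      · have := hf.2 1 (m - 1) one_pos (by omega) (by omega)
        rw [h1, smul_zero, show 1 + (m - 1) = m by omega, Nat.choose_one_right, nsmul_eq_mul] at this
        refine (mul_eq_zero.1 this).resolve_left fun h0 => hpm ?_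
        exact (ZMod.natCast_eq_zero_iff _ _).1 h0
      · rwa [show m = 1 by omega]
    by_cases hpN : p ∣ N
    · by_cases hNp : N = p
      · refine ⟨1, one_pos, by omega, fun f hf h1 i hi hiN => base f hf h1 i hi hiN fun hd => ?_⟩
        exact absurd (Nat.le_of_dvd hi hd) (by omega)
      · obtain ⟨m, rfl⟩ := hpN
        have hm : 2 ≤ m := by
          rcases m with _ | _ | m
          · simp at hN
          · simp at hNp
          · omega
        obtain ⟨i₀, h0, h1, h2⟩ := ih m (by nlinarith [hp.two_le]) hm
        refine ⟨p * i₀, Nat.mul_pos hp.pos h0, (Nat.mul_lt_mul_left hp.pos).2 h1,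
          fun f hf hfi => ?_⟩
        -- The relation for `(1, p - 1)` reads `p f(p) = (N - 1).choose (p - 1) f(1)`. Its left side
        -- is zero modulo `p`, and the binomial coefficient is `1`.
        have hf1 : f 1 = 0 := by
          have hlt : 1 + (p - 1) < p * m := by nlinarith [hp.two_le, Nat.sub_add_cancel hp.pos]
          have := hf.2 1 (p - 1) one_pos (by have := hp.two_le; omega) hlt
          rw [show 1 + (p - 1) = p by have := hp.two_le; omega, Nat.choose_one_right, nsmul_eq_mul,
            nsmul_eq_mul, natCast_choose_pred_pred p (by omega) (Dvd.intro _ rfl)] at this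
          simpa using this.symm
        have hf' : IsSymmCocycle m fun i => f (p * i) := by
          refine ⟨fun i hi him => ?_, fun i j hi hj hij => ?_⟩
          · have := hf.1 (p * i) (Nat.mul_pos hp.pos hi) ((Nat.mul_lt_mul_left hp.pos).2 him)
            rwa [← Nat.mul_sub] at this
          · have := hf.2 (p * i) (p * j) (Nat.mul_pos hp.pos hi) (Nat.mul_pos hp.pos hj)
              (by rw [← mul_add]; exact (Nat.mul_lt_mul_left hp.pos).2 hij)
            rwa [← mul_add, ← Nat.mul_sub, nsmul_eq_mul, nsmul_eq_mul, natCast_choose_mul_mul,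
              natCast_choose_mul_mul, ← nsmul_eq_mul, ← nsmul_eq_mul] at this
        intro i hi hiN
        by_cases hpi : p ∣ i
        · obtain ⟨i, rfl⟩ := hpi
          exact h2 _ hf' hfi i (Nat.pos_of_mul_pos_left hi) (lt_of_mul_lt_mul_left hiN (Nat.zero_le _))
        · exact base f hf hf1 i hi hiN hpi
    · refine ⟨1, one_pos, by omega, fun f hf h1 i hi hiN => ?_⟩
      by_cases hpi : p ∣ i
      · rw [hf.1 i hi hiN]
        refine base f hf h1 _ (by omega) (by omega) fun h => hpN ?_
        have := dvd_add hpi h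
        rwa [show i + (N - i) = N by omega] at this
      · exact base f hf h1 i hi hiN hpi

/-- Every nontrivial finitely generated abelian group maps onto some `ℤ / p`. -/
theorem exists_ne_zero_hom_zmod (M : Type*) [AddCommGroup M] [Module.Finite ℤ M] [Nontrivial M] :
    ∃ p : ℕ, p.Prime ∧ ∃ φ : M →+ ZMod p, Function.Surjective φ := by
  obtain ⟨m, hm, -⟩ := (eq_top_or_exists_le_coatom (⊥ : Submodule ℤ M)).resolve_left bot_ne_top
  have hs : IsSimpleModule ℤ (M ⧸ m) := isSimpleModule_iff_isCoatom.2 hm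
  obtain ⟨I, hI, ⟨e⟩⟩ := isSimpleModule_iff_quot_maximal.1 hs
  obtain ⟨n, rfl⟩ := (Submodule.IsPrincipal.principal I : ∃ a, I = Submodule.span ℤ {a})
  have hn0 : n ≠ 0 := by
    rintro rfl
    exact Ring.ne_bot_of_isMaximal_of_not_isField hI Int.not_isField
      (Ideal.span_singleton_eq_bot.2 rfl)
  have hn : Prime n := (Ideal.span_singleton_prime hn0).1 hI.isPrime
  refine ⟨n.natAbs, Int.prime_iff_natAbs_prime.1 hn,
    ((Int.quotientSpanEquivZMod n).toAddMonoidHom.comp e.toLinearMap.toAddMonoidHom).comp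
      m.mkQ.toAddMonoidHom, ?_⟩
  exact ((Int.quotientSpanEquivZMod n).surjective.comp e.surjective).comp m.mkQ_surjective

/-- This is the coboundary `(x + y) ^ N - x ^ N - y ^ N`; divided by the gcd of its coefficients it
becomes the primitive cocycle against which all others are compared. -/
theorem isSymmCocycle_choose (N : ℕ) : IsSymmCocycle N fun i => (N.choose i : ℤ) := by
  refine ⟨fun i _ h => congrArg Nat.cast (Nat.choose_symm h.le).symm, fun i j _ _ h => ?_⟩
  have := Nat.choose_mul (n := N) (k := i + j) (s := i) (by omega)
  rw [show i + j - i = j by omega] at this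
  simp only [nsmul_eq_mul]
  norm_cast
  rw [mul_comm, this, mul_comm]

/-- The greatest common divisor of the binomial coefficients `N.choose i` with `0 < i < N`,
together with a Bézout relation. -/
theorem exists_bezout_choose (N : ℕ) (hN : 2 ≤ N) : ∃ d : ℤ, d ≠ 0 ∧ ∃ c q : ℕ → ℤ,
    (∀ i, 0 < i → i < N → (N.choose i : ℤ) = d * q i) ∧
      ∑ i ∈ Finset.Ioo 0 N, c i * q i = 1 := by
  obtain ⟨d, hd⟩ := IsPrincipalIdealRing.principal
    (Ideal.span ((fun i => (N.choose i : ℤ)) '' (Finset.Ioo 0 N : Set ℕ)))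
  have hd : Ideal.span ((fun i => (N.choose i : ℤ)) '' (Finset.Ioo 0 N : Set ℕ)) =
    Ideal.span {d} := hd
  have hdvd : ∀ i, 0 < i → i < N → d ∣ (N.choose i : ℤ) := by
    intro i h1 h2
    rw [← Ideal.mem_span_singleton, ← hd]
    exact Ideal.subset_span ⟨i, by simp [h1, h2], rfl⟩
  have hd0 : d ≠ 0 := by
    rintro rfl
    have := hdvd 1 one_pos (by omega)
    rw [zero_dvd_iff, Nat.choose_one_right] at this
    omega
  have hmem : d ∈ Ideal.span ((fun i => (N.choose i : ℤ)) '' (Finset.Ioo 0 N : Set ℕ)) :=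
    hd ▸ Ideal.mem_span_singleton_self d
  obtain ⟨c, hc⟩ := (Submodule.mem_span_image_finset_iff_exists_fun' ℤ).1 hmem
  choose! q hq using hdvd
  refine ⟨d, hd0, c, q, hq, mul_left_cancel₀ hd0 ?_⟩
  rw [mul_one, Finset.mul_sum]
  refine Eq.trans ?_ hc
  refine Finset.sum_congr rfl fun i hi => ?_
  rw [Finset.mem_Ioo] at hi
  rw [smul_eq_mul, hq i hi.1 hi.2]
  ring

theorem IsSymmCocycle.map {M M' : Type*} [AddCommGroup M] [AddCommGroup M'] (φ : M →+ M') {N : ℕ}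
    {f : ℕ → M} (hf : IsSymmCocycle N f) : IsSymmCocycle N fun i => φ (f i) := by
  refine ⟨fun i h1 h2 => congrArg φ (hf.1 i h1 h2), fun i j hi hj h => ?_⟩
  dsimp only
  rw [← map_nsmul, ← map_nsmul, hf.2 i j hi hj h]

theorem IsSymmCocycle.of_mul {N : ℕ} {d : ℤ} (hd : d ≠ 0) {f q : ℕ → ℤ} (hf : IsSymmCocycle N f)
    (hq : ∀ i, 0 < i → i < N → f i = d * q i) : IsSymmCocycle N q := by
  refine ⟨fun i h1 h2 => mul_left_cancel₀ hd ?_, fun i j hi hj h => mul_left_cancel₀ hd ?_⟩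
  · rw [← hq i h1 h2, ← hq _ (by omega) (by omega), hf.1 i h1 h2]
  · have := hf.2 i j hi hj h
    rw [hq _ (by omega) h, hq i hi (by omega)] at this
    simp only [nsmul_eq_mul] at this ⊢
    linear_combination this

/-- The group of symmetric cocycles with values in an abelian group is detected by one integral
combination of the coefficients. -/
theorem IsSymmCocycle.eq_zero {M : Type*} [AddCommGroup M] {N : ℕ} (hN : 2 ≤ N) {d : ℤ}
    (hd : d ≠ 0) {c q : ℕ → ℤ} (hq : ∀ i, 0 < i → i < N → (N.choose i : ℤ) = d * q i)
    (hc : ∑ i ∈ Finset.Ioo 0 N, c i * q i = 1) {f : ℕ → M} (hf : IsSymmCocycle N f)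
    (h0 : ∑ i ∈ Finset.Ioo 0 N, c i • f i = 0) : ∀ i, 0 < i → i < N → f i = 0 := by
  have hqc : IsSymmCocycle N q := (isSymmCocycle_choose N).of_mul hd hq
  by_contra! hne
  obtain ⟨k, hk0, hkN, hk⟩ := hne
  -- The values of `f` span a finitely generated group. If it is nonzero it maps onto some `ℤ / p`,
  -- where the one-dimensionality of the space of cocycles applies.
  let S : Submodule ℤ M := Submodule.span ℤ (f '' (Finset.Ioo 0 N : Set ℕ))
  have hfS : ∀ i, 0 < i → i < N → f i ∈ S := fun i h1 h2 =>
    Submodule.subset_span ⟨i, by simp [h1, h2], rfl⟩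
  let g : ℕ → S := fun i => if h : 0 < i ∧ i < N then ⟨f i, hfS i h.1 h.2⟩ else 0
  have hg : ∀ i, 0 < i → i < N → (g i : M) = f i := fun i h1 h2 => by simp [g, h1, h2]
  have hgc : IsSymmCocycle N g := by
    refine ⟨fun i h1 h2 => Subtype.ext ?_, fun i j hi hj h => Subtype.ext ?_⟩
    · rw [hg i h1 h2, hg _ (by omega) (by omega), hf.1 i h1 h2]
    · have := hf.2 i j hi hj h
      rwa [← hg _ (by omega) h, ← hg i hi (by omega)] at this
  have : Module.Finite ℤ S :=
    Module.Finite.iff_fg.2 (Submodule.fg_span ((Finset.finite_toSet _).image _))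
  have : Nontrivial S := ⟨g k, 0, fun h => hk (by rw [← hg k hk0 hkN, h]; rfl)⟩
  obtain ⟨p, hp, φ, hφ⟩ := exists_ne_zero_hom_zmod S
  have : Fact p.Prime := ⟨hp⟩
  obtain ⟨i₀, hi0, hi1, huniq⟩ := IsSymmCocycle.exists_index p N hN
  have hφg := hgc.map φ
  have hφq := hqc.map (Int.castAddHom (ZMod p))
  -- This combination of two cocycles is built to vanish at `i₀`, hence vanishes everywhere. Pairing
  -- it with `c`, where `q` gives `1` and `g` gives `0`, leaves `φ (g i₀) = 0`.
  have hcomb : ∀ i, 0 < i → i < N → (q i₀ : ZMod p) * φ (g i) - φ (g i₀) * (q i : ZMod p) = 0 := by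
    refine huniq (fun i => (q i₀ : ZMod p) * φ (g i) - φ (g i₀) * (q i : ZMod p)) ?_ (by ring)
    refine ⟨fun i h1 h2 => ?_, fun i j hi hj h => ?_⟩
    · have e1 := hφg.1 i h1 h2
      have e2 := hφq.1 i h1 h2
      simp only [Int.coe_castAddHom] at e1 e2
      dsimp only
      rw [e1, e2]
    · have e1 := hφg.2 i j hi hj h
      have e2 := hφq.2 i j hi hj h
      simp only [Int.coe_castAddHom, nsmul_eq_mul] at e1 e2 ⊢
      linear_combination (q i₀ : ZMod p) * e1 - φ (g i₀) * e2
  have hsum : ∑ i ∈ Finset.Ioo 0 N, (c i : ZMod p) * φ (g i) = 0 := by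
    have : ∑ i ∈ Finset.Ioo 0 N, c i • g i = 0 := by
      refine Subtype.ext ?_
      rw [Submodule.coe_sum, Submodule.coe_zero, ← h0]
      refine Finset.sum_congr rfl fun i hi => ?_
      rw [Finset.mem_Ioo] at hi
      rw [Submodule.coe_smul, hg i hi.1 hi.2]
    have h := congrArg φ this
    rw [map_sum, map_zero] at h
    rw [← h]
    exact Finset.sum_congr rfl fun i _ => by rw [map_zsmul, zsmul_eq_mul]
  have hi₀ : φ (g i₀) = 0 := by
    have h1 : ∑ i ∈ Finset.Ioo 0 N,
        (c i : ZMod p) * ((q i₀ : ZMod p) * φ (g i) - φ (g i₀) * (q i : ZMod p)) = 0 :=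
      Finset.sum_eq_zero fun i hi => by
        rw [Finset.mem_Ioo] at hi
        rw [hcomb i hi.1 hi.2, mul_zero]
    have h2 : ∑ i ∈ Finset.Ioo 0 N, (c i : ZMod p) * (q i : ZMod p) = 1 := by
      exact_mod_cast congrArg (Int.cast : ℤ → ZMod p) hc
    have h3 : ∑ i ∈ Finset.Ioo 0 N,
        (c i : ZMod p) * ((q i₀ : ZMod p) * φ (g i) - φ (g i₀) * (q i : ZMod p)) =
        (q i₀ : ZMod p) * ∑ i ∈ Finset.Ioo 0 N, (c i : ZMod p) * φ (g i) -
          φ (g i₀) * ∑ i ∈ Finset.Ioo 0 N, (c i : ZMod p) * (q i : ZMod p) := by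
      rw [Finset.mul_sum, Finset.mul_sum, ← Finset.sum_sub_distrib]
      exact Finset.sum_congr rfl fun i _ => by ring
    rw [h3, hsum, h2] at h1
    linear_combination -h1
  have hφ0 : ∀ i, 0 < i → i < N → φ (g i) = 0 := huniq _ hφg hi₀
  have hker : ∀ s : S, φ s = 0 := by
    intro s
    have hs : s.1 ∈ Submodule.map S.subtype (LinearMap.ker φ.toIntLinearMap) := by
      refine (Submodule.span_le.2 ?_ : S ≤ _) s.2
      rintro _ ⟨i, hi, rfl⟩
      rw [Finset.coe_Ioo, Set.mem_Ioo] at hi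
      exact ⟨g i, hφ0 i hi.1 hi.2, hg i hi.1 hi.2⟩
    obtain ⟨t, ht, hts⟩ := hs
    rw [← Subtype.ext hts]
    exact ht
  obtain ⟨s, hs⟩ := hφ 1
  exact one_ne_zero (hs.symm.trans (hker s))

/-! ### Coefficients of the associativity relation -/

section FormalGroupCoeff

variable {R : Type*} [CommRing R]

/-- The exponent of the monomial `u ^ i v ^ j`. -/
noncomputable def bideg (i j : ℕ) : Fin 2 →₀ ℕ := Finsupp.single 0 i + Finsupp.single 1 j

@[simp] theorem bideg_zero (i j : ℕ) : bideg i j 0 = i := by simp [bideg]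

@[simp] theorem bideg_one (i j : ℕ) : bideg i j 1 = j := by simp [bideg]

theorem bideg_self (d : Fin 2 →₀ ℕ) : bideg (d 0) (d 1) = d := by
  ext i; fin_cases i <;> simp

theorem degree_fin_two (d : Fin 2 →₀ ℕ) : d.degree = d 0 + d 1 := by
  rw [Finsupp.degree_eq_sum, Fin.sum_univ_two]

@[simp] theorem degree_bideg (i j : ℕ) : (bideg i j).degree = i + j := by
  simp [degree_fin_two]

theorem coeff_pow_mul_X_pow_rename (e : Fin 2 ↪ Fin 3) {c : Fin 3} (hc : c ∉ Set.range e)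
    (G : MvPowerSeries (Fin 2) R) (d : Fin 2 →₀ ℕ) (k q : ℕ) :
    coeff (Finsupp.embDomain e d + Finsupp.single c k) (rename e G * X c ^ q) =
      if q = k then coeff d G else 0 := by
  have hec : ∀ d : Fin 2 →₀ ℕ, Finsupp.embDomain e d c = 0 := fun d =>
    Finsupp.embDomain_of_notMem_range _ _ _ hc
  have hXc : (X c : MvPowerSeries (Fin 3) R) ^ q = monomial (Finsupp.single c q) 1 := by
    rw [X_pow_eq]
  rw [hXc, coeff_mul_monomial, mul_one]
  split_ifs with h1 h2 h2
  · subst h2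
    rw [add_tsub_cancel_right, coeff_embDomain_rename]
  · have hqk : q ≤ k := by simpa [hec] using h1 c
    refine coeff_rename_eq_zero (R := R) (f := e) _ ?_
    rintro ⟨d', hd'⟩
    rw [← Finsupp.embDomain_eq_mapDomain] at hd'
    have := DFunLike.congr_fun hd' c
    rw [hec] at this
    simp [hec] at this
    omega
  · subst h2
    exact absurd le_add_self h1
  · rfl

variable (F : FormalGroup R)

theorem constantCoeff_rename_toPowerSeries (e : Fin 2 ↪ Fin 3) :
    constantCoeff (rename e F.toPowerSeries) = 0 := by
  rw [constantCoeff_rename, F.zero_constantCoeff]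

/-- The variable `X c` does not occur in the inner copy of `F`, so its exponent fixes the power of
the second argument. Powers `F ^ p` with `p > d.degree` have order too large to contribute. -/
theorem coeff_subst_rename_X (e : Fin 2 ↪ Fin 3) {c : Fin 3} (hc : c ∉ Set.range e)
    (d : Fin 2 →₀ ℕ) (k : ℕ) :
    coeff (Finsupp.embDomain e d + Finsupp.single c k)
      (F.toPowerSeries.subst ![rename e F.toPowerSeries, (X c : MvPowerSeries (Fin 3) R)]) =
      ∑ p ∈ Finset.range (d.degree + 1),
        coeff (bideg p k) F.toPowerSeries * coeff d (F.toPowerSeries ^ p) := by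
  have hs : HasSubst ![rename e F.toPowerSeries, (X c : MvPowerSeries (Fin 3) R)] := by
    refine hasSubst_of_constantCoeff_zero fun s => ?_
    fin_cases s
    · exact constantCoeff_rename_toPowerSeries F e
    · exact constantCoeff_X _
  have hterm : ∀ D : Fin 2 →₀ ℕ, coeff (Finsupp.embDomain e d + Finsupp.single c k)
      (D.prod fun s n => ![rename e F.toPowerSeries, (X c : MvPowerSeries (Fin 3) R)] s ^ n) =
      if D 1 = k then coeff d (F.toPowerSeries ^ D 0) else 0 := by
    intro D
    rw [Finsupp.prod_fintype _ _ (by simp), Fin.prod_univ_two,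
      ← coeff_pow_mul_X_pow_rename e hc (F.toPowerSeries ^ D 0) d k (D 1), map_pow]
    rfl
  rw [coeff_subst hs]
  simp_rw [hterm]
  rw [finsum_eq_sum_of_support_subset
    (s := (Finset.range (d.degree + 1)).image fun p => bideg p k)]
  · rw [Finset.sum_image]
    · exact Finset.sum_congr rfl fun p _ => by simp
    · intro p _ p' _ h
      simpa using DFunLike.congr_fun h 0
  · intro D hD
    rw [Function.mem_support] at hD
    have h1 : D 1 = k := by
      by_contra h
      exact hD (by rw [if_neg h, smul_zero])
    rw [if_pos h1] at hD
    rw [Finset.coe_image, Set.mem_image]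
    refine ⟨D 0, ?_, by rw [← h1, bideg_self]⟩
    rw [Finset.coe_range, Set.mem_Iio, Nat.lt_succ_iff]
    by_contra! h
    refine hD ?_
    refine (congrArg _ (coeff_of_lt_order ?_)).trans (smul_zero _)
    refine lt_of_lt_of_le ?_ (le_order_pow_of_constantCoeff_eq_zero _ F.zero_constantCoeff)
    exact_mod_cast h

theorem subst_X_X_eq_rename (e : Fin 2 ↪ Fin 3) :
    F.toPowerSeries.subst ![(X (e 0) : MvPowerSeries (Fin 3) R), X (e 1)] =
      rename e F.toPowerSeries := by
  rw [rename_eq_subst]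
  congr 1
  ext1 s; fin_cases s <;> rfl

section LinearTerm

variable {G : MvPowerSeries (Fin 2) R} (h0 : constantCoeff G = 0)
  (hX : coeff (Finsupp.single 0 1) G = 1) (hY : coeff (Finsupp.single 1 1) G = 1)

include hX hY in
theorem homogeneousComponent_one_eq :
    homogeneousComponent 1 G = X 0 + X 1 := by
  ext d
  rw [coeff_homogeneousComponent, map_add]
  split_ifs with h
  · rw [degree_fin_two] at h
    rcases (by omega : (d 0 = 1 ∧ d 1 = 0) ∨ (d 0 = 0 ∧ d 1 = 1)) with h' | h'
    · have : d = Finsupp.single 0 1 := by rw [← bideg_self d, h'.1, h'.2]; simp [bideg]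
      rw [this, hX]
      simp [coeff_X, Finsupp.single_left_inj]
    · have : d = Finsupp.single 1 1 := by rw [← bideg_self d, h'.1, h'.2]; simp [bideg]
      rw [this, hY]
      simp [coeff_X, Finsupp.single_left_inj]
  · rw [coeff_X, coeff_X, if_neg, if_neg, add_zero]
    · rintro rfl; simp at h
    · rintro rfl; simp at h

include h0 hX hY in
theorem homogeneousComponent_pow_eq (p : ℕ) :
    homogeneousComponent p (G ^ p) = (X 0 + X 1) ^ p := by
  induction p with
  | zero =>
    ext d
    rw [coeff_homogeneousComponent, pow_zero, pow_zero, coeff_one]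
    split_ifs with h1 h2 h2 <;> simp_all
  | succ p ih =>
    rw [pow_succ, homogeneousComponent_mul_of_le_order, ih, homogeneousComponent_one_eq hX hY,
      pow_succ]
    · exact_mod_cast le_order_pow_of_constantCoeff_eq_zero _ h0
    · exact_mod_cast one_le_order_iff_constCoeff_eq_zero.2 h0

include h0 hX hY in
-- The part of lowest degree of `G ^ p` is `(X 0 + X 1) ^ p`; this is the source of the binomial
-- coefficients in the cocycle relation.
theorem coeff_degree_pow_eq (d : Fin 2 →₀ ℕ) :
    coeff d (G ^ d.degree) = (d.degree.choose (d 0) : ℕ) := by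
  have h := congrArg (coeff d) (homogeneousComponent_pow_eq h0 hX hY d.degree)
  rw [coeff_homogeneousComponent, if_pos rfl] at h
  rw [h]
  have := PowerSeries.coeff_subst_X_zero_add_X_one (R := R) (PowerSeries.X ^ d.degree) d
  rw [PowerSeries.subst_pow, PowerSeries.subst_X] at this
  · rw [this, degree_fin_two, PowerSeries.coeff_X_pow_self, mul_one]
  all_goals exact PowerSeries.HasSubst.of_constantCoeff_zero (by simp)

end LinearTerm

theorem coeff_pow_mem {σ : Type*} (T : Subring R) (G : MvPowerSeries σ R) (p : ℕ) :
    ∀ d : σ →₀ ℕ, (∀ d' ≤ d, coeff d' G ∈ T) → coeff d (G ^ p) ∈ T := by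
  classical
  induction p with
  | zero =>
    intro d _
    rw [pow_zero, coeff_one]
    split_ifs
    exacts [T.one_mem, T.zero_mem]
  | succ p ih =>
    intro d hd
    rw [pow_succ, coeff_mul]
    refine T.sum_mem fun x hx => ?_
    have hx := Finset.HasAntidiagonal.mem_antidiagonal.1 hx
    exact T.mul_mem (ih _ fun d' h => hd _ (h.trans (hx ▸ le_self_add)))
      (hd _ (hx ▸ le_add_self))

theorem coeff_zero_left (k : ℕ) : coeff (bideg 0 k) F.toPowerSeries = if k = 1 then 1 else 0 := by
  have h := F.zeroX_eq_X
  have h1 : PowerSeries.coeff k F.zeroX = coeff (bideg 0 k) F.toPowerSeries := by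
    have hs : HasSubst ![(0 : PowerSeries R), PowerSeries.X] := HasSubst.zero_X
    rw [FormalGroup.zeroX, PowerSeries.coeff, coeff_subst hs, finsum_eq_single _ (bideg 0 k)]
    · rw [Finsupp.prod_fintype _ _ (by simp), Fin.prod_univ_two]
      simp [← PowerSeries.coeff_def (s := Finsupp.single () k) (n := k) (by simp),
        PowerSeries.coeff_X_pow]
    · intro D hD
      rw [Finsupp.prod_fintype _ _ (by simp), Fin.prod_univ_two]
      by_cases h0 : D 0 = 0
      · have : D 1 ≠ k := fun h1 => hD (by rw [← bideg_self D, h0, h1])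
        simp [h0, ← PowerSeries.coeff_def (s := Finsupp.single () k) (n := k) (by simp),
          PowerSeries.coeff_X_pow, this.symm]
      · simp [h0]
  rw [← h1, h, PowerSeries.coeff_X]

theorem coeff_symm [F.IsComm] (i j : ℕ) :
    coeff (bideg i j) F.toPowerSeries = coeff (bideg j i) F.toPowerSeries := by
  have hX : (![X 1, X 0] : Fin 2 → MvPowerSeries (Fin 2) R) =
      X ∘ (Equiv.swap (0 : Fin 2) 1).toEmbedding := by
    funext i; fin_cases i <;> simp
  have h := congrArg (coeff (bideg i j)) (FormalGroup.IsComm.comm (F := F))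
  rw [hX, ← rename_eq_subst] at h
  have hd : bideg i j = Finsupp.embDomain (Equiv.swap (0 : Fin 2) 1).toEmbedding (bideg j i) := by
    rw [Finsupp.embDomain_eq_mapDomain, bideg, bideg, Finsupp.mapDomain_add,
      Finsupp.mapDomain_single, Finsupp.mapDomain_single, add_comm]
    simp
  rw [h, hd, coeff_embDomain_rename]

/-- In the sum over `p` only `p = d.degree` involves a coefficient of `F` of total degree `d.degree
+ k`. Since `k > 0`, the coefficients entering `F ^ p` have smaller degree and lie in `T`. -/
theorem coeff_subst_rename_X_sub_mem (T : Subring R) (e : Fin 2 ↪ Fin 3) {c : Fin 3}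
    (hc : c ∉ Set.range e) (d : Fin 2 →₀ ℕ) (k : ℕ) (hk : 0 < k)
    (hT : ∀ d' : Fin 2 →₀ ℕ, d'.degree < d.degree + k → coeff d' F.toPowerSeries ∈ T) :
    coeff (Finsupp.embDomain e d + Finsupp.single c k)
      (F.toPowerSeries.subst ![rename e F.toPowerSeries, (X c : MvPowerSeries (Fin 3) R)]) -
      (d.degree.choose (d 0) : ℕ) * coeff (bideg d.degree k) F.toPowerSeries ∈ T := by
  rw [coeff_subst_rename_X F e hc, Finset.sum_range_succ,
    coeff_degree_pow_eq F.zero_constantCoeff F.lin_coeff_X F.lin_coeff_Y,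
    mul_comm _ (Nat.cast _), add_sub_cancel_right]
  refine T.sum_mem fun p hp => ?_
  rw [Finset.mem_range] at hp
  refine T.mul_mem (hT _ (by simp; omega)) (coeff_pow_mem T _ p d fun d' h => hT _ ?_)
  have := Finsupp.degree_mono h
  omega

/-- Modulo the subring generated by the coefficients of lower degree, the coefficients of a
commutative formal group law satisfy the cocycle relation. -/
theorem choose_mul_coeff_sub_mem [F.IsComm] (T : Subring R) {i j k : ℕ} (hi : 0 < i) (hk : 0 < k)
    (hT : ∀ d : Fin 2 →₀ ℕ, d.degree < i + j + k → coeff d F.toPowerSeries ∈ T) :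
    ((i + j).choose i : ℕ) * coeff (bideg (i + j) k) F.toPowerSeries -
      ((j + k).choose j : ℕ) * coeff (bideg i (j + k)) F.toPowerSeries ∈ T := by
  let e₁ : Fin 2 ↪ Fin 3 := ⟨![0, 1], by decide⟩
  let e₂ : Fin 2 ↪ Fin 3 := ⟨![1, 2], by decide⟩
  have he₁ : (2 : Fin 3) ∉ Set.range e₁ := by
    rintro ⟨s, hs⟩; revert hs; fin_cases s <;> simp [e₁]
  have he₂ : (0 : Fin 3) ∉ Set.range e₂ := by
    rintro ⟨s, hs⟩; revert hs; fin_cases s <;> simp [e₂]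
  have hX : ∀ s : Fin 3, PowerSeries.HasSubst (X s : MvPowerSeries (Fin 3) R) :=
    fun s => PowerSeries.HasSubst.X s
  -- Commutativity turns `F(x₀, F(x₁, x₂))` into `F(F(x₁, x₂), x₀)`, so the same coefficient formula
  -- serves both sides of associativity.
  have hassoc : F.toPowerSeries.subst ![rename e₁ F.toPowerSeries, (X 2 : MvPowerSeries (Fin 3) R)]
      = F.toPowerSeries.subst ![rename e₂ F.toPowerSeries, (X 0 : MvPowerSeries (Fin 3) R)] := by
    rw [← subst_X_X_eq_rename, ← subst_X_X_eq_rename]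
    refine (F.assoc' (hX 0) (hX 1) (hX 2)).trans (F.comm' (hX 0) ?_)
    refine PowerSeries.HasSubst.of_constantCoeff_zero ?_
    exact (congrArg constantCoeff (subst_X_X_eq_rename F e₂)).trans
      (constantCoeff_rename_toPowerSeries F e₂)
  have hexp : Finsupp.embDomain e₁ (bideg i j) + Finsupp.single (2 : Fin 3) k =
      Finsupp.embDomain e₂ (bideg j k) + Finsupp.single (0 : Fin 3) i := by
    simp only [Finsupp.embDomain_eq_mapDomain, bideg, Finsupp.mapDomain_add,
      Finsupp.mapDomain_single]
    simp [e₁, e₂]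
    abel
  have h1 := coeff_subst_rename_X_sub_mem F T e₁ he₁ (bideg i j) k hk
    (fun d hd => hT d (by simpa using hd))
  have h2 := coeff_subst_rename_X_sub_mem F T e₂ he₂ (bideg j k) i hi
    (fun d hd => hT d (by simp at hd; omega))
  have := T.sub_mem h2 h1
  rw [hexp, hassoc, sub_sub_sub_cancel_left] at this
  simpa [coeff_symm F (j + k) i] using this

end FormalGroupCoeff

/-! ### The structure of the Lazard ring -/

theorem coeff_lazardFGL_bideg (i j : ℕ) :
    coeff (bideg (i + 1) (j + 1)) lazardFGL.toPowerSeries = lazardMk (MvPolynomial.X (i, j)) := by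
  rw [lazardFGL_coeff, genericSeries]
  simp

theorem lazardMk_surjective : Function.Surjective lazardMk := Ideal.Quotient.mk_surjective

theorem subring_eq_top_of_coeff_mem (T : Subring Lazard)
    (hT : ∀ d, coeff d lazardFGL.toPowerSeries ∈ T) : T = ⊤ := by
  refine (Subring.eq_top_iff' T).2 fun x => ?_
  obtain ⟨p, rfl⟩ := lazardMk_surjective x
  induction p using MvPolynomial.induction_on with
  | C a =>
    rw [show MvPolynomial.C a = (a : MvPolynomial (ℕ × ℕ) ℤ) by simp, map_intCast]
    exact intCast_mem T a
  | add p q hp hq => rw [map_add]; exact T.add_mem hp hq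
  | mul_X p ij hp =>
    rw [map_mul, ← coeff_lazardFGL_bideg]
    exact T.mul_mem hp (hT _)

/-- The common divisor of the binomial coefficients `(k + 2).choose i`. -/
noncomputable def chooseGcd (k : ℕ) : ℤ := (exists_bezout_choose (k + 2) (by omega)).choose

theorem chooseGcd_ne_zero (k : ℕ) : chooseGcd k ≠ 0 :=
  (exists_bezout_choose (k + 2) (by omega)).choose_spec.1

/-- Bézout coefficients for the binomial coefficients `(k + 2).choose i`. -/
noncomputable def chooseBezout (k : ℕ) : ℕ → ℤ :=
  (exists_bezout_choose (k + 2) (by omega)).choose_spec.2.choose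

theorem exists_chooseQuot (k : ℕ) : ∃ q : ℕ → ℤ,
    (∀ i, 0 < i → i < k + 2 → ((k + 2).choose i : ℤ) = chooseGcd k * q i) ∧
      ∑ i ∈ Finset.Ioo 0 (k + 2), chooseBezout k i * q i = 1 :=
  (exists_bezout_choose (k + 2) (by omega)).choose_spec.2.choose_spec

/-- The combination of the degree `k + 2` coefficients of a series which generates the
indecomposables of that degree. -/
noncomputable def degreeGenerator {R : Type*} [CommRing R] (G : MvPowerSeries (Fin 2) R) (k : ℕ) :
    R :=
  ∑ i ∈ Finset.Ioo 0 (k + 2), chooseBezout k i • coeff (bideg i (k + 2 - i)) G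

/-- The polynomial presentation of the Lazard ring. -/
noncomputable def lazardPoly : MvPolynomial ℕ ℤ →+* Lazard :=
  MvPolynomial.eval₂Hom (Int.castRingHom Lazard) (degreeGenerator lazardFGL.toPowerSeries)

theorem lazardPoly_X (k : ℕ) :
    lazardPoly (MvPolynomial.X k) = degreeGenerator lazardFGL.toPowerSeries k := by
  simp [lazardPoly]

/-- By induction on the degree every coefficient of the universal law lies in the range. Modulo the
range, the coefficients of degree `k + 2` form a symmetric cocycle, and its Bézout combination
vanishes because it is the image of a variable. -/
theorem lazardPoly_surjective : Function.Surjective lazardPoly := by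
  rw [← RingHom.range_eq_top]
  refine subring_eq_top_of_coeff_mem _ fun d => ?_
  set T := lazardPoly.range with hT
  induction h : d.degree using Nat.strong_induction_on generalizing d with
  | _ N ih =>
  subst h
  have hpure : ∀ k, coeff (bideg 0 k) lazardFGL.toPowerSeries ∈ T := by
    intro k
    rw [coeff_zero_left]
    split_ifs
    exacts [T.one_mem, T.zero_mem]
  rw [← bideg_self d]
  rcases Nat.eq_zero_or_pos (d 0) with h0 | h0
  · rw [h0]; exact hpure _
  rcases Nat.eq_zero_or_pos (d 1) with h1 | h1
  · rw [h1, coeff_symm]; exact hpure _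
  obtain ⟨k, hk⟩ : ∃ k, d 0 + d 1 = k + 2 := ⟨d 0 + d 1 - 2, by omega⟩
  rw [degree_fin_two, hk] at ih
  obtain ⟨q, hq, hq1⟩ := exists_chooseQuot k
  -- `T` is a subring and not an ideal, so only the additive quotient makes sense; the comparison
  -- lemma needs no more.
  let mk : Lazard →+ Lazard ⧸ T.toAddSubgroup := QuotientAddGroup.mk' T.toAddSubgroup
  have hmk : ∀ x, mk x = 0 ↔ x ∈ T := fun x => QuotientAddGroup.eq_zero_iff x
  have hcoc : IsSymmCocycle (k + 2)
      fun i => mk (coeff (bideg i (k + 2 - i)) lazardFGL.toPowerSeries) := by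
    refine ⟨fun i hi hik => ?_, fun i j hi hj hij => ?_⟩
    · dsimp only
      rw [coeff_symm, Nat.sub_sub_self hik.le]
    · dsimp only
      have := choose_mul_coeff_sub_mem lazardFGL T (i := i) (j := j) (k := k + 2 - (i + j)) hi
        (by omega) (fun d' hd' => ih _ (by omega) d' rfl)
      rw [← hmk, map_sub, sub_eq_zero, ← nsmul_eq_mul, ← nsmul_eq_mul, map_nsmul, map_nsmul,
        show j + (k + 2 - (i + j)) = k + 2 - i by omega] at this
      exact this
  have h := hcoc.eq_zero (by omega) (chooseGcd_ne_zero k) hq hq1 (by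
    simp_rw [← map_zsmul]
    rw [← map_sum, hmk]
    exact ⟨MvPolynomial.X k, lazardPoly_X k⟩) (d 0) h0 (by omega)
  rw [hmk] at h
  rwa [show d 1 = k + 2 - d 0 by omega]

/-! ### Formal group laws with a logarithm -/

section LogarithmicGroup

variable {R : Type*} [CommRing R]

theorem exists_compositional_inverse {E : PowerSeries R} (h0 : PowerSeries.constantCoeff E = 0)
    (h1 : PowerSeries.coeff 1 E = 1) : ∃ l : PowerSeries R, PowerSeries.constantCoeff l = 0 ∧
    PowerSeries.coeff 1 l = 1 ∧ E.subst l = PowerSeries.X ∧ l.subst E = PowerSeries.X := by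
  have hu : IsUnit (PowerSeries.coeff 1 E) := h1 ▸ isUnit_one
  have hc := PowerSeries.constantCoeff_substInvOfIsUnit E hu
  have hE := PowerSeries.subst_substInvOfIsUnit_right E h0 hu
  have hl := PowerSeries.subst_substInvOfIsUnit_left E h0 hu
  refine ⟨E.substInvOfIsUnit hu, hc, ?_, hE, hl⟩
  rw [PowerSeries.coeff_one_substInvOfIsUnit]
  have : hu.unit = 1 := Units.ext h1
  rw [this, inv_one, Units.val_one]

/-- The series `E(l(u) + l(v))`. -/
noncomputable def logSeries (E l : PowerSeries R) : MvPowerSeries (Fin 2) R :=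
  PowerSeries.subst (PowerSeries.subst (X 0 : MvPowerSeries (Fin 2) R) l +
    PowerSeries.subst (X 1 : MvPowerSeries (Fin 2) R) l) E

variable {E l : PowerSeries R}

theorem constantCoeff_psubst {σ : Type*} {a : MvPowerSeries σ R} (ha : constantCoeff a = 0)
    (hl : PowerSeries.constantCoeff l = 0) : constantCoeff (PowerSeries.subst a l) = 0 :=
  PowerSeries.constantCoeff_subst_eq_zero ha l hl

theorem psubst_subst {σ τ : Type*} {a : MvPowerSeries σ R} (ha : constantCoeff a = 0)
    {b : σ → MvPowerSeries τ R} (hb : HasSubst b) (f : PowerSeries R) :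
    (PowerSeries.subst a f).subst b = PowerSeries.subst (a.subst b) f := by
  rw [PowerSeries.subst, PowerSeries.subst, subst_comp_subst_apply _ hb]
  exact (PowerSeries.HasSubst.of_constantCoeff_zero ha).const

theorem psubst_psubst {σ : Type*} {a : MvPowerSeries σ R} (ha : constantCoeff a = 0)
    (hl : PowerSeries.constantCoeff l = 0) (f : PowerSeries R) :
    PowerSeries.subst (PowerSeries.subst a l) f = PowerSeries.subst a (f.subst l) := by
  rw [PowerSeries.subst_comp_subst_apply]
  · exact PowerSeries.HasSubst.of_constantCoeff_zero' hl
  · exact PowerSeries.HasSubst.of_constantCoeff_zero ha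

theorem logSeries_subst {τ : Type*} (hl : PowerSeries.constantCoeff l = 0)
    {a b : MvPowerSeries τ R} (ha : constantCoeff a = 0) (hb : constantCoeff b = 0) :
    (logSeries E l).subst ![a, b] =
      PowerSeries.subst (PowerSeries.subst a l + PowerSeries.subst b l) E := by
  have hs : HasSubst ![a, b] := hasSubst_of_constantCoeff_zero fun s => by
    fin_cases s
    exacts [ha, hb]
  rw [logSeries, psubst_subst _ hs, subst_add hs, psubst_subst (constantCoeff_X _) hs,
    psubst_subst (constantCoeff_X _) hs, subst_X hs, subst_X hs]
  · rfl
  · rw [map_add, constantCoeff_psubst (constantCoeff_X _) hl,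
      constantCoeff_psubst (constantCoeff_X _) hl, add_zero]

theorem coeff_logSeries (hl : PowerSeries.constantCoeff l = 0) (d : Fin 2 →₀ ℕ) :
    coeff d (logSeries E l) = ∑ k ∈ Finset.range (d.degree + 1), PowerSeries.coeff k E *
      coeff d ((PowerSeries.subst (X 0 : MvPowerSeries (Fin 2) R) l +
        PowerSeries.subst (X 1 : MvPowerSeries (Fin 2) R) l) ^ k) := by
  have hG : constantCoeff (PowerSeries.subst (X 0 : MvPowerSeries (Fin 2) R) l +
        PowerSeries.subst (X 1 : MvPowerSeries (Fin 2) R) l) = 0 := by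
    rw [map_add, constantCoeff_psubst (constantCoeff_X _) hl,
      constantCoeff_psubst (constantCoeff_X _) hl, add_zero]
  rw [logSeries, PowerSeries.coeff_subst (PowerSeries.HasSubst.of_constantCoeff_zero hG)]
  simp_rw [smul_eq_mul]
  refine finsum_eq_sum_of_support_subset _ fun k hk => ?_
  rw [Function.mem_support] at hk
  rw [Finset.coe_range, Set.mem_Iio, Nat.lt_succ_iff]
  by_contra! h
  refine hk ((congrArg _ (coeff_of_lt_order ?_)).trans (mul_zero _))
  refine lt_of_lt_of_le ?_ (le_order_pow_of_constantCoeff_eq_zero _ hG)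
  exact_mod_cast h

theorem coeff_psubst_X {σ : Type*} [DecidableEq σ] (s : σ) (f : PowerSeries R) (e : σ →₀ ℕ) :
    coeff e (PowerSeries.subst (X s : MvPowerSeries σ R) f) =
      if e = Finsupp.single s (e s) then PowerSeries.coeff (e s) f else 0 :=
  PowerSeries.coeff_subst_single s f e

theorem coeff_logSeries_of_degree_eq_one (h0 : PowerSeries.constantCoeff E = 0)
    (h1 : PowerSeries.coeff 1 E = 1)
    (hl : PowerSeries.constantCoeff l = 0) (hl1 : PowerSeries.coeff 1 l = 1) (s : Fin 2) :
    coeff (Finsupp.single s 1) (logSeries E l) = 1 := by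
  rw [coeff_logSeries hl, Finsupp.degree_single, Finset.sum_range_succ, Finset.sum_range_one, h1,
    PowerSeries.coeff_zero_eq_constantCoeff_apply, h0, zero_mul, zero_add, one_mul, pow_one,
    map_add, coeff_psubst_X, coeff_psubst_X]
  fin_cases s <;> simp [hl1]

/-- The formal group law `E(l(u) + l(v))` with exponential `E` and logarithm `l`. -/
noncomputable def logFGL (h0 : PowerSeries.constantCoeff E = 0) (h1 : PowerSeries.coeff 1 E = 1)
    (hl : PowerSeries.constantCoeff l = 0) (hl1 : PowerSeries.coeff 1 l = 1)
    (hlE : l.subst E = PowerSeries.X) : FormalGroup R where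
  toPowerSeries := logSeries E l
  zero_constantCoeff := by
    refine constantCoeff_psubst ?_ h0
    rw [map_add, constantCoeff_psubst (constantCoeff_X _) hl,
      constantCoeff_psubst (constantCoeff_X _) hl, add_zero]
  lin_coeff_X := coeff_logSeries_of_degree_eq_one h0 h1 hl hl1 0
  lin_coeff_Y := coeff_logSeries_of_degree_eq_one h0 h1 hl hl1 1
  assoc := by
    have hX : ∀ s : Fin 3, constantCoeff (X s : MvPowerSeries (Fin 3) R) = 0 :=
      fun s => constantCoeff_X s
    have hG : ∀ s t : Fin 3, constantCoeff
        (PowerSeries.subst (X s : MvPowerSeries (Fin 3) R) l +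
          PowerSeries.subst (X t : MvPowerSeries (Fin 3) R) l) = 0 := fun s t => by
      rw [map_add, constantCoeff_psubst (hX _) hl, constantCoeff_psubst (hX _) hl, add_zero]
    have hE : ∀ s t : Fin 3, PowerSeries.subst (PowerSeries.subst
        (PowerSeries.subst (X s : MvPowerSeries (Fin 3) R) l +
          PowerSeries.subst (X t : MvPowerSeries (Fin 3) R) l) E) l =
        PowerSeries.subst (X s : MvPowerSeries (Fin 3) R) l +
          PowerSeries.subst (X t : MvPowerSeries (Fin 3) R) l := fun s t => by
      rw [psubst_psubst (hG s t) h0, hlE,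
        PowerSeries.subst_X (PowerSeries.HasSubst.of_constantCoeff_zero (hG s t))]
    rw [logSeries_subst hl (hX _) (hX _), logSeries_subst hl (hX _) (hX _),
      logSeries_subst hl (constantCoeff_psubst (hG _ _) h0) (hX _),
      logSeries_subst hl (hX _) (constantCoeff_psubst (hG _ _) h0), hE, hE, add_assoc]

/-- Comparing coefficients of `t ^ m` in `E(l(t)) = t` isolates `l_m`. For `k ≥ 2` the power `l ^ k
= t ^ k (l / t) ^ k` involves only the `l_j` with `j ≤ m - k + 1 < m`. -/
theorem coeff_compositional_inverse_mem (hl : PowerSeries.constantCoeff l = 0)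
    (hEl : E.subst l = PowerSeries.X) (h1 : PowerSeries.coeff 1 E = 1) (T : Subring R) (N : ℕ)
    (hT : ∀ k < N, PowerSeries.coeff k E ∈ T) (m : ℕ) (hm : m < N) : PowerSeries.coeff m l ∈ T := by
  induction m using Nat.strong_induction_on with
  | _ m ih =>
  rcases Nat.eq_zero_or_pos m with rfl | hm0
  · rw [PowerSeries.coeff_zero_eq_constantCoeff_apply, hl]; exact T.zero_mem
  have h := congrArg (PowerSeries.coeff m) hEl
  rw [PowerSeries.coeff_subst' (PowerSeries.HasSubst.of_constantCoeff_zero' hl),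
    finsum_eq_sum_of_support_subset (s := Finset.range (m + 1)),
    ← Finset.add_sum_erase _ _ (Finset.mem_range.2 (by omega : 1 < m + 1)), h1, one_smul,
    pow_one] at h
  · rw [eq_sub_of_add_eq h]
    refine T.sub_mem ?_ (T.sum_mem fun k hk => ?_)
    · rw [PowerSeries.coeff_X]
      split_ifs
      exacts [T.one_mem, T.zero_mem]
    · rw [Finset.mem_erase, Finset.mem_range] at hk
      rw [smul_eq_mul]
      refine T.mul_mem (hT k (by omega)) ?_
      rcases Nat.eq_zero_or_pos k with rfl | hk0
      · rw [pow_zero, PowerSeries.coeff_one]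
        split_ifs
        exacts [T.one_mem, T.zero_mem]
      · obtain ⟨k, rfl⟩ : ∃ k', k = k' + 2 := ⟨k - 2, by omega⟩
        obtain ⟨g, rfl⟩ := PowerSeries.X_dvd_iff.2 hl
        have hg : ∀ j, PowerSeries.coeff j g = PowerSeries.coeff (j + 1) (PowerSeries.X * g) :=
          fun j => (PowerSeries.coeff_succ_X_mul j g).symm
        rw [mul_pow, PowerSeries.coeff_X_pow_mul']
        split_ifs with hkm
        · refine coeff_pow_mem T g (k + 2) _ fun d' hd' => ?_
          have hle : d' () ≤ m - (k + 2) := by simpa using hd' ()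
          have := hg (d' ())
          rw [PowerSeries.coeff_def (s := d') rfl] at this
          rw [this]
          exact ih _ (by omega) (by omega)
        · exact T.zero_mem
  · intro k hk
    rw [Function.mem_support] at hk
    rw [Finset.coe_range, Set.mem_Iio, Nat.lt_succ_iff]
    by_contra! hlt
    refine hk ?_
    obtain ⟨g, rfl⟩ := PowerSeries.X_dvd_iff.2 hl
    rw [mul_pow, PowerSeries.coeff_X_pow_mul', if_neg (by omega), smul_zero]

/-- The mixed coefficients of `E(l(u) + l(v))` of degree `N` are binomial multiples of the
coefficient of degree `N` of `E`, modulo the lower coefficients. -/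
theorem coeff_logSeries_sub_mem (hl : PowerSeries.constantCoeff l = 0)
    (hl1 : PowerSeries.coeff 1 l = 1) (hEl : E.subst l = PowerSeries.X)
    (h1 : PowerSeries.coeff 1 E = 1) (T : Subring R) {i j : ℕ} (hi : 0 < i) (hj : 0 < j)
    (hT : ∀ k < i + j, PowerSeries.coeff k E ∈ T) :
    coeff (bideg i j) (logSeries E l) -
      ((i + j).choose i : ℕ) * PowerSeries.coeff (i + j) E ∈ T := by
  have hlT := coeff_compositional_inverse_mem hl hEl h1 T (i + j) hT
  rw [coeff_logSeries hl, degree_bideg, Finset.sum_range_succ]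
  have htop : coeff (bideg i j) ((PowerSeries.subst (X 0 : MvPowerSeries (Fin 2) R) l +
      PowerSeries.subst (X 1 : MvPowerSeries (Fin 2) R) l) ^ (i + j)) =
      ((i + j).choose i : ℕ) := by
    have := coeff_degree_pow_eq (G := PowerSeries.subst (X 0 : MvPowerSeries (Fin 2) R) l +
      PowerSeries.subst (X 1 : MvPowerSeries (Fin 2) R) l) ?_ ?_ ?_ (bideg i j)
    · rwa [degree_bideg, bideg_zero] at this
    · rw [map_add, constantCoeff_psubst (constantCoeff_X _) hl,
        constantCoeff_psubst (constantCoeff_X _) hl, add_zero]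
    all_goals rw [map_add, coeff_psubst_X, coeff_psubst_X]; simp [hl1]
  rw [htop, mul_comm _ (Nat.cast _), add_sub_cancel_right]
  refine T.sum_mem fun k hk => T.mul_mem (hT k (Finset.mem_range.1 hk))
    (coeff_pow_mem T _ _ _ fun d' hd' => ?_)
  -- The series `l(u) + l(v)` has only pure terms, and a pure exponent below `(i, j)` has degree at
  -- most `i` or `j`. Both are positive, so the coefficient of `l` of degree `i + j` never enters.
  rw [map_add, coeff_psubst_X, coeff_psubst_X]
  have hd0 : d' 0 ≤ i := by simpa using hd' 0
  have hd1 : d' 1 ≤ j := by simpa using hd' 1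
  refine T.add_mem ?_ ?_ <;> split_ifs
  exacts [hlT _ (by omega), T.zero_mem, hlT _ (by omega), T.zero_mem]

end LogarithmicGroup

/-! ### The universal property and torsion-freeness -/

section UniversalProperty

variable {R : Type*} [CommRing R] (F : FormalGroup R)

/-- The coefficients of a formal group law, as a ring homomorphism. -/
noncomputable def coeffHom : MvPolynomial (ℕ × ℕ) ℤ →+* R :=
  MvPolynomial.eval₂Hom (Int.castRingHom R)
    fun ij => coeff (bideg (ij.1 + 1) (ij.2 + 1)) F.toPowerSeries

theorem coeffHom_X (ij : ℕ × ℕ) : coeffHom F (MvPolynomial.X ij) =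
    coeff (bideg (ij.1 + 1) (ij.2 + 1)) F.toPowerSeries := by
  simp [coeffHom]

variable [F.IsComm]

theorem map_coeffHom_genericSeries : genericSeries.map (coeffHom F) = F.toPowerSeries := by
  ext d
  rw [coeff_map]
  change coeffHom F (genericSeries d) = _
  rw [← bideg_self d]
  rcases hi : d 0 with _ | i
  · rw [coeff_zero_left]
    simp only [genericSeries, bideg_zero, bideg_one, true_or, if_true, zero_add]
    split_ifs <;> simp
  · rcases hj : d 1 with _ | j
    · rw [coeff_symm, coeff_zero_left]
      simp only [genericSeries, bideg_zero, bideg_one, or_true, if_true, add_zero]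
      split_ifs <;> simp
    · simp only [genericSeries, bideg_zero, bideg_one]
      simp [coeffHom_X]

theorem coeffHom_eq_zero (a : MvPolynomial (ℕ × ℕ) ℤ) (ha : a ∈ lazardIdeal) :
    coeffHom F a = 0 := by
  refine (Ideal.span_le (I := RingHom.ker (coeffHom F))).2 ?_ ha
  rintro _ (⟨d, rfl⟩ | ⟨ij, rfl⟩)
  · have h1 := HasSubst.cons_subst_zero_left (0 : Fin 3) 1 2 genericSeries_constantCoeff
    have h2 := HasSubst.cons_subst_zero_right (0 : Fin 3) 1 2 genericSeries_constantCoeff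
    have aux (g₁ g₂ : MvPowerSeries (Fin 3) (MvPolynomial (ℕ × ℕ) ℤ)) :
        (fun i => (![g₁, g₂] i).map (coeffHom F)) =
          ![g₁.map (coeffHom F), g₂.map (coeffHom F)] := by
      ext1 i; fin_cases i <;> simp
    have hL : genericAssocLeft.map (coeffHom F) = genericAssocRight.map (coeffHom F) := by
      rw [genericAssocLeft, genericAssocRight, map_subst h1, map_subst h2, aux, aux,
        map_subst HasSubst.X_X, map_subst HasSubst.X_X, aux, aux, map_coeffHom_genericSeries]
      simp only [map_X]
      exact F.assoc
    have := congrArg (coeff d) hL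
    rw [coeff_map, coeff_map] at this
    simpa [RingHom.mem_ker, sub_eq_zero] using this
  · simp only [SetLike.mem_coe, RingHom.mem_ker, map_sub, coeffHom_X]
    rw [coeff_symm, sub_self]

/-- The homomorphism from the Lazard ring which classifies a formal group law. -/
noncomputable def lazardHom : Lazard →+* R :=
  Ideal.Quotient.lift lazardIdeal (coeffHom F) (coeffHom_eq_zero F)

theorem lazardHom_mk (p : MvPolynomial (ℕ × ℕ) ℤ) : lazardHom F (lazardMk p) = coeffHom F p :=
  Ideal.Quotient.lift_mk _ _ _

theorem lazardHom_coeff (d : Fin 2 →₀ ℕ) :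
    lazardHom F (coeff d lazardFGL.toPowerSeries) = coeff d F.toPowerSeries := by
  rw [lazardFGL_coeff, lazardHom_mk]
  conv_rhs => rw [← map_coeffHom_genericSeries F, coeff_map]
  rfl

theorem lazardHom_degreeGenerator (k : ℕ) :
    lazardHom F (degreeGenerator lazardFGL.toPowerSeries k) =
      degreeGenerator F.toPowerSeries k := by
  simp_rw [degreeGenerator, map_sum, map_zsmul, lazardHom_coeff]

end UniversalProperty

/-- The generic exponential series `t + b₀ t ^ 2 + b₁ t ^ 3 + ⋯`. -/
noncomputable def genericExp : PowerSeries (MvPolynomial ℕ ℤ) := PowerSeries.mk fun n =>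
  match n with
  | 0 => 0
  | 1 => 1
  | n + 2 => MvPolynomial.X n

/-- `ρ` classifies `E(l(u) + l(v))` for the generic `E`. Its mixed coefficients of degree `k + 2`
are `(k + 2).choose i` times the variable `k`, modulo earlier variables, so the Bézout combination
of them yields the gcd times that variable. -/
theorem exists_triangular_hom : ∃ ρ : Lazard →+* MvPolynomial ℕ ℤ, ∀ k,
    ρ (lazardPoly (MvPolynomial.X k)) - chooseGcd k • MvPolynomial.X k ∈
      Subring.closure {x : MvPolynomial ℕ ℤ | ∃ j < k, MvPolynomial.X j = x} := by
  have h0 : PowerSeries.constantCoeff genericExp = 0 := by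
    rw [← PowerSeries.coeff_zero_eq_constantCoeff_apply, genericExp, PowerSeries.coeff_mk]
  have h1 : PowerSeries.coeff 1 genericExp = 1 := by rw [genericExp, PowerSeries.coeff_mk]
  obtain ⟨l, hl, hl1, hEl, hlE⟩ := exists_compositional_inverse h0 h1
  let F := logFGL h0 h1 hl hl1 hlE
  have hF : F.IsComm := ⟨by
    change logSeries genericExp l = (logSeries genericExp l).subst ![X 1, X 0]
    rw [logSeries_subst hl (constantCoeff_X _) (constantCoeff_X _), add_comm, logSeries]⟩
  refine ⟨lazardHom F, fun k => ?_⟩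
  set T := Subring.closure {x : MvPolynomial ℕ ℤ | ∃ j < k, MvPolynomial.X j = x}
  obtain ⟨q, hq, hq1⟩ := exists_chooseQuot k
  have hT : ∀ m < k + 2, PowerSeries.coeff m genericExp ∈ T := by
    intro m hm
    rcases m with _ | _ | m
    · rw [PowerSeries.coeff_zero_eq_constantCoeff_apply, h0]; exact T.zero_mem
    · rw [h1]; exact T.one_mem
    · rw [genericExp, PowerSeries.coeff_mk]
      exact Subring.subset_closure ⟨m, by omega, rfl⟩
  have hk : PowerSeries.coeff (k + 2) genericExp = MvPolynomial.X k := by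
    rw [genericExp, PowerSeries.coeff_mk]
  have hsum : chooseGcd k • (MvPolynomial.X k : MvPolynomial ℕ ℤ) =
      ∑ i ∈ Finset.Ioo 0 (k + 2), chooseBezout k i •
        (((k + 2).choose i : ℕ) * PowerSeries.coeff (k + 2) genericExp) := by
    have : ∀ i ∈ Finset.Ioo 0 (k + 2), chooseBezout k i •
        (((k + 2).choose i : ℕ) * PowerSeries.coeff (k + 2) genericExp) =
        (chooseBezout k i * q i) • chooseGcd k • (MvPolynomial.X k : MvPolynomial ℕ ℤ) := by
      intro i hi
      rw [Finset.mem_Ioo] at hi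
      rw [hk, ← Int.cast_natCast, ← zsmul_eq_mul, hq i hi.1 hi.2, smul_smul, smul_smul]
      congr 1; ring
    rw [Finset.sum_congr rfl this, ← Finset.sum_smul, hq1, one_smul]
  rw [lazardPoly_X, lazardHom_degreeGenerator, degreeGenerator, hsum, ← Finset.sum_sub_distrib]
  refine T.sum_mem fun i hi => ?_
  rw [Finset.mem_Ioo] at hi
  rw [← smul_sub]
  refine zsmul_mem ?_ _
  have := coeff_logSeries_sub_mem hl hl1 hEl h1 T (i := i) (j := k + 2 - i) hi.1 (by omega)
    (fun m hm => hT m (by omega))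
  rwa [show i + (k + 2 - i) = k + 2 by omega] at this

/-- Over `ℚ` the diagonal entries `d k` are invertible, so the triangular system is solved
recursively: the `k`-th equation involves, besides `d k • z k`, only the `z j` with `j < k`. -/
theorem exists_solution_triangular (f : ℕ → MvPolynomial ℕ ℤ) (d : ℕ → ℤ) (hd : ∀ k, d k ≠ 0)
    (hf : ∀ k, f k - d k • MvPolynomial.X k ∈
      Subring.closure {x : MvPolynomial ℕ ℤ | ∃ j < k, MvPolynomial.X j = x}) :
    ∃ z : ℕ → MvPolynomial ℕ ℚ, ∀ k, MvPolynomial.eval₂ (Int.castRingHom _) z (f k) =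
      MvPolynomial.X k := by
  let z : ℕ → MvPolynomial ℕ ℚ := fun k => Nat.strongRec (motive := fun _ => MvPolynomial ℕ ℚ)
    (fun k ih => MvPolynomial.C ((d k : ℚ)⁻¹) * (MvPolynomial.X k -
      MvPolynomial.eval₂ (Int.castRingHom _) (fun j => if h : j < k then ih j h else 0)
        (f k - d k • MvPolynomial.X k))) k
  have hz : ∀ k, z k = MvPolynomial.C ((d k : ℚ)⁻¹) * (MvPolynomial.X k -
      MvPolynomial.eval₂ (Int.castRingHom _) (fun j => if j < k then z j else 0)
        (f k - d k • MvPolynomial.X k)) := by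
    intro k
    conv_lhs => simp only [z]
    rw [Nat.strongRec_eq]
    rfl
  have hagree : ∀ k, MvPolynomial.eval₂ (Int.castRingHom _) (fun j => if j < k then z j else 0)
        (f k - d k • MvPolynomial.X k) =
      MvPolynomial.eval₂ (Int.castRingHom _) z (f k - d k • MvPolynomial.X k) := by
    intro k
    have h := hf k
    have hle : Subring.closure {x : MvPolynomial ℕ ℤ | ∃ j < k, MvPolynomial.X j = x} ≤
        RingHom.eqLocus (MvPolynomial.eval₂Hom (Int.castRingHom _)
          (fun j => if j < k then z j else 0)) (MvPolynomial.eval₂Hom (Int.castRingHom _) z) := by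
      rw [Subring.closure_le]
      rintro _ ⟨j, hj, rfl⟩
      simp [RingHom.eqLocus, hj]
    exact hle h
  refine ⟨z, fun k => ?_⟩
  have h := hz k
  rw [hagree] at h
  have hC : MvPolynomial.C (d k : ℚ) * z k = MvPolynomial.X k -
      MvPolynomial.eval₂ (Int.castRingHom _) z (f k - d k • MvPolynomial.X k) := by
    rw [h, ← mul_assoc, ← MvPolynomial.C_mul, mul_inv_cancel₀ (by exact_mod_cast hd k),
      MvPolynomial.C_1, one_mul]
  rw [MvPolynomial.eval₂_sub, zsmul_eq_mul, MvPolynomial.eval₂_mul, MvPolynomial.eval₂_X] at hC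
  have hint : MvPolynomial.eval₂ (Int.castRingHom (MvPolynomial ℕ ℚ)) z (d k : MvPolynomial ℕ ℤ) =
      MvPolynomial.C (d k : ℚ) := by
    rw [← MvPolynomial.coe_eval₂Hom, map_intCast]
    simp
  rw [hint] at hC
  linear_combination hC

/-- Followed by `ρ` and by the rational solution of the triangular system, `lazardPoly` becomes the
inclusion of `ℤ[x]` into `ℚ[x]`. -/
theorem lazardPoly_injective : Function.Injective lazardPoly := by
  obtain ⟨ρ, hρ⟩ := exists_triangular_hom
  obtain ⟨z, hz⟩ := exists_solution_triangular _ _ chooseGcd_ne_zero hρ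
  have hcomp : ((MvPolynomial.eval₂Hom (Int.castRingHom (MvPolynomial ℕ ℚ)) z).comp ρ).comp
      lazardPoly = MvPolynomial.map (Int.castRingHom ℚ) := by
    refine MvPolynomial.ringHom_ext (fun r => by simp) fun k => ?_
    simpa using hz k
  have hinj : Function.Injective (MvPolynomial.map (σ := ℕ) (Int.castRingHom ℚ)) :=
    MvPolynomial.map_injective _ Int.cast_injective
  rw [← hcomp] at hinj
  rw [RingHom.coe_comp] at hinj
  exact Function.Injective.of_comp hinj

/-- Lazard's theorem: the Lazard ring is a polynomial ring. -/
noncomputable def lazardEquiv : MvPolynomial ℕ ℤ ≃+* Lazard :=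
  RingEquiv.ofBijective lazardPoly ⟨lazardPoly_injective, lazardPoly_surjective⟩

instance : IsDomain Lazard := lazardEquiv.symm.toMulEquiv.isDomain _

instance : CharZero Lazard :=
  charZero_of_injective_ringHom (f := lazardEquiv.symm.symm.toRingHom) lazardEquiv.injective

theorem prime_two_lazard : Prime (2 : Lazard) := by
  have h : Prime (2 : MvPolynomial ℕ ℤ) := by
    have := (MvPolynomial.prime_C_iff (σ := ℕ) (r := (2 : ℤ))).2 Int.prime_two
    simpa using this
  have := (MulEquiv.prime_iff lazardEquiv.toMulEquiv).2 h
  rwa [show lazardEquiv.toMulEquiv 2 = 2 from map_ofNat lazardEquiv 2] at this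

/-- In degree two there is a single middle binomial coefficient, so the first polynomial generator
is an integral multiple of `a_{1,1}`; and `2` does not divide a variable. -/
theorem not_two_dvd_coeff_lazardFGL :
    ¬ (2 : Lazard) ∣ coeff (bideg 1 1) lazardFGL.toPowerSeries := by
  intro h
  have h1 : (2 : Lazard) ∣ lazardEquiv (MvPolynomial.X 0) := by
    change (2 : Lazard) ∣ lazardPoly (MvPolynomial.X 0)
    rw [lazardPoly_X, degreeGenerator]
    refine Finset.dvd_sum fun i hi => ?_
    rw [Finset.mem_Ioo] at hi
    rw [show i = 1 by omega, zsmul_eq_mul]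
    exact h.mul_left _
  have h2 : (MvPolynomial.C 2 : MvPolynomial ℕ ℤ) ∣ MvPolynomial.X 0 := by
    have := map_dvd lazardEquiv.symm h1
    rwa [RingEquiv.symm_apply_apply, map_ofNat] at this
  have h3 := (MvPolynomial.C_dvd_iff_dvd_coeff _ _).1 h2 (Finsupp.single 0 1)
  rw [MvPolynomial.coeff_X] at h3
  norm_num at h3

/-! ### Substitution homomorphisms -/

section EvalHom

variable {R : Type*} [CommRing R] {σ τ υ : Type*} [Finite σ]

/-- Substitution of power series without constant term, as an algebra homomorphism. -/
noncomputable def evalHom (z : σ → MvPowerSeries τ R) (hz : ∀ s, constantCoeff (z s) = 0) :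
    MvPowerSeries σ R →ₐ[R] MvPowerSeries τ R :=
  substAlgHom (hasSubst_of_constantCoeff_zero hz)

variable {z : σ → MvPowerSeries τ R} (hz : ∀ s, constantCoeff (z s) = 0)

theorem evalHom_apply (f : MvPowerSeries σ R) : evalHom z hz f = f.subst z :=
  substAlgHom_apply _ f

@[simp] theorem evalHom_X (s : σ) : evalHom z hz (X s) = z s := by
  rw [evalHom_apply, subst_X (hasSubst_of_constantCoeff_zero hz)]

theorem constantCoeff_evalHom {f : MvPowerSeries σ R} (hf : constantCoeff f = 0) :
    constantCoeff (evalHom z hz f) = 0 := by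
  rw [evalHom_apply]
  exact constantCoeff_subst_eq_zero (hasSubst_of_constantCoeff_zero hz) hz hf

theorem evalHom_evalHom [Finite τ] {w : τ → MvPowerSeries υ R}
    (hw : ∀ s, constantCoeff (w s) = 0) (f : MvPowerSeries σ R) :
    evalHom w hw (evalHom z hz f) =
      evalHom (fun s => evalHom w hw (z s)) (fun s => constantCoeff_evalHom hw (hz s)) f := by
  simp only [evalHom_apply]
  rw [subst_comp_subst_apply (hasSubst_of_constantCoeff_zero hz)
    (hasSubst_of_constantCoeff_zero hw)]

theorem evalHom_congr {w : σ → MvPowerSeries τ R} (hw : ∀ s, constantCoeff (w s) = 0)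
    (h : ∀ s, z s = w s) (f : MvPowerSeries σ R) : evalHom z hz f = evalHom w hw f := by
  obtain rfl : z = w := funext h
  rfl

theorem evalHom_X_self (hX : ∀ s : σ, constantCoeff (X s : MvPowerSeries σ R) = 0)
    (f : MvPowerSeries σ R) : evalHom X hX f = f := by
  rw [evalHom_apply]
  exact congrFun subst_self f

theorem coeff_evalHom (f : MvPowerSeries σ R) (d : τ →₀ ℕ) :
    coeff d (evalHom z hz f) =
      finsum fun e => coeff e f * coeff d (e.prod fun s k => z s ^ k) := by
  rw [evalHom_apply, coeff_subst (hasSubst_of_constantCoeff_zero hz)]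
  rfl

theorem evalHom_psubst {a : MvPowerSeries σ R} (ha : constantCoeff a = 0) (f : PowerSeries R) :
    evalHom z hz (PowerSeries.subst a f) = PowerSeries.subst (evalHom z hz a) f := by
  rw [evalHom_apply, evalHom_apply, psubst_subst ha (hasSubst_of_constantCoeff_zero hz)]

/-! ### Divisibility by variables and by differences of variables -/

section SetZero

variable [DecidableEq σ]

/-- Setting one variable to zero. -/
noncomputable def setZero (i : σ) : MvPowerSeries σ R →ₐ[R] MvPowerSeries σ R :=
  evalHom (fun s => if s = i then 0 else X s) fun s => by split_ifs <;> simp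

@[simp] theorem setZero_X_of_ne {i s : σ} (h : s ≠ i) :
    setZero i (X s : MvPowerSeries σ R) = X s := by
  simp [setZero, h]

theorem coeff_setZero (i : σ) (f : MvPowerSeries σ R) (d : σ →₀ ℕ) :
    coeff d (setZero i f) = if d i = 0 then coeff d f else 0 := by
  have hterm : ∀ e : σ →₀ ℕ,
      coeff d (e.prod fun s k => (if s = i then 0 else X s : MvPowerSeries σ R) ^ k) =
        if e i = 0 ∧ e = d then 1 else 0 := by
    intro e
    by_cases hei : e i = 0
    · have : (e.prod fun s k => (if s = i then 0 else X s : MvPowerSeries σ R) ^ k) =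
          monomial e 1 := by
        rw [monomial_one_eq]
        refine Finsupp.prod_congr fun s hs => ?_
        rw [if_neg]
        rintro rfl
        exact Finsupp.mem_support_iff.1 hs hei
      rw [this, coeff_monomial]
      simp only [hei, true_and, eq_comm]
    · rw [Finsupp.prod, Finset.prod_eq_zero (Finsupp.mem_support_iff.2 hei)]
      · simp [hei]
      · simp [zero_pow hei]
  rw [setZero, coeff_evalHom]
  simp_rw [hterm]
  rw [finsum_eq_single _ d]
  · simp
  · intro e he
    simp [he]

theorem X_dvd_iff_setZero (i : σ) (f : MvPowerSeries σ R) : X i ∣ f ↔ setZero i f = 0 := by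
  rw [X_dvd_iff]
  refine ⟨fun h => ?_, fun h m hm => ?_⟩
  · ext d
    rw [coeff_setZero]
    split_ifs with hd
    · rw [h d hd, map_zero]
    · rw [map_zero]
  · have := congrArg (coeff m) h
    rwa [coeff_setZero, if_pos hm, map_zero] at this

/-- Setting the variable `b` equal to the variable `a`. -/
noncomputable def identify (a b : σ) : MvPowerSeries σ R →ₐ[R] MvPowerSeries σ R :=
  evalHom (fun s => if s = b then X a else X s) fun s => by split_ifs <;> simp

/-- The invertible shear `x_b ↦ x_b + x_a` carries `x_b - x_a` to `x_b`, which reduces the claim to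
`X_dvd_iff_setZero`. -/
theorem X_sub_X_dvd_iff {a b : σ} (hab : a ≠ b) (f : MvPowerSeries σ R) :
    X b - X a ∣ f ↔ identify a b f = 0 := by
  have hz : ∀ c : R, ∀ s, constantCoeff
      (if s = b then X b + C c * X a else X s : MvPowerSeries σ R) = 0 := by
    intro c s; split_ifs <;> simp
  let Φ := evalHom _ (hz 1)
  let Ψ := evalHom _ (hz (-1))
  have hinv : ∀ f, Ψ (Φ f) = f := by
    intro f
    simp only [Ψ, Φ]
    rw [evalHom_evalHom]
    refine (evalHom_congr _ (fun s => constantCoeff_X s) (fun s => ?_) f).trans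
      (evalHom_X_self _ f)
    split_ifs with h
    · subst h
      simp [hab]
    · simp [h]
  have h1 : identify a b f = setZero b (Φ f) := by
    simp only [Φ, identify, setZero]
    rw [evalHom_evalHom]
    refine evalHom_congr _ _ (fun s => ?_) f
    split_ifs with h
    · simp [hab]
    · simp [h]
  rw [h1, ← X_dvd_iff_setZero]
  constructor
  · rintro ⟨g, rfl⟩
    refine ⟨Φ g, ?_⟩
    simp [Φ, hab]
  · rintro ⟨g, hg⟩
    refine ⟨Ψ g, ?_⟩
    rw [← hinv f, hg]
    simp [Ψ, sub_eq_add_neg]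

variable [IsDomain R]

theorem prime_X_var (i : σ) : Prime (X i : MvPowerSeries σ R) := by
  refine ⟨?_, fun h => ?_, fun f g h => ?_⟩
  · intro h
    have := congrArg (coeff (Finsupp.single i 1)) h
    simp at this
  · have := (X_dvd_iff_setZero i 1).1 h.dvd
    rw [map_one] at this
    exact one_ne_zero this
  · rw [X_dvd_iff_setZero, map_mul, mul_eq_zero] at h
    rwa [X_dvd_iff_setZero, X_dvd_iff_setZero]

theorem prime_X_sub_X {a b : σ} (hab : a ≠ b) : Prime (X b - X a : MvPowerSeries σ R) := by
  refine ⟨?_, fun h => ?_, fun f g h => ?_⟩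
  · intro h
    have := congrArg (coeff (Finsupp.single b 1)) h
    rw [map_sub, coeff_X, coeff_X, if_pos rfl, if_neg, map_zero, sub_zero] at this
    · exact one_ne_zero this
    · rw [Finsupp.single_left_inj one_ne_zero]
      exact hab.symm
  · have := (X_sub_X_dvd_iff hab 1).1 h.dvd
    rw [map_one] at this
    exact one_ne_zero this
  · rw [X_sub_X_dvd_iff hab, map_mul, mul_eq_zero] at h
    rwa [X_sub_X_dvd_iff hab, X_sub_X_dvd_iff hab]

end SetZero

end EvalHom

/-! ### Calculus of the universal formal group law -/

section FormalSum

variable {σ τ : Type} {a b c : MvPowerSeries σ Lazard}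

theorem hasSubst_pair (ha : constantCoeff a = 0) (hb : constantCoeff b = 0) :
    HasSubst ![a, b] :=
  hasSubst_of_constantCoeff_zero fun s => by
    fin_cases s
    exacts [ha, hb]

theorem pHasSubst (ha : constantCoeff a = 0) : PowerSeries.HasSubst a :=
  PowerSeries.HasSubst.of_constantCoeff_zero ha

theorem fadd_comm (ha : constantCoeff a = 0) (hb : constantCoeff b = 0) :
    fadd a b = fadd b a :=
  lazardFGL.comm' (pHasSubst ha) (pHasSubst hb)

theorem fadd_assoc (ha : constantCoeff a = 0) (hb : constantCoeff b = 0)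
    (hc : constantCoeff c = 0) : fadd (fadd a b) c = fadd a (fadd b c) :=
  lazardFGL.assoc' (pHasSubst ha) (pHasSubst hb) (pHasSubst hc)

theorem fadd_zero (ha : constantCoeff a = 0) : fadd a 0 = a :=
  lazardFGL.add_zero (pHasSubst ha)

theorem zero_fadd (ha : constantCoeff a = 0) : fadd 0 a = a :=
  lazardFGL.zero_add (pHasSubst ha)

theorem subst_fadd (ha : constantCoeff a = 0) (hb : constantCoeff b = 0)
    {z : σ → MvPowerSeries τ Lazard} (hz : HasSubst z) :
    (fadd a b).subst z = fadd (a.subst z) (b.subst z) := by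
  rw [fadd, fadd, subst_comp_subst_apply (hasSubst_pair ha hb) hz]
  congr 1
  funext s; fin_cases s <;> rfl

theorem constantCoeff_finvSeries : PowerSeries.constantCoeff finvSeries = 0 := by
  rw [← PowerSeries.coeff_zero_eq_constantCoeff_apply, finvSeries, PowerSeries.coeff_mk,
    finvCoeff_zero]

theorem constantCoeff_finv (ha : constantCoeff a = 0) : constantCoeff (finv a) = 0 :=
  constantCoeff_psubst ha constantCoeff_finvSeries

theorem fadd_finv (ha : constantCoeff a = 0) : fadd a (finv a) = 0 := by
  have h := congrArg (MvPowerSeries.subst fun _ : Unit => a) fadd_finvSeries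
  have hz : HasSubst fun _ : Unit => a := (pHasSubst ha).const
  rw [subst_fadd PowerSeries.constantCoeff_X constantCoeff_finvSeries hz] at h
  have h1 : MvPowerSeries.subst (fun _ : Unit => a) (PowerSeries.X : PowerSeries Lazard) = a :=
    PowerSeries.subst_X (pHasSubst ha)
  have h2 : MvPowerSeries.subst (fun _ : Unit => a) (0 : PowerSeries Lazard) = 0 := by
    rw [← substAlgHom_apply hz, map_zero]
  rw [h1, h2] at h
  exact h

theorem finv_fadd (ha : constantCoeff a = 0) : fadd (finv a) a = 0 := by
  rw [fadd_comm (constantCoeff_finv ha) ha, fadd_finv ha]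

theorem finv_finv (ha : constantCoeff a = 0) : finv (finv a) = a := by
  have h1 := constantCoeff_finv ha
  have h2 := constantCoeff_finv h1
  calc finv (finv a) = fadd 0 (finv (finv a)) := (zero_fadd h2).symm
    _ = fadd (fadd a (finv a)) (finv (finv a)) := by rw [fadd_finv ha]
    _ = fadd a (fadd (finv a) (finv (finv a))) := fadd_assoc ha h1 h2
    _ = a := by rw [fadd_finv h1, fadd_zero ha]

theorem finv_zero : finv (0 : MvPowerSeries σ Lazard) = 0 := by
  have h := fadd_finv (a := (0 : MvPowerSeries σ Lazard)) (map_zero _)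
  rwa [zero_fadd (constantCoeff_finv (map_zero _))] at h

variable [Finite σ]

theorem evalHom_fadd (ha : constantCoeff a = 0) (hb : constantCoeff b = 0)
    {z : σ → MvPowerSeries τ Lazard} (hz : ∀ s, constantCoeff (z s) = 0) :
    evalHom z hz (fadd a b) = fadd (evalHom z hz a) (evalHom z hz b) := by
  simp only [evalHom_apply]
  exact subst_fadd ha hb (hasSubst_of_constantCoeff_zero hz)

theorem evalHom_finv (ha : constantCoeff a = 0)
    {z : σ → MvPowerSeries τ Lazard} (hz : ∀ s, constantCoeff (z s) = 0) :
    evalHom z hz (finv a) = finv (evalHom z hz a) :=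
  evalHom_psubst hz ha _

omit [Finite σ] in
/-- `a +_F b = a + b + a b c` for some series `c`. -/
theorem exists_fadd_eq (ha : constantCoeff a = 0) (hb : constantCoeff b = 0) :
    ∃ c, fadd a b = a + b + a * b * c := by
  have hX0 : (X 0 : MvPowerSeries (Fin 2) Lazard) ∣ lazardFGL.toPowerSeries - X 0 - X 1 := by
    rw [X_dvd_iff]
    intro m hm
    rw [map_sub, map_sub, ← bideg_self m, hm, coeff_zero_left, coeff_X, coeff_X]
    by_cases h : m 1 = 1
    · simp [h, bideg, Finsupp.single_left_inj]
    · rw [if_neg h, if_neg, if_neg]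
      · simp
      · intro h'
        exact h (by simpa using DFunLike.congr_fun h' 1)
      · intro h'
        simpa using DFunLike.congr_fun h' 0
  have hX1 : (X 1 : MvPowerSeries (Fin 2) Lazard) ∣ lazardFGL.toPowerSeries - X 0 - X 1 := by
    rw [X_dvd_iff]
    intro m hm
    rw [map_sub, map_sub, ← bideg_self m, hm, coeff_symm, coeff_zero_left, coeff_X, coeff_X]
    by_cases h : m 0 = 1
    · simp [h, bideg, Finsupp.single_left_inj]
    · rw [if_neg h, if_neg, if_neg]
      · simp
      · intro h'
        simpa using DFunLike.congr_fun h' 1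
      · intro h'
        exact h (by simpa using DFunLike.congr_fun h' 0)
  obtain ⟨g, hg⟩ := hX0
  have hX1g : (X 1 : MvPowerSeries (Fin 2) Lazard) ∣ g := by
    rw [hg] at hX1
    refine ((prime_X_var 1).dvd_or_dvd hX1).resolve_left fun h => ?_
    rw [X_dvd_iff_setZero, setZero_X_of_ne (by decide)] at h
    exact (prime_X_var 0).ne_zero h
  obtain ⟨g, rfl⟩ := hX1g
  have hs := hasSubst_pair ha hb
  refine ⟨g.subst ![a, b], ?_⟩
  have hF : lazardFGL.toPowerSeries = X 0 + X 1 + X 0 * X 1 * g := by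
    linear_combination hg
  rw [fadd, hF, subst_add hs, subst_add hs, subst_mul hs, subst_mul hs, subst_X hs, subst_X hs]
  rfl

omit [Finite σ] in
theorem exists_finv_eq (ha : constantCoeff a = 0) :
    ∃ ω, constantCoeff ω = -1 ∧ finv a = a * ω := by
  obtain ⟨c, hc⟩ := exists_fadd_eq ha (constantCoeff_finv ha)
  rw [fadd_finv ha] at hc
  have hu : (1 + a * c) * invOfUnit (1 + a * c) 1 = 1 := by
    apply mul_invOfUnit
    simp [ha]
  refine ⟨-invOfUnit (1 + a * c) 1, by simp, ?_⟩
  linear_combination (-finv a) * hu - invOfUnit (1 + a * c) 1 * hc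

omit [Finite σ] in
/-- `a +_F b̄` is `a - b` up to a unit. -/
theorem exists_fadd_finv_eq (ha : constantCoeff a = 0) (hb : constantCoeff b = 0) :
    ∃ u, constantCoeff u = 1 ∧ fadd a (finv b) = (a - b) * u := by
  have hX : ∀ s : Fin 2, constantCoeff (X s : MvPowerSeries (Fin 2) Lazard) = 0 :=
    fun s => constantCoeff_X s
  have hdvd : (X 0 - X 1 : MvPowerSeries (Fin 2) Lazard) ∣ fadd (X 0) (finv (X 1)) := by
    rw [X_sub_X_dvd_iff (by decide), identify, evalHom_fadd (hX _) (constantCoeff_finv (hX _)),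
      evalHom_finv (hX _)]
    simp [fadd_finv (hX 1)]
  obtain ⟨u, hu⟩ := hdvd
  -- On `x₁ = 0` the identity becomes `x₀ = x₀ u`.
  have hu1 : constantCoeff u = 1 := by
    obtain ⟨ω, -, hω⟩ := exists_finv_eq (hX 1)
    obtain ⟨c, hc⟩ := exists_fadd_eq (hX 0) (constantCoeff_finv (hX 1))
    rw [hc, hω] at hu
    have e1 : (X 1 * (ω + X 0 * ω * c + u) : MvPowerSeries (Fin 2) Lazard) = X 0 * (u - 1) := by
      linear_combination hu
    have h2 : setZero 1 (X 0 * (u - 1) : MvPowerSeries (Fin 2) Lazard) = 0 :=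
      (X_dvd_iff_setZero _ _).1 ⟨_, e1.symm⟩
    rw [map_mul, setZero_X_of_ne (by decide), mul_eq_zero] at h2
    have h3 := congrArg (coeff 0) (h2.resolve_left (prime_X_var 0).ne_zero)
    rw [coeff_setZero, if_pos (by simp), map_zero, coeff_zero_eq_constantCoeff_apply, map_sub,
      map_one] at h3
    exact sub_eq_zero.1 h3
  have hs := hasSubst_pair ha hb
  refine ⟨u.subst ![a, b], ?_, ?_⟩
  · rw [show u = 1 + (u - 1) by ring, subst_add hs, map_add,
      constantCoeff_subst_eq_zero hs (fun s => by fin_cases s; exacts [ha, hb]) (f := u - 1)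
      (by rw [map_sub, hu1, map_one, sub_self]), ← substAlgHom_apply hs, map_one, map_one, add_zero]
  · have h := congrArg (subst ![a, b]) hu
    rw [subst_mul hs, subst_sub hs, subst_X hs, subst_X hs, subst_fadd (hX _)
      (constantCoeff_finv (hX _)) hs, subst_X hs, finv, psubst_subst (hX _) hs, subst_X hs] at h
    exact h

omit [Finite σ] in
theorem exists_fadd_self_eq (ha : constantCoeff a = 0) :
    ∃ u, constantCoeff u = 1 ∧ fadd a a = (a - finv a) * u := by
  have := exists_fadd_finv_eq ha (constantCoeff_finv ha)
  rwa [finv_finv ha] at this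

end FormalSum

/-! ### Iterated sums over the elements of a finite set -/

section SchurSum

variable {σ τ C C' : Type*} [DecidableEq σ] [DecidableEq τ] [CommRing C] [CommRing C']

/-- The sum over all ways to choose distinct `a_1, …, a_r ∈ S` of
`∏ ρ λ_i a_i ∏_i ∏_{b ∈ S \ {a_1, …, a_i}} θ a_i b · β (S \ {a_1, …, a_r})`. -/
def schurSum (β : Finset σ → C) (θ : σ → σ → C) (ρ : ℕ → σ → C) : List ℕ → Finset σ → C
  | [], S => β S
  | k :: L, S => ∑ a ∈ S, ρ k a * (∏ b ∈ S.erase a, θ a b) * schurSum β θ ρ L (S.erase a)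

variable {β β' : Finset σ → C} {θ θ' : σ → σ → C} {ρ ρ' : ℕ → σ → C}

theorem map_schurSum (φ : C →+* C') (L : List ℕ) (S : Finset σ) :
    φ (schurSum β θ ρ L S) =
      schurSum (fun T => φ (β T)) (fun a b => φ (θ a b)) (fun k a => φ (ρ k a)) L S := by
  induction L generalizing S with
  | nil => rfl
  | cons k L ih => simp only [schurSum, map_sum, map_mul, map_prod, ih]

theorem schurSum_congr {L : List ℕ} {S : Finset σ} (hβ : ∀ T ⊆ S, β T = β' T)
    (hθ : ∀ a ∈ S, ∀ b ∈ S, a ≠ b → θ a b = θ' a b) (hρ : ∀ k ∈ L, ∀ a ∈ S, ρ k a = ρ' k a) :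
    schurSum β θ ρ L S = schurSum β' θ' ρ' L S := by
  induction L generalizing S with
  | nil => exact hβ S subset_rfl
  | cons k L ih =>
    refine Finset.sum_congr rfl fun a ha => ?_
    rw [hρ k List.mem_cons_self a ha, Finset.prod_congr rfl fun b hb =>
        hθ a ha b (Finset.mem_of_mem_erase hb) (Finset.ne_of_mem_erase hb).symm,
      ih (fun T hT => hβ T (hT.trans (Finset.erase_subset _ _)))
        (fun a ha b hb => hθ a (Finset.mem_of_mem_erase ha) b (Finset.mem_of_mem_erase hb))
        (fun k hk a ha => hρ k (List.mem_cons_of_mem _ hk) a (Finset.mem_of_mem_erase ha))]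

theorem schurSum_map (f : τ ↪ σ) (L : List ℕ) (S : Finset τ) :
    schurSum β θ ρ L (S.map f) =
      schurSum (fun T => β (T.map f)) (fun a b => θ (f a) (f b)) (fun k a => ρ k (f a)) L S := by
  induction L generalizing S with
  | nil => rfl
  | cons k L ih =>
    simp only [schurSum, Finset.sum_map, ← Finset.map_erase, Finset.prod_map, ih]

theorem schurSum_eq_zero_of_card_lt {L : List ℕ} {S : Finset σ} (h : S.card < L.length) :
    schurSum β θ ρ L S = 0 := by
  induction L generalizing S with
  | nil => simp at h
  | cons k L ih =>
    refine Finset.sum_eq_zero fun a ha => ?_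
    rw [ih, mul_zero]
    rw [Finset.card_erase_of_mem ha]
    rw [List.length_cons] at h
    have := Finset.card_pos.2 ⟨a, ha⟩
    omega

/-- In each summand either one of `i`, `j` is chosen while the other is still present, which gives a
factor `θ i j` or `θ j i`, or both survive into the argument of `β`. -/
theorem dvd_schurSum {p : C} {i j : σ} {L : List ℕ} {S : Finset σ} (hi : i ∈ S) (hj : j ∈ S)
    (hij : i ≠ j) (hβ : ∀ T, i ∈ T → j ∈ T → p ∣ β T) (h1 : p ∣ θ i j) (h2 : p ∣ θ j i) :
    p ∣ schurSum β θ ρ L S := by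
  induction L generalizing S with
  | nil => exact hβ S hi hj
  | cons k L ih =>
    refine Finset.dvd_sum fun a ha => ?_
    by_cases hai : a = i
    · subst hai
      exact Dvd.dvd.mul_right (Dvd.dvd.mul_left (h1.trans
        (Finset.dvd_prod_of_mem _ (Finset.mem_erase.2 ⟨hij.symm, hj⟩))) _) _
    by_cases haj : a = j
    · subst haj
      exact Dvd.dvd.mul_right (Dvd.dvd.mul_left (h2.trans
        (Finset.dvd_prod_of_mem _ (Finset.mem_erase.2 ⟨hij, hi⟩))) _) _
    exact Dvd.dvd.mul_left (ih (Finset.mem_erase.2 ⟨Ne.symm hai, hi⟩)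
      (Finset.mem_erase.2 ⟨Ne.symm haj, hj⟩)) _

/-- A choice of `i` kills its summand, and an unchosen `i` contributes only factors `1`. This
applies at `x_i = 0` and also modulo `g(x_i)`. -/
theorem schurSum_erase {i : σ} {L : List ℕ} {S : Finset σ} (hρ : ∀ k ∈ L, ρ k i = 0)
    (hθ : ∀ a ∈ S, a ≠ i → θ a i = 1) :
    schurSum (fun _ => 1) θ ρ L S = schurSum (fun _ => 1) θ ρ L (S.erase i) := by
  by_cases hi : i ∈ S
  swap
  · rw [Finset.erase_eq_of_notMem hi]
  induction L generalizing S with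
  | nil => rfl
  | cons k L ih =>
    rw [schurSum, schurSum, ← Finset.add_sum_erase _ _ hi, hρ k List.mem_cons_self, zero_mul,
      zero_mul, zero_add]
    refine Finset.sum_congr rfl fun a ha => ?_
    obtain ⟨hai, haS⟩ := Finset.mem_erase.1 ha
    have hi' : i ∈ S.erase a := Finset.mem_erase.2 ⟨Ne.symm hai, hi⟩
    rw [ih (fun k hk => hρ k (List.mem_cons_of_mem _ hk))
      (fun b hb => hθ b (Finset.mem_of_mem_erase hb)) hi', ← Finset.mul_prod_erase _ _ hi',
      hθ a haS hai, one_mul, Finset.erase_right_comm]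

/-- The first of `i`, `j` to be chosen meets the other in a factor `0`, so neither is ever chosen,
and their remaining factors cancel in pairs. This is the cancellation at `x_j = x̄_i`. -/
theorem schurSum_erase_erase {i j : σ} {L : List ℕ} {S : Finset σ} (hi : i ∈ S) (hj : j ∈ S)
    (hij : i ≠ j) (h1 : θ i j = 0) (h2 : θ j i = 0)
    (hθ : ∀ a ∈ S, a ≠ i → a ≠ j → θ a i * θ a j = 1) :
    schurSum (fun _ => 1) θ ρ L S = schurSum (fun _ => 1) θ ρ L ((S.erase i).erase j) := by
  induction L generalizing S with
  | nil => rfl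
  | cons k L ih =>
    have hj' : j ∈ S.erase i := Finset.mem_erase.2 ⟨hij.symm, hj⟩
    have hi' : i ∈ S.erase j := Finset.mem_erase.2 ⟨hij, hi⟩
    rw [schurSum, schurSum, ← Finset.add_sum_erase _ _ hi, ← Finset.add_sum_erase _ _ hj',
      Finset.prod_eq_zero hj' h1, Finset.prod_eq_zero hi' h2]
    simp only [mul_zero, zero_mul, zero_add]
    refine Finset.sum_congr rfl fun a ha => ?_
    obtain ⟨haj, ha⟩ := Finset.mem_erase.1 ha
    obtain ⟨hai, haS⟩ := Finset.mem_erase.1 ha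
    have hia : i ∈ S.erase a := Finset.mem_erase.2 ⟨Ne.symm hai, hi⟩
    have hja : j ∈ S.erase a := Finset.mem_erase.2 ⟨Ne.symm haj, hj⟩
    have hja' : j ∈ (S.erase a).erase i := Finset.mem_erase.2 ⟨hij.symm, hja⟩
    rw [ih hia hja (fun b hb => hθ b (Finset.mem_of_mem_erase hb)),
      ← Finset.mul_prod_erase _ _ hia, ← Finset.mul_prod_erase _ _ hja', ← mul_assoc (θ a i),
      hθ a haS hai haj, one_mul]
    rw [Finset.erase_right_comm (a := a) (b := i), Finset.erase_right_comm (a := a) (b := j)]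

/-- The product of `δ a b` over all pairs `a ≠ b` in `S`. -/
def pairProd (δ : σ → σ → C) (S : Finset σ) : C := ∏ a ∈ S, ∏ b ∈ S.erase a, δ a b

theorem pairProd_eq_mul_erase (δ : σ → σ → C) {S : Finset σ} {a : σ} (ha : a ∈ S) :
    pairProd δ S = (∏ b ∈ S.erase a, δ a b * δ b a) * pairProd δ (S.erase a) := by
  have h : ∀ x ∈ S.erase a,
      ∏ b ∈ S.erase x, δ x b = δ x a * ∏ b ∈ (S.erase a).erase x, δ x b := by
    intro x hx
    rw [← Finset.mul_prod_erase _ _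
      (Finset.mem_erase.2 ⟨(Finset.ne_of_mem_erase hx).symm, ha⟩ : a ∈ S.erase x),
      Finset.erase_right_comm]
  rw [pairProd, ← Finset.mul_prod_erase _ _ ha, Finset.prod_congr rfl h, Finset.prod_mul_distrib,
    Finset.prod_mul_distrib, mul_assoc, pairProd]

theorem dvd_pairProd (δ : σ → σ → C) {S : Finset σ} {a b : σ} (ha : a ∈ S) (hb : b ∈ S)
    (hab : a ≠ b) : δ a b ∣ pairProd δ S := by
  refine (Finset.dvd_prod_of_mem (fun b => δ a b) (Finset.mem_erase.2 ⟨hab.symm, hb⟩)).trans ?_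
  exact Finset.dvd_prod_of_mem (fun a => ∏ b ∈ S.erase a, δ a b) ha

theorem map_pairProd (φ : C →+* C') (δ : σ → σ → C) (S : Finset σ) :
    φ (pairProd δ S) = pairProd (fun a b => φ (δ a b)) S := by
  simp only [pairProd, map_prod]

theorem pairProd_map (f : τ ↪ σ) (δ : σ → σ → C) (S : Finset τ) :
    pairProd δ (S.map f) = pairProd (fun a b => δ (f a) (f b)) S := by
  simp only [pairProd, Finset.prod_map, ← Finset.map_erase]

theorem isUnit_pairProd {δ : σ → σ → C} (S : Finset σ) (h : ∀ a b, a ≠ b → IsUnit (δ a b)) :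
    IsUnit (pairProd δ S) :=
  Submonoid.prod_mem (IsUnit.submonoid C) fun a _ => Submonoid.prod_mem (IsUnit.submonoid C)
    fun b hb => h a b (Finset.ne_of_mem_erase hb).symm

/-- Clearing denominators: choosing `a` removes the factors `δ a b * δ b a` from the full product,
of which `δ a b` turns `θ a b` into `ν a b` and `δ b a` is kept. -/
theorem schurSum_pairProd {ν δ : σ → σ → C} {L : List ℕ} {S : Finset σ}
    (h : ∀ a ∈ S, ∀ b ∈ S, a ≠ b → θ a b * δ a b = ν a b) :
    schurSum (pairProd δ) (fun a b => ν a b * δ b a) ρ L S =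
      pairProd δ S * schurSum (fun _ => 1) θ ρ L S := by
  induction L generalizing S with
  | nil => simp [schurSum]
  | cons k L ih =>
    rw [schurSum, schurSum, Finset.mul_sum]
    refine Finset.sum_congr rfl fun a ha => ?_
    rw [ih fun a ha b hb => h a (Finset.mem_of_mem_erase ha) b (Finset.mem_of_mem_erase hb),
      pairProd_eq_mul_erase δ ha, Finset.prod_congr rfl fun b hb => by
        rw [← h a ha b (Finset.mem_of_mem_erase hb) (Finset.ne_of_mem_erase hb).symm, mul_assoc],
      Finset.prod_mul_distrib]
    ring

/-! ### Comparison with sums over permutations -/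

variable [Fintype σ]

/-- The maps `Fin n → σ` with image `S`. -/
def mapsOnto (n : ℕ) (S : Finset σ) : Finset (Fin n → σ) :=
  Finset.univ.filter fun w => Finset.univ.image w = S

theorem sum_mapsOnto_succ {n : ℕ} {S : Finset σ} (hS : S.card = n + 1) (f : (Fin (n + 1) → σ) → C) :
    ∑ w ∈ mapsOnto (n + 1) S, f w = ∑ a ∈ S, ∑ w ∈ mapsOnto n (S.erase a), f (Fin.cons a w) := by
  rw [Finset.sum_sigma']
  refine Finset.sum_bij' (fun w _ => ⟨w 0, Fin.tail w⟩) (fun p _ => Fin.cons p.1 p.2) ?_ ?_ ?_ ?_ ?_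
  · intro w hw
    have hw' : Finset.univ.image w = S := (Finset.mem_filter.1 hw).2
    have hinj : Function.Injective w := by
      rw [← Set.injOn_univ, ← Finset.coe_univ, ← Finset.card_image_iff, hw', hS]
      simp
    refine Finset.mem_sigma.2 ⟨by rw [← hw']; simp, Finset.mem_filter.2 ⟨Finset.mem_univ _, ?_⟩⟩
    ext b
    simp only [← hw', Finset.mem_image, Finset.mem_univ, true_and, Finset.mem_erase, Fin.tail]
    constructor
    · rintro ⟨i, rfl⟩
      exact ⟨fun h => Fin.succ_ne_zero i (hinj h), _, rfl⟩
    · rintro ⟨hb, i, rfl⟩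
      obtain ⟨j, rfl⟩ := Fin.exists_succ_eq.2 (fun h : i = 0 => hb (by rw [h]))
      exact ⟨j, rfl⟩
  · rintro ⟨a, w⟩ h
    obtain ⟨ha, hw⟩ := Finset.mem_sigma.1 h
    have hw' : Finset.univ.image w = S.erase a := (Finset.mem_filter.1 hw).2
    refine Finset.mem_filter.2 ⟨Finset.mem_univ _, ?_⟩
    ext b
    simp only [Finset.mem_image, Finset.mem_univ, true_and, Fin.exists_fin_succ, Fin.cons_zero,
      Fin.cons_succ]
    have hb : (∃ i, w i = b) ↔ b ∈ S.erase a := by rw [← hw']; simp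
    rw [hb, Finset.mem_erase]
    constructor
    · rintro (rfl | h)
      exacts [ha, h.2]
    · intro h
      by_cases hab : a = b
      exacts [Or.inl hab, Or.inr ⟨Ne.symm hab, h⟩]
  · intro w _
    exact Fin.cons_self_tail w
  · rintro ⟨a, w⟩ _
    simp
  · intro w _
    rw [Fin.cons_self_tail w]

/-- The value at `0` is peeled off as the first choice. Once `L` is exhausted the summand no longer
depends on the ordering of the remaining elements; their `(n - r)!` orderings account for the
normalisation of the symmetrization. -/
theorem sum_mapsOnto {n : ℕ} {L : List ℕ} {S : Finset σ} (hS : S.card = n) (hL : L.length ≤ n) :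
    ∑ w ∈ mapsOnto n S, (∏ i : Fin n with i.val < L.length, ρ (L.getD i 0) (w i)) *
        ∏ i : Fin n with i.val < L.length, ∏ j : Fin n with i < j, θ (w i) (w j) =
      (n - L.length).factorial * schurSum (fun _ => 1) θ ρ L S := by
  induction n generalizing L S with
  | zero =>
    obtain rfl : L = [] := List.length_eq_zero_iff.1 (by omega)
    obtain rfl : S = ∅ := Finset.card_eq_zero.1 hS
    simp [schurSum, mapsOnto]
  | succ n ih =>
    rw [sum_mapsOnto_succ hS]
    have hcard : ∀ a ∈ S, (S.erase a).card = n := fun a ha => by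
      rw [Finset.card_erase_of_mem ha, hS]; rfl
    cases L with
    | nil =>
      have : ∀ a ∈ S, (∑ w ∈ mapsOnto n (S.erase a), (1 : C)) = n.factorial := by
        intro a ha
        have := ih (L := []) (hcard a ha) (Nat.zero_le _)
        simpa [schurSum] using this
      simp only [List.length_nil, Nat.not_lt_zero, Finset.filter_false, Finset.prod_empty, mul_one,
        schurSum, Nat.sub_zero]
      rw [Finset.sum_congr rfl this, Finset.sum_const, hS, Nat.factorial_succ, nsmul_eq_mul]
      push_cast
      ring
    | cons k L =>
      rw [List.length_cons] at hL ⊢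
      rw [schurSum, Finset.mul_sum, Nat.add_sub_add_right]
      refine Finset.sum_congr rfl fun a ha => ?_
      have hih := ih (L := L) (hcard a ha) (by omega)
      have hθ : ∀ w ∈ mapsOnto n (S.erase a), ∏ j : Fin n, θ a (w j) = ∏ b ∈ S.erase a, θ a b := by
        intro w hw
        have hw' : Finset.univ.image w = S.erase a := (Finset.mem_filter.1 hw).2
        rw [← hw', Finset.prod_image]
        rw [← Finset.card_image_iff, hw', hcard a ha]
        simp
      rw [mul_left_comm, ← hih, Finset.mul_sum]
      refine Finset.sum_congr rfl fun w hw => ?_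
      rw [← hθ w hw]
      simp only [Finset.prod_filter, Fin.prod_univ_succ, Fin.val_zero, Fin.val_succ, Fin.cons_zero,
        Fin.cons_succ, Nat.succ_pos, if_true, Fin.succ_pos, Fin.succ_lt_succ_iff,
        Nat.add_lt_add_iff_right, List.getD_cons_zero, List.getD_cons_succ, Fin.not_lt_zero,
        if_false, one_mul]
      ring

theorem sum_perm_eq_schurSum {n : ℕ} {θ : Fin n → Fin n → C} {ρ : ℕ → Fin n → C} {L : List ℕ}
    (hL : L.length ≤ n) :
    ∑ w : Equiv.Perm (Fin n), (∏ i : Fin n with i.val < L.length, ρ (L.getD i 0) (w i)) *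
        ∏ i : Fin n with i.val < L.length, ∏ j : Fin n with i < j, θ (w i) (w j) =
      (n - L.length).factorial * schurSum (fun _ => 1) θ ρ L Finset.univ := by
  rw [← sum_mapsOnto (by simp) hL]
  refine Finset.sum_bij (fun w _ => w) ?_ ?_ ?_ ?_
  · intro w _
    exact Finset.mem_filter.2 ⟨Finset.mem_univ _, Finset.image_univ_of_surjective w.surjective⟩
  · intro w _ w' _ h
    exact DFunLike.coe_injective h
  · intro w hw
    have hw' : Finset.univ.image w = Finset.univ := (Finset.mem_filter.1 hw).2
    have hs : Function.Surjective w := fun b => by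
      have := Finset.mem_univ b
      rw [← hw'] at this
      simpa using this
    exact ⟨Equiv.ofBijective w (Finite.surjective_iff_bijective.1 hs), Finset.mem_univ _, rfl⟩
  · intro w _
    rfl

end SchurSum

/-! ### Integrality of the symmetrizations -/

section Denominators

variable {σ : Type} {a b : MvPowerSeries σ Lazard}

theorem ne_zero_of_constantCoeff_eq_one {u : MvPowerSeries σ Lazard}
    (h : constantCoeff u = 1) : u ≠ 0 := by
  rintro rfl
  rw [map_zero] at h
  exact zero_ne_one h

theorem isUnit_of_constantCoeff_eq_one {u : MvPowerSeries σ Lazard}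
    (h : constantCoeff u = 1) : IsUnit u := by
  rw [MvPowerSeries.isUnit_iff_constantCoeff, h]
  exact isUnit_one

theorem fadd_finv_ne_zero (ha : constantCoeff a = 0) (hb : constantCoeff b = 0) (hab : a ≠ b) :
    fadd a (finv b) ≠ 0 := by
  obtain ⟨u, hu, h⟩ := exists_fadd_finv_eq ha hb
  rw [h]
  exact mul_ne_zero (sub_ne_zero.2 hab) (ne_zero_of_constantCoeff_eq_one hu)

theorem fadd_ne_zero (ha : constantCoeff a = 0) (hb : constantCoeff b = 0) (hab : a ≠ finv b) :
    fadd a b ≠ 0 := by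
  have := fadd_finv_ne_zero ha (constantCoeff_finv hb) hab
  rwa [finv_finv hb] at this

theorem X_ne_finv_X [DecidableEq σ] [Finite σ] (i j : σ) :
    (X i : MvPowerSeries σ Lazard) ≠ finv (X j) := by
  intro h
  have hX : ∀ s, constantCoeff (X s : MvPowerSeries σ Lazard) = 0 := fun s => constantCoeff_X s
  by_cases hij : i = j
  · subst hij
    obtain ⟨ω, hω, h'⟩ := exists_finv_eq (hX i)
    rw [h'] at h
    have h1 : (1 : MvPowerSeries σ Lazard) = ω :=
      mul_left_cancel₀ (prime_X_var i).ne_zero (by rw [mul_one]; exact h)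
    have h2 := congrArg constantCoeff h1
    rw [hω, map_one] at h2
    have : (2 : Lazard) = 0 := by linear_combination h2
    exact two_ne_zero this
  · have := congrArg (setZero j) h
    rw [setZero_X_of_ne hij, setZero, evalHom_finv (hX j), evalHom_X, if_pos rfl, finv_zero] at this
    exact (prime_X_var i).ne_zero this

end Denominators

theorem X_injective_lazard {σ : Type} {i j : σ}
    (h : (X i : MvPowerSeries σ Lazard) = X j) : i = j := by
  classical
  by_contra hij
  have := congrArg (coeff (Finsupp.single i 1)) h
  rw [coeff_X, coeff_X, if_pos rfl, if_neg] at this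
  · exact one_ne_zero this
  · rwa [Finsupp.single_left_inj one_ne_zero]

/-- The numerator `x_a +_F x_b`. -/
noncomputable def num {n : ℕ} (a b : Fin n) : MvPowerSeries (Fin n) Lazard := fadd (X a) (X b)

/-- The denominator `x_a +_F x̄_b`. -/
noncomputable def den {n : ℕ} (a b : Fin n) : MvPowerSeries (Fin n) Lazard :=
  fadd (X a) (finv (X b))

/-- The row factor `g(t) t ^ (k - 1)`. -/
noncomputable def row (g : PowerSeries Lazard) {σ : Type} (k : ℕ) (t : MvPowerSeries σ Lazard) :
    MvPowerSeries σ Lazard :=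
  PowerSeries.subst t g * t ^ (k - 1)

section Integrality

variable {n : ℕ} {τ : Type} {z : Fin n → MvPowerSeries τ Lazard}

theorem constantCoeff_X_lazard (i : Fin n) :
    constantCoeff (X i : MvPowerSeries (Fin n) Lazard) = 0 := constantCoeff_X i

theorem evalHom_num (hz : ∀ s, constantCoeff (z s) = 0) (a b : Fin n) :
    evalHom z hz (num a b) = fadd (z a) (z b) := by
  rw [num, evalHom_fadd (constantCoeff_X_lazard a) (constantCoeff_X_lazard b), evalHom_X, evalHom_X]

theorem evalHom_den (hz : ∀ s, constantCoeff (z s) = 0) (a b : Fin n) :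
    evalHom z hz (den a b) = fadd (z a) (finv (z b)) := by
  rw [den, evalHom_fadd (constantCoeff_X_lazard a) (constantCoeff_finv (constantCoeff_X_lazard b)),
    evalHom_finv (constantCoeff_X_lazard b), evalHom_X, evalHom_X]

theorem evalHom_row (hz : ∀ s, constantCoeff (z s) = 0) (g : PowerSeries Lazard) (k : ℕ)
    (a : Fin n) : evalHom z hz (row g k (X a)) = row g k (z a) := by
  rw [row, map_mul, map_pow, evalHom_psubst hz (constantCoeff_X_lazard a), evalHom_X, row]

theorem exists_den_eq (a b : Fin n) : ∃ u : MvPowerSeries (Fin n) Lazard,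
    constantCoeff u = 1 ∧ den a b = (X a - X b) * u :=
  exists_fadd_finv_eq (constantCoeff_X_lazard a) (constantCoeff_X_lazard b)

theorem den_ne_zero {a b : Fin n} (hab : a ≠ b) : den a b ≠ 0 :=
  fadd_finv_ne_zero (constantCoeff_X_lazard a) (constantCoeff_X_lazard b)
    fun h => hab (X_injective_lazard h)

theorem X_sub_X_dvd_den_left (a b : Fin n) :
    (X b - X a : MvPowerSeries (Fin n) Lazard) ∣ den a b := by
  obtain ⟨u, -, h⟩ := exists_den_eq a b
  exact ⟨-u, by rw [h]; ring⟩

theorem X_sub_X_dvd_den_right (a b : Fin n) :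
    (X b - X a : MvPowerSeries (Fin n) Lazard) ∣ den b a := by
  obtain ⟨u, -, h⟩ := exists_den_eq b a
  exact ⟨u, h⟩

theorem not_X_sub_X_dvd_den {a b c d : Fin n} (hab : a ≠ b)
    (h : (if c = b then a else c) ≠ if d = b then a else d) :
    ¬ (X b - X a : MvPowerSeries (Fin n) Lazard) ∣ den c d := by
  rw [X_sub_X_dvd_iff hab, identify, evalHom_den]
  refine fadd_finv_ne_zero (by split_ifs <;> simp) (by split_ifs <;> simp) fun h' => h ?_
  rw [← apply_ite X, ← apply_ite X] at h'
  exact X_injective_lazard h'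

/-- Permuting the variables. -/
noncomputable def permHom (π : Equiv.Perm (Fin n)) :
    MvPowerSeries (Fin n) Lazard →ₐ[Lazard] MvPowerSeries (Fin n) Lazard :=
  evalHom (fun s => X (π s)) fun _ => constantCoeff_X_lazard _

theorem permHom_X (π : Equiv.Perm (Fin n)) (s : Fin n) :
    permHom π (X s) = X (π s) := evalHom_X _ s

/-- The common numerator of the symmetrization. -/
noncomputable def numSum (g : PowerSeries Lazard) (L : List ℕ) (n : ℕ) :
    MvPowerSeries (Fin n) Lazard :=
  schurSum (pairProd den) (fun a b => num a b * den b a) (fun k a => row g k (X a)) L Finset.univ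

theorem permHom_pairProd_den (π : Equiv.Perm (Fin n)) :
    permHom π (pairProd den Finset.univ) = pairProd den (Finset.univ : Finset (Fin n)) := by
  have h := map_pairProd (permHom π).toRingHom den Finset.univ
  refine h.trans ?_
  conv_rhs => rw [← Finset.map_univ_equiv π, pairProd_map]
  exact congrArg (fun δ => pairProd δ Finset.univ) (by
    funext a b
    exact evalHom_den _ a b)

theorem permHom_numSum (π : Equiv.Perm (Fin n)) (g : PowerSeries Lazard) (L : List ℕ) :
    permHom π (numSum g L n) = numSum g L n := by
  have h := map_schurSum (β := pairProd den) (θ := fun a b : Fin n => num a b * den b a)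
    (ρ := fun k a => row g k (X a)) (permHom π).toRingHom L Finset.univ
  refine h.trans ?_
  rw [numSum]
  conv_rhs => rw [← Finset.map_univ_equiv π, schurSum_map]
  refine schurSum_congr (fun T _ => ?_) (fun a _ b _ _ => ?_) (fun k _ a _ => ?_)
  · rw [map_pairProd, pairProd_map]
    exact congrArg (fun δ => pairProd δ T) (by
      funext a b
      exact evalHom_den _ a b)
  · rw [map_mul]
    exact congrArg₂ _ (evalHom_num _ a b) (evalHom_den _ b a)
  · exact evalHom_row _ g k a

/-- One factor is visible term by term. The common denominator runs over ordered pairs, so the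
numerator is symmetric and its quotient by `x_j - x_i` changes sign under the transposition; on `x_i
= x_j` the quotient equals its negative and vanishes in characteristic zero. -/
theorem sq_dvd_numSum (g : PowerSeries Lazard) (L : List ℕ) {i j : Fin n} (hij : i ≠ j) :
    (X j - X i : MvPowerSeries (Fin n) Lazard) ^ 2 ∣ numSum g L n := by
  obtain ⟨N, hN⟩ : (X j - X i : MvPowerSeries (Fin n) Lazard) ∣ numSum g L n :=
    dvd_schurSum (Finset.mem_univ i) (Finset.mem_univ j) hij
      (fun T hi hj => (X_sub_X_dvd_den_left i j).trans (dvd_pairProd den hi hj hij))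
      ((X_sub_X_dvd_den_right i j).trans (Dvd.intro_left _ rfl))
      ((X_sub_X_dvd_den_left i j).trans (Dvd.intro_left _ rfl))
  have hne : (X j - X i : MvPowerSeries (Fin n) Lazard) ≠ 0 := (prime_X_sub_X hij).ne_zero
  have h1 : permHom (Equiv.swap i j) N = -N := by
    have h := permHom_numSum (Equiv.swap i j) g L
    rw [hN, map_mul, map_sub, permHom_X, permHom_X, Equiv.swap_apply_left,
      Equiv.swap_apply_right] at h
    refine mul_left_cancel₀ hne ?_
    linear_combination -h
  have h2 : identify i j (permHom (Equiv.swap i j) N) = identify i j N := by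
    rw [permHom, identify, evalHom_evalHom]
    refine evalHom_congr _ _ (fun s => ?_) N
    rw [evalHom_X]
    by_cases hsi : s = i
    · subst hsi; simp [hij]
    by_cases hsj : s = j
    · subst hsj; simp [hij]
    rw [Equiv.swap_apply_of_ne_of_ne hsi hsj]
  have h3 : X j - X i ∣ N := by
    rw [X_sub_X_dvd_iff hij]
    rw [h1, map_neg] at h2
    have : (2 : MvPowerSeries (Fin n) Lazard) * identify i j N = 0 := by linear_combination -h2
    refine (mul_eq_zero.1 this).resolve_left fun h => ?_
    have := congrArg constantCoeff h
    rw [map_ofNat, map_zero] at this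
    exact two_ne_zero this
  rw [hN, pow_two]
  exact mul_dvd_mul_left _ h3

theorem prod_dvd_of_prime_pow_dvd {M ι : Type*} [CommMonoidWithZero M] [IsCancelMulZero M]
    (s : Finset ι)
    {p q : ι → M} {k : ℕ} {x : M} (hp : ∀ i ∈ s, Prime (p i)) (hq : ∀ i ∈ s, Associated (q i) (p i ^ k))
    (hx : ∀ i ∈ s, p i ^ k ∣ x) (hpq : ∀ i ∈ s, ∀ j ∈ s, i ≠ j → ¬ p i ∣ q j) :
    ∏ i ∈ s, q i ∣ x := by
  classical
  induction s using Finset.induction_on with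
  | empty => simp
  | insert a s ha ih =>
    obtain ⟨y, rfl⟩ := ih (fun i hi => hp i (Finset.mem_insert_of_mem hi))
      (fun i hi => hq i (Finset.mem_insert_of_mem hi))
      (fun i hi => hx i (Finset.mem_insert_of_mem hi))
      (fun i hi j hj => hpq i (Finset.mem_insert_of_mem hi) j (Finset.mem_insert_of_mem hj))
    have hpa := hp a (Finset.mem_insert_self _ _)
    have hy : p a ^ k ∣ y := by
      refine hpa.pow_dvd_of_dvd_mul_left k (fun h => ?_) (hx a (Finset.mem_insert_self _ _))
      obtain ⟨j, hj, h⟩ := (Prime.dvd_finsetProd_iff hpa _).1 h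
      exact hpq a (Finset.mem_insert_self _ _) j (Finset.mem_insert_of_mem hj)
        (fun h => ha (h ▸ hj)) h
    rw [Finset.prod_insert ha, mul_comm]
    exact mul_dvd_mul_left _ ((hq a (Finset.mem_insert_self _ _)).dvd.trans hy)

theorem associated_den_mul_den (a b : Fin n) :
    Associated (den a b * den b a) ((X b - X a : MvPowerSeries (Fin n) Lazard) ^ 2) := by
  obtain ⟨u, hu, h⟩ := exists_den_eq a b
  obtain ⟨v, hv, h'⟩ := exists_den_eq b a
  have huv : IsUnit (-(u * v)) :=
    ((isUnit_of_constantCoeff_eq_one hu).mul (isUnit_of_constantCoeff_eq_one hv)).neg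
  refine Associated.symm ⟨huv.unit, ?_⟩
  rw [IsUnit.unit_spec, h, h']
  ring

/-- Each unordered pair contributes, up to a unit, the square of the prime `x_b - x_a`, and this
prime divides no denominator of another pair. The divisibilities by the squares therefore multiply;
the induction adds one index at a time. -/
theorem pairProd_den_dvd_numSum (g : PowerSeries Lazard) (L : List ℕ) (n : ℕ) :
    pairProd den (Finset.univ : Finset (Fin n)) ∣ numSum g L n := by
  suffices ∀ S : Finset (Fin n), pairProd den S ∣ numSum g L n from this _
  intro S
  induction S using Finset.induction_on with
  | empty => simp [pairProd]
  | insert a T ha ih =>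
    obtain ⟨y, hy⟩ := ih
    rw [pairProd_eq_mul_erase den (Finset.mem_insert_self a T), Finset.erase_insert ha, hy, mul_comm]
    refine mul_dvd_mul_left _ (prod_dvd_of_prime_pow_dvd (k := 2) T
      (p := fun b => X b - X a) (fun b hb => prime_X_sub_X fun h => ha (h ▸ hb))
      (fun b _ => associated_den_mul_den a b) (fun b hb => ?_) fun b hb c hc hbc h => ?_)
    · have hab : a ≠ b := fun h => ha (h ▸ hb)
      refine (prime_X_sub_X hab).pow_dvd_of_dvd_mul_left 2 (fun h => ?_)
        (hy ▸ sq_dvd_numSum g L hab)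
      obtain ⟨c, hc, h⟩ := (Prime.dvd_finsetProd_iff (prime_X_sub_X hab) _).1 h
      obtain ⟨d, hd, h⟩ := (Prime.dvd_finsetProd_iff (prime_X_sub_X hab) _).1 h
      have hd' := Finset.mem_erase.1 hd
      have hca : c ≠ a := fun h => ha (h ▸ hc)
      have hda : d ≠ a := fun h => ha (h ▸ hd'.2)
      refine not_X_sub_X_dvd_den hab ?_ h
      split_ifs with h1 h2 h2
      · exact fun _ => hd'.1 (h2.trans h1.symm)
      · exact hda.symm
      · exact hca
      · exact hd'.1.symm
    · have hab : a ≠ b := fun h => ha (h ▸ hb)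
      have hac : a ≠ c := fun h => ha (h ▸ hc)
      rcases (prime_X_sub_X hab).dvd_or_dvd h with h | h
      · refine not_X_sub_X_dvd_den hab ?_ h
        rw [if_neg hab, if_neg hbc.symm]
        exact hac
      · refine not_X_sub_X_dvd_den hab ?_ h
        rw [if_neg hab, if_neg hbc.symm]
        exact hac.symm

/-- The universal Schur function with row series `g`. -/
noncomputable def schurFn (g : PowerSeries Lazard) (L : List ℕ) (n : ℕ) :
    MvPowerSeries (Fin n) Lazard := (pairProd_den_dvd_numSum g L n).choose

theorem pairProd_mul_schurFn (g : PowerSeries Lazard) (L : List ℕ) (n : ℕ) :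
    pairProd den Finset.univ * schurFn g L n = numSum g L n :=
  (pairProd_den_dvd_numSum g L n).choose_spec.symm

theorem pairProd_den_ne_zero (S : Finset (Fin n)) : pairProd den S ≠ 0 :=
  Finset.prod_ne_zero_iff.2 fun _ _ => Finset.prod_ne_zero_iff.2 fun _ hb =>
    den_ne_zero (Finset.ne_of_mem_erase hb).symm

theorem schurFn_eq_zero_of_lt (g : PowerSeries Lazard) {L : List ℕ} (h : n < L.length) :
    schurFn g L n = 0 := by
  have h' := pairProd_mul_schurFn g L n
  rw [numSum, schurSum_eq_zero_of_card_lt (by simpa using h)] at h'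
  exact (mul_eq_zero.1 h').resolve_left (pairProd_den_ne_zero _)

theorem permHom_schurFn (π : Equiv.Perm (Fin n)) (g : PowerSeries Lazard) (L : List ℕ) :
    permHom π (schurFn g L n) = schurFn g L n := by
  have h := congrArg (permHom π) (pairProd_mul_schurFn g L n)
  rw [map_mul, permHom_pairProd_den, permHom_numSum, ← pairProd_mul_schurFn] at h
  exact mul_left_cancel₀ (pairProd_den_ne_zero _) h

/-- The value of a universal Schur function under a homomorphism which inverts the
denominators. -/
theorem map_schurFn {C : Type*} [CommRing C] (ψ : MvPowerSeries (Fin n) Lazard →+* C)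
    (hψ : ∀ a b, a ≠ b → IsUnit (ψ (den a b))) {θ : Fin n → Fin n → C}
    (hθ : ∀ a b, a ≠ b → θ a b * ψ (den a b) = ψ (num a b)) (g : PowerSeries Lazard)
    (L : List ℕ) :
    ψ (schurFn g L n) =
      schurSum (fun _ => 1) θ (fun k a => ψ (row g k (X a))) L Finset.univ := by
  have h := congrArg ψ (pairProd_mul_schurFn g L n)
  rw [map_mul, map_pairProd, numSum, map_schurSum] at h
  simp only [map_mul, map_pairProd] at h
  rw [schurSum_pairProd fun a _ b _ hab => hθ a b hab] at h
  exact (isUnit_pairProd _ hψ).mul_left_cancel h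

theorem algebraMap_schurFn (g : PowerSeries Lazard) (L : List ℕ) {K : Type*} [Field K]
    (ψ : MvPowerSeries (Fin n) Lazard →+* K) (hψ : Function.Injective ψ) :
    ψ (schurFn g L n) = schurSum (fun _ => 1) (fun a b => ψ (num a b) * Ring.inverse (ψ (den a b)))
      (fun k a => ψ (row g k (X a))) L Finset.univ := by
  have hu : ∀ a b : Fin n, a ≠ b → ψ (den a b) ≠ 0 := fun a b hab =>
    (map_ne_zero_iff ψ hψ).2 (den_ne_zero hab)
  refine map_schurFn ψ (fun a b hab => (hu a b hab).isUnit) (fun a b hab => ?_) g L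
  rw [mul_assoc, Ring.inverse_mul_cancel _ (hu a b hab).isUnit, mul_one]

theorem algebraMap_schurFn_eq_symmetrization {g : PowerSeries Lazard}
    {rw' : ℕ → MvPowerSeries (Fin n) Lazard → MvPowerSeries (Fin n) Lazard}
    (h : ∀ k > 0, ∀ a, rw' k (X a) = row g k (X a)) {l : StrictPartition} (hl : l.length ≤ n) :
    algebraMap _ (FractionRing (MvPowerSeries (Fin n) Lazard)) (schurFn g l.parts n) =
      symmetrization n rw' l := by
  rw [algebraMap_schurFn g l.parts _ (IsFractionRing.injective _ _), symmetrization]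
  have h1 := sum_perm_eq_schurSum (θ := fun a b : Fin n => frac (fadd (X a) (X b))
    (fadd (X a) (finv (X b)))) (ρ := fun k a =>
      algebraMap _ (FractionRing (MvPowerSeries (Fin n) Lazard)) (rw' k (X a))) hl
  refine Eq.trans ?_ (congrArg (fun t => Ring.inverse
    ((n - l.length).factorial : FractionRing (MvPowerSeries (Fin n) Lazard)) * t) h1.symm)
  simp only [StrictPartition.length] at hl ⊢
  rw [← mul_assoc, Ring.inverse_mul_cancel, one_mul]
  · refine schurSum_congr (fun _ _ => rfl) (fun _ _ _ _ _ => rfl) fun k hk a _ => ?_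
    rw [h k (l.pos k hk)]
  · have : ((n - l.parts.length).factorial : FractionRing (MvPowerSeries (Fin n) Lazard)) ≠ 0 := by
      have h2 : (((n - l.parts.length).factorial : MvPowerSeries (Fin n) Lazard)) ≠ 0 := by
        intro h0
        have := congrArg constantCoeff h0
        rw [map_natCast, map_zero, Nat.cast_eq_zero] at this
        exact Nat.factorial_ne_zero _ this
      rw [← map_natCast (algebraMap (MvPowerSeries (Fin n) Lazard) _)]
      exact (map_ne_zero_iff _ (IsFractionRing.injective _ _)).2 h2
    exact this.isUnit

end Integrality

/-! ### Stable cancellative families of symmetric power series -/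

/-- The series `g(x_i)`. -/
noncomputable def gX (g : PowerSeries Lazard) {n : ℕ} (i : Fin n) :
    MvPowerSeries (Fin n) Lazard := PowerSeries.subst (X i) g

/-- The row series `g` for which the universal Schur functions form a basis, with cofactor `v`
such that `t - t̄ = g(t) v(t)`. -/
structure IsRow (g v : PowerSeries Lazard) : Prop where
  constantCoeff_eq_zero : PowerSeries.constantCoeff g = 0
  coeff_one_ne_zero : PowerSeries.coeff 1 g ≠ 0
  constantCoeff_cofactor_ne_zero : PowerSeries.constantCoeff v ≠ 0
  sub_finv_eq : PowerSeries.X - finvSeries = g * v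
  -- That is, `g(x_j)` is a non-zero-divisor modulo `g(x_i)`, so divisibility by each `g(x_i)` gives
  -- divisibility by their product.
  dvd_of_dvd_mul : ∀ {n : ℕ} {i j : Fin n}, i ≠ j → ∀ {f : MvPowerSeries (Fin n) Lazard},
    gX g i ∣ gX g j * f → gX g i ∣ f

/-- Setting the last variable to zero. -/
noncomputable def killLast (n : ℕ) :
    MvPowerSeries (Fin (n + 1)) Lazard →ₐ[Lazard] MvPowerSeries (Fin n) Lazard :=
  evalHom (Fin.snoc (α := fun _ => MvPowerSeries (Fin n) Lazard) X 0) fun s => by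
    induction s using Fin.lastCases <;> simp

/-- Substituting `x̄_i` for `x_j`. -/
noncomputable def pairHom {n : ℕ} (i j : Fin n) :
    MvPowerSeries (Fin n) Lazard →ₐ[Lazard] MvPowerSeries (Fin n) Lazard :=
  evalHom (fun s => if s = j then finv (X i) else X s) fun s => by
    split_ifs
    exacts [constantCoeff_finv (constantCoeff_X_lazard i), constantCoeff_X_lazard s]

/-- The part of a power series made of the monomials which involve all variables in `T`. -/
noncomputable def partOn {n : ℕ} (T : Finset (Fin n)) (f : MvPowerSeries (Fin n) Lazard) :
    MvPowerSeries (Fin n) Lazard := fun d => if ∀ i ∈ T, d i ≠ 0 then coeff d f else 0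

/-- The product `g(x_1) ⋯ g(x_n)`. -/
noncomputable def gProd (g : PowerSeries Lazard) (n : ℕ) : MvPowerSeries (Fin n) Lazard :=
  ∏ i, gX g i

/-- The symmetric stable families which satisfy the cancellation law, and whose full parts are
divisible by `g(x_1) ⋯ g(x_n)`. -/
structure IsGammaFamily (g : PowerSeries Lazard) (f : ∀ n, MvPowerSeries (Fin n) Lazard) :
    Prop where
  symm : ∀ n (π : Equiv.Perm (Fin n)), permHom π (f n) = f n
  stable : ∀ n, killLast n (f (n + 1)) = f n
  -- The left side is free of `x_j` and the right side of `x_i`, so the equation says that `f(…,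
  -- x_i, x̄_i)` does not depend on `x_i`.
  cancel : ∀ n (i j : Fin n), i ≠ j → pairHom i j (f n) = pairHom j i (f n)
  dvd : ∀ n, gProd g n ∣ partOn Finset.univ (f n)

section PartOn

variable {n : ℕ} {T : Finset (Fin n)} {f : MvPowerSeries (Fin n) Lazard}

theorem coeff_partOn (d : Fin n →₀ ℕ) :
    coeff d (partOn T f) = if ∀ i ∈ T, d i ≠ 0 then coeff d f else 0 := rfl

theorem partOn_empty : partOn ∅ f = f := by
  ext d
  simp [coeff_partOn]

theorem partOn_insert (i : Fin n) :
    partOn (insert i T) f = partOn T f - setZero i (partOn T f) := by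
  ext d
  rw [map_sub, coeff_setZero, coeff_partOn, coeff_partOn]
  by_cases h : d i = 0 <;> simp [h]

theorem partOn_univ_eq (i : Fin n) :
    partOn Finset.univ f = partOn (Finset.univ.erase i) (f - setZero i f) := by
  ext d
  rw [coeff_partOn, coeff_partOn, map_sub, coeff_setZero]
  by_cases h : d i = 0
  · rw [if_neg fun h' => h' i (Finset.mem_univ _) h, if_pos h, sub_self, ite_self]
  · rw [if_neg h, sub_zero]
    refine if_congr ?_ rfl rfl
    refine ⟨fun h' j _ => h' j (Finset.mem_univ _), fun h' j _ => ?_⟩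
    by_cases hj : j = i
    · exact hj ▸ h
    · exact h' j (Finset.mem_erase.2 ⟨hj, Finset.mem_univ _⟩)

theorem dvd_partOn {q : MvPowerSeries (Fin n) Lazard} (hq : ∀ i ∈ T, setZero i q = q)
    (hf : q ∣ f) : q ∣ partOn T f := by
  induction T using Finset.induction_on with
  | empty => rwa [partOn_empty]
  | insert i T hi ih =>
    have h := ih fun j hj => hq j (Finset.mem_insert_of_mem hj)
    rw [partOn_insert]
    refine dvd_sub h ?_
    have := map_dvd (setZero i) h
    rwa [hq i (Finset.mem_insert_self _ _)] at this

end PartOn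

section GX

variable {n : ℕ} {g v : PowerSeries Lazard}

theorem evalHom_gX {τ : Type} {z : Fin n → MvPowerSeries τ Lazard}
    (hz : ∀ s, constantCoeff (z s) = 0) (i : Fin n) :
    evalHom z hz (gX g i) = PowerSeries.subst (z i) g := by
  rw [gX, evalHom_psubst hz (constantCoeff_X_lazard i), evalHom_X]

theorem gX_ne_zero (hg : PowerSeries.coeff 1 g ≠ 0) (i : Fin n) : gX g i ≠ 0 := by
  intro h
  have := congrArg (coeff (Finsupp.single i 1)) h
  rw [gX, PowerSeries.coeff_subst_single] at this
  exact hg (by simpa using this)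

theorem setZero_gX {i j : Fin n} (hij : i ≠ j) : setZero j (gX g i) = gX g i := by
  rw [setZero, evalHom_gX, if_neg hij, gX]

theorem gProd_ne_zero (hg : PowerSeries.coeff 1 g ≠ 0) (n : ℕ) : gProd g n ≠ 0 :=
  Finset.prod_ne_zero_iff.2 fun i _ => gX_ne_zero hg i

theorem IsRow.gX_dvd_sub (h : IsRow g v) (i : Fin n) : gX g i ∣ X i - finv (X i) := by
  refine ⟨PowerSeries.subst (X i) v, ?_⟩
  have h1 := congrArg (PowerSeries.subst (X i : MvPowerSeries (Fin n) Lazard)) h.sub_finv_eq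
  have hs := pHasSubst (constantCoeff_X_lazard i)
  rwa [PowerSeries.subst_sub hs, PowerSeries.subst_mul hs, PowerSeries.subst_X hs] at h1

theorem IsRow.gProd_dvd (h : IsRow g v) {f : MvPowerSeries (Fin n) Lazard}
    (hf : ∀ i, gX g i ∣ f) : gProd g n ∣ f := by
  suffices ∀ T : Finset (Fin n), ∏ i ∈ T, gX g i ∣ f from this _
  intro T
  induction T using Finset.induction_on with
  | empty => simp
  | insert i T hi ih =>
    obtain ⟨y, rfl⟩ := ih
    rw [Finset.prod_insert hi, mul_comm]
    refine mul_dvd_mul_left _ ?_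
    have hi' := hf i
    clear hf
    induction T using Finset.induction_on generalizing y with
    | empty => simpa using hi'
    | insert j T hj ih =>
      rw [Finset.prod_insert hj, mul_assoc] at hi'
      exact ih (fun h => hi (Finset.mem_insert_of_mem h)) y
        (h.dvd_of_dvd_mul (fun h => hi (by rw [h]; exact Finset.mem_insert_self _ _)) hi')

end GX

/-- `F(a, b) - F(a, c)` is divisible by `b - c`. -/
theorem sub_dvd_fadd_sub_fadd {σ : Type} {a b c : MvPowerSeries σ Lazard}
    (ha : constantCoeff a = 0) (hb : constantCoeff b = 0) (hc : constantCoeff c = 0) :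
    b - c ∣ fadd a b - fadd a c := by
  have hX : ∀ s : Fin 3, constantCoeff (X s : MvPowerSeries (Fin 3) Lazard) = 0 :=
    fun s => constantCoeff_X s
  have h : (X 1 - X 2 : MvPowerSeries (Fin 3) Lazard) ∣ fadd (X 0) (X 1) - fadd (X 0) (X 2) := by
    rw [X_sub_X_dvd_iff (by decide), map_sub, identify, evalHom_fadd (hX _) (hX _),
      evalHom_fadd (hX _) (hX _)]
    simp
  have hz : ∀ s : Fin 3, constantCoeff (![a, b, c] s) = 0 := by
    intro s; fin_cases s; exacts [ha, hb, hc]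
  have := map_dvd (evalHom _ hz) h
  rwa [map_sub, map_sub, evalHom_fadd (hX _) (hX _), evalHom_fadd (hX _) (hX _), evalHom_X,
    evalHom_X, evalHom_X] at this

/-! ### The universal Schur functions form a family of this class -/

section SchurFn

variable {n : ℕ} {g v : PowerSeries Lazard}

theorem row_zero (hg : PowerSeries.constantCoeff g = 0) {σ : Type} (k : ℕ) :
    row g k (0 : MvPowerSeries σ Lazard) = 0 := by
  have : PowerSeries.subst (0 : MvPowerSeries σ Lazard) g = 0 := by
    have := PowerSeries.X_dvd_iff.2 hg
    obtain ⟨p, rfl⟩ := this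
    have hs := PowerSeries.HasSubst.of_constantCoeff_zero
      (map_zero (constantCoeff (σ := σ) (R := Lazard)))
    rw [PowerSeries.subst_mul hs, PowerSeries.subst_X hs, zero_mul]
  rw [row, this, zero_mul]

/-- Distinct arguments keep all denominators nonzero, so the explicit sum survives the substitution;
it is used for `x_n ↦ 0` and for `x_j ↦ x̄_i`. -/
theorem evalHom_schurFn_field {τ : Type} {z : Fin n → MvPowerSeries τ Lazard}
    (hz : ∀ s, constantCoeff (z s) = 0) (hinj : Function.Injective z) {K : Type*} [Field K]
    (ψ : MvPowerSeries τ Lazard →+* K) (hψ : Function.Injective ψ) (g : PowerSeries Lazard)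
    (L : List ℕ) :
    ψ (evalHom z hz (schurFn g L n)) =
      schurSum (fun _ => 1)
        (fun a b => ψ (fadd (z a) (z b)) * (ψ (fadd (z a) (finv (z b))))⁻¹)
        (fun k a => ψ (row g k (z a))) L Finset.univ := by
  have hu : ∀ a b : Fin n, a ≠ b → ψ (fadd (z a) (finv (z b))) ≠ 0 := fun a b hab =>
    (map_ne_zero_iff ψ hψ).2 (fadd_finv_ne_zero (hz a) (hz b) (hinj.ne hab))
  have h := map_schurFn (ψ.comp (evalHom z hz).toRingHom) (θ := fun a b =>
    ψ (fadd (z a) (z b)) * (ψ (fadd (z a) (finv (z b))))⁻¹) (fun a b hab => ?_)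
    (fun a b hab => ?_) g L
  · refine h.trans (schurSum_congr (fun _ _ => rfl) (fun _ _ _ _ _ => rfl) fun k _ a _ => ?_)
    exact congrArg ψ (evalHom_row hz g k a)
  · have : (ψ.comp (evalHom z hz).toRingHom) (den a b) = ψ (fadd (z a) (finv (z b))) :=
      congrArg ψ (evalHom_den hz a b)
    rw [this]
    exact (hu a b hab).isUnit
  · have : (ψ.comp (evalHom z hz).toRingHom) (den a b) = ψ (fadd (z a) (finv (z b))) :=
      congrArg ψ (evalHom_den hz a b)
    rw [this, mul_assoc, inv_mul_cancel₀ (hu a b hab), mul_one]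
    exact (congrArg ψ (evalHom_num hz a b)).symm

theorem killLast_schurFn (hg : PowerSeries.constantCoeff g = 0) (L : List ℕ) (n : ℕ) :
    killLast n (schurFn g L (n + 1)) = schurFn g L n := by
  have hψ := IsFractionRing.injective (MvPowerSeries (Fin n) Lazard)
    (FractionRing (MvPowerSeries (Fin n) Lazard))
  refine hψ ?_
  set ψ := algebraMap (MvPowerSeries (Fin n) Lazard) (FractionRing (MvPowerSeries (Fin n) Lazard))
  set z := Fin.snoc (α := fun _ => MvPowerSeries (Fin n) Lazard) X 0 with hzdef
  have hzc : ∀ i : Fin n, z i.castSucc = X i := fun i => by simp [hzdef]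
  have hzl : z (Fin.last n) = 0 := by simp [hzdef]
  have hz : ∀ s, constantCoeff (z s) = 0 := fun s => by
    induction s using Fin.lastCases with
    | last => rw [hzl, map_zero]
    | cast i => rw [hzc, constantCoeff_X]
  have hinj : Function.Injective z := by
    intro a b
    induction a using Fin.lastCases with
    | last =>
      induction b using Fin.lastCases with
      | last => exact fun _ => rfl
      | cast b => rw [hzc, hzl]; exact fun h => absurd h.symm (prime_X_var b).ne_zero
    | cast a =>
      induction b using Fin.lastCases with
      | last => rw [hzc, hzl]; exact fun h => absurd h (prime_X_var a).ne_zero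
      | cast b => rw [hzc, hzc]; exact fun h => by rw [X_injective_lazard h]
  have h1 := evalHom_schurFn_field hz hinj ψ hψ g L
  have h2 := evalHom_schurFn_field (z := X) (constantCoeff_X_lazard (n := n))
    (fun a b h => X_injective_lazard h) ψ hψ g L
  rw [evalHom_X_self] at h2
  refine h1.trans (Eq.trans ?_ h2.symm)
  have he : (Finset.univ : Finset (Fin (n + 1))).erase (Fin.last n) =
      Finset.univ.map Fin.castSuccEmb := by
    ext s
    induction s using Fin.lastCases <;> simp [Fin.castSucc_ne_last]
  rw [schurSum_erase (i := Fin.last n), he, schurSum_map]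
  · simp only [Fin.coe_castSuccEmb, hzc]
  · intro k _
    rw [hzl, row_zero hg, map_zero]
  · intro a _ ha
    have h0 : z a ≠ 0 := fun h => ha (hinj (h.trans hzl.symm))
    rw [hzl, finv_zero, fadd_zero (hz a), mul_inv_cancel₀ ((map_ne_zero_iff ψ hψ).2 h0)]

theorem pairHom_schurFn {i j : Fin n} (hij : i ≠ j) (g : PowerSeries Lazard) (L : List ℕ) :
    pairHom i j (schurFn g L n) = pairHom j i (schurFn g L n) := by
  have hψ := IsFractionRing.injective (MvPowerSeries (Fin n) Lazard)
    (FractionRing (MvPowerSeries (Fin n) Lazard))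
  refine hψ ?_
  set ψ := algebraMap (MvPowerSeries (Fin n) Lazard) (FractionRing (MvPowerSeries (Fin n) Lazard))
  have hX := constantCoeff_X_lazard (n := n)
  have key : ∀ i j : Fin n, i ≠ j → ψ (pairHom i j (schurFn g L n)) =
      schurSum (fun _ => 1) (fun a b => ψ (num a b) * (ψ (den a b))⁻¹)
        (fun k a => ψ (row g k (X a))) L ((Finset.univ.erase i).erase j) := by
    intro i j hij
    have hz : ∀ s, constantCoeff
        ((fun s => if s = j then finv (X i) else X s : Fin n → MvPowerSeries (Fin n) Lazard) s)
        = 0 := fun s => by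
      dsimp only
      split_ifs
      exacts [constantCoeff_finv (hX i), hX s]
    have hinj : Function.Injective
        (fun s => if s = j then finv (X i) else X s : Fin n → MvPowerSeries (Fin n) Lazard) := by
      intro a b h
      dsimp only at h
      split_ifs at h with h1 h2 h2
      · rw [h1, h2]
      · exact absurd h.symm (X_ne_finv_X _ _)
      · exact absurd h (X_ne_finv_X _ _)
      · exact X_injective_lazard h
    refine (evalHom_schurFn_field hz hinj ψ hψ g L).trans ?_
    rw [schurSum_erase_erase (Finset.mem_univ i) (Finset.mem_univ j) hij]
    · refine schurSum_congr (fun _ _ => rfl) (fun a ha b hb _ => ?_) (fun k _ a ha => ?_)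
      · rw [if_neg (Finset.ne_of_mem_erase ha), if_neg (Finset.ne_of_mem_erase hb), num, den]
      · rw [if_neg (Finset.ne_of_mem_erase ha)]
    · rw [if_neg hij, if_pos rfl, fadd_finv (hX i), map_zero, zero_mul]
    · rw [if_neg hij, if_pos rfl, finv_fadd (hX i), map_zero, zero_mul]
    · intro a _ hai haj
      rw [if_neg haj, if_neg hij, if_pos rfl, finv_finv (hX i)]
      have h1 : ψ (fadd (X a) (X i)) ≠ 0 :=
        (map_ne_zero_iff ψ hψ).2 (fadd_ne_zero (hX a) (hX i) (X_ne_finv_X a i))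
      have h2 : ψ (fadd (X a) (finv (X i))) ≠ 0 := (map_ne_zero_iff ψ hψ).2 (den_ne_zero hai)
      field_simp
  rw [key i j hij, key j i hij.symm, Finset.erase_right_comm]

theorem dvd_of_prime_mul_dvd {p u q f : MvPowerSeries (Fin n) Lazard} (hp : Prime p)
    (hu : IsUnit u) (hpq : ¬ p ∣ q) (h : q ∣ p * u * f) : q ∣ f := by
  obtain ⟨y, hy⟩ := h
  obtain ⟨y, rfl⟩ := (hp.dvd_or_dvd (show p ∣ q * y from ⟨u * f, by rw [← hy]; ring⟩)).resolve_left
    hpq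
  rw [← hu.dvd_mul_left]
  refine ⟨y, mul_left_cancel₀ hp.ne_zero ?_⟩
  linear_combination hy

/-- Since `g` divides `t - t̄`, the variable `x_i` agrees with `x̄_i` modulo `g(x_i)`. Hence the
factors `(x_a +_F x_i) / (x_a +_F x̄_i)` become `1` while the rows at `i` vanish, exactly as after
`x_i ↦ 0`: both functions reduce to the sum over the remaining variables. -/
theorem IsRow.gX_dvd_schurFn_sub (h : IsRow g v) (i : Fin n) (L : List ℕ) :
    gX g i ∣ schurFn g L n - setZero i (schurFn g L n) := by
  set q := gX g i with hq
  have hX := constantCoeff_X_lazard (n := n)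
  let I := Ideal.span {q}
  -- The quotient need not be a domain, so this is its localisation at the non-zero-divisors. The
  -- denominators become units in it because each is a unit times a prime not dividing `g(x_i)`.
  let K := FractionRing (MvPowerSeries (Fin n) Lazard ⧸ I)
  let φ : MvPowerSeries (Fin n) Lazard →+* K :=
    (algebraMap (MvPowerSeries (Fin n) Lazard ⧸ I) K).comp (Ideal.Quotient.mk I)
  have hφ : ∀ f f', φ f = φ f' ↔ q ∣ f - f' := by
    intro f f'
    rw [← Ideal.mem_span_singleton, ← Ideal.Quotient.eq]
    exact (IsFractionRing.injective (MvPowerSeries (Fin n) Lazard ⧸ I) K).eq_iff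
  have hunit : ∀ f, (∀ y, q ∣ f * y → q ∣ y) → IsUnit (φ f) := by
    intro f hf
    refine IsLocalization.map_units K (⟨Ideal.Quotient.mk I f, ?_⟩ :
      nonZeroDivisors (MvPowerSeries (Fin n) Lazard ⧸ I))
    rw [mem_nonZeroDivisors_iff_right]
    intro y hy
    obtain ⟨y, rfl⟩ := Ideal.Quotient.mk_surjective y
    rw [← map_mul, Ideal.Quotient.eq_zero_iff_mem, Ideal.mem_span_singleton, mul_comm] at hy
    rw [Ideal.Quotient.eq_zero_iff_mem, Ideal.mem_span_singleton]
    exact hf y hy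
  have hXX : ∀ a b : Fin n, a ≠ b → ¬ (X b - X a : MvPowerSeries (Fin n) Lazard) ∣ q := by
    intro a b hab hd
    rw [X_sub_X_dvd_iff hab, hq, identify, evalHom_gX, ← apply_ite X] at hd
    exact gX_ne_zero h.coeff_one_ne_zero _ hd
  have hX0 : ∀ a : Fin n, a ≠ i → ¬ (X a : MvPowerSeries (Fin n) Lazard) ∣ q := by
    intro a ha hd
    rw [X_dvd_iff_setZero, hq, setZero_gX ha.symm] at hd
    exact gX_ne_zero h.coeff_one_ne_zero _ hd
  have hdiff : ∀ a b : Fin n, a ≠ b → ∀ u, constantCoeff u = 1 →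
      IsUnit (φ ((X a - X b : MvPowerSeries (Fin n) Lazard) * u)) := fun a b hab u hu =>
    hunit _ fun y hy => dvd_of_prime_mul_dvd (prime_X_sub_X hab.symm)
      (isUnit_of_constantCoeff_eq_one hu) (hXX b a hab.symm) hy
  have hu1 : ∀ a b : Fin n, a ≠ b → IsUnit (φ (den a b)) := by
    intro a b hab
    obtain ⟨u, hu, hd⟩ := exists_den_eq a b
    rw [hd]
    exact hdiff a b hab u hu
  set z : Fin n → MvPowerSeries (Fin n) Lazard := fun s => if s = i then 0 else X s with hzdef
  have hz : ∀ s, constantCoeff (z s) = 0 := fun s => by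
    simp only [hzdef]
    split_ifs <;> simp
  let φ' : MvPowerSeries (Fin n) Lazard →+* K := φ.comp (setZero i).toRingHom
  have hφ'den : ∀ a b, φ' (den a b) = φ (fadd (z a) (finv (z b))) := fun a b =>
    congrArg φ (evalHom_den hz a b)
  have hφ'num : ∀ a b, φ' (num a b) = φ (fadd (z a) (z b)) := fun a b =>
    congrArg φ (evalHom_num hz a b)
  have hu2 : ∀ a b : Fin n, a ≠ b → IsUnit (φ' (den a b)) := by
    intro a b hab
    rw [hφ'den]
    obtain ⟨u, hu, hd⟩ := exists_fadd_finv_eq (hz a) (hz b)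
    rw [hd]
    by_cases hai : a = i
    · have hbi : b ≠ i := fun h => hab (hai.trans h.symm)
      refine hunit _ fun y hy => dvd_of_prime_mul_dvd (prime_X_var b)
        (isUnit_of_constantCoeff_eq_one hu) (hX0 b hbi) ?_
      rw [hzdef] at hy
      simp only [hai, if_true, hbi, if_false] at hy
      rw [zero_sub, neg_mul, neg_mul, dvd_neg] at hy
      exact hy
    by_cases hbi : b = i
    · refine hunit _ fun y hy => dvd_of_prime_mul_dvd (prime_X_var a)
        (isUnit_of_constantCoeff_eq_one hu) (hX0 a hai) ?_
      rw [hzdef] at hy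
      simp only [hai, if_true, hbi, if_false] at hy
      rwa [sub_zero] at hy
    · simp only [hzdef, if_neg hai, if_neg hbi]
      exact hdiff a b hab u hu
  have hinv : ∀ x : K, IsUnit x → Ring.inverse x * x = 1 := fun x hx => Ring.inverse_mul_cancel x hx
  have e1 := map_schurFn φ hu1 (θ := fun a b => φ (num a b) * Ring.inverse (φ (den a b)))
    (fun a b hab => by rw [mul_assoc, hinv _ (hu1 a b hab), mul_one]) g L
  have e2 := map_schurFn φ' hu2 (θ := fun a b => φ' (num a b) * Ring.inverse (φ' (den a b)))
    (fun a b hab => by rw [mul_assoc, hinv _ (hu2 a b hab), mul_one]) g L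
  rw [← hφ]
  refine e1.trans (Eq.trans ?_ e2.symm)
  have hone : ∀ x y : K, IsUnit y → x = y → x * Ring.inverse y = 1 := fun x y hy hxy => by
    rw [hxy, mul_comm, hinv y hy]
  refine (schurSum_erase (i := i) (fun k _ => ?_) fun a _ ha => ?_).trans (Eq.trans ?_
    (schurSum_erase (i := i) (fun k _ => ?_) fun a _ ha => ?_).symm)
  · rw [← map_zero φ, hφ, sub_zero, row]
    exact Dvd.intro _ rfl
  · refine hone _ _ (hu1 a i ha) ?_
    rw [hφ]
    exact (h.gX_dvd_sub i).trans
      (sub_dvd_fadd_sub_fadd (hX a) (hX i) (constantCoeff_finv (hX i)))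
  · refine schurSum_congr (fun _ _ => rfl) (fun a ha b hb _ => ?_) (fun k _ a ha => ?_)
    · rw [hφ'den, hφ'num, hzdef]
      simp only [if_neg (Finset.ne_of_mem_erase ha), if_neg (Finset.ne_of_mem_erase hb), num, den]
    · refine congrArg φ ((evalHom_row hz g k a).trans ?_).symm
      simp only [hzdef, if_neg (Finset.ne_of_mem_erase ha)]
  · refine (congrArg φ (evalHom_row hz g k i)).trans ?_
    simp only [hzdef, if_pos, row_zero h.constantCoeff_eq_zero, map_zero]
  · refine hone _ _ (hu2 a i ha) ?_
    rw [hφ'den, hφ'num]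
    simp only [hzdef, if_pos, finv_zero]

theorem IsRow.isGammaFamily_schurFn (h : IsRow g v) (L : List ℕ) :
    IsGammaFamily g (schurFn g L) where
  symm n π := permHom_schurFn π g L
  stable n := killLast_schurFn h.constantCoeff_eq_zero L n
  cancel n i j hij := pairHom_schurFn hij g L
  dvd n := h.gProd_dvd fun i => by
    rw [partOn_univ_eq i]
    exact dvd_partOn (fun j hj => setZero_gX (Finset.ne_of_mem_erase hj).symm)
      (h.gX_dvd_schurFn_sub i L)

end SchurFn

/-! ### A family is determined by its strict coefficients -/

section Coefficients

variable {n : ℕ}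

theorem coeff_permHom (π : Equiv.Perm (Fin n)) (f : MvPowerSeries (Fin n) Lazard)
    (d : Fin n →₀ ℕ) : coeff (d.embDomain π.toEmbedding) (permHom π f) = coeff d f := by
  have : permHom π f = rename π.toEmbedding f := by
    rw [rename_eq_subst, permHom, evalHom_apply]
    rfl
  rw [this, coeff_embDomain_rename]

theorem coeff_killLast (f : MvPowerSeries (Fin (n + 1)) Lazard) (d : Fin n →₀ ℕ) :
    coeff d (killLast n f) = coeff (d.embDomain Fin.castSuccEmb) f := by
  have h : rename Fin.castSuccEmb (killLast n f) = setZero (Fin.last n) f := by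
    have hX : ∀ s : Fin n, constantCoeff
        (X (Fin.castSuccEmb s) : MvPowerSeries (Fin (n + 1)) Lazard) = 0 :=
      fun s => constantCoeff_X _
    rw [rename_eq_subst]
    refine (evalHom_apply hX _).symm.trans ?_
    rw [killLast, setZero, evalHom_evalHom]
    refine evalHom_congr _ _ (fun s => ?_) f
    induction s using Fin.lastCases <;> simp [Fin.castSucc_ne_last]
  rw [← coeff_embDomain_rename Fin.castSuccEmb, h, coeff_setZero, if_pos]
  exact Finsupp.embDomain_of_notMem_range _ _ _ (by simp)

/-- The exponent `(1, …, 1)`. -/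
noncomputable def ones (n : ℕ) : Fin n →₀ ℕ := Finsupp.equivFunOnFinite.symm fun _ => 1

@[simp] theorem ones_apply (i : Fin n) : ones n i = 1 := rfl

theorem degree_ones (n : ℕ) : (ones n).degree = n := by
  simp [Finsupp.degree_eq_sum]

variable {g : PowerSeries Lazard}

theorem exists_gProd_eq (hg : PowerSeries.constantCoeff g = 0) (n : ℕ) :
    ∃ P : MvPowerSeries (Fin n) Lazard, constantCoeff P = PowerSeries.coeff 1 g ^ n ∧
      gProd g n = monomial (ones n) 1 * P := by
  obtain ⟨p, rfl⟩ := PowerSeries.X_dvd_iff.2 hg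
  refine ⟨∏ i, PowerSeries.subst (X i) p, ?_, ?_⟩
  · rw [map_prod]
    have : ∀ i : Fin n, constantCoeff (PowerSeries.subst (X i : MvPowerSeries (Fin n) Lazard) p) =
        PowerSeries.coeff 1 (PowerSeries.X * p) := by
      intro i
      rw [← coeff_zero_eq_constantCoeff_apply, coeff_psubst_X, if_pos (by simp),
        PowerSeries.coeff_succ_X_mul]
      rfl
    simp [this]
  · rw [monomial_one_eq, Finsupp.prod_fintype _ _ (by simp), gProd, ← Finset.prod_mul_distrib]
    refine Finset.prod_congr rfl fun i _ => ?_
    have hs := pHasSubst (constantCoeff_X_lazard i)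
    rw [gX, PowerSeries.subst_mul hs, PowerSeries.subst_X hs, ones_apply, pow_one]

theorem coeff_mul_of_lowest {σ : Type} {P h : MvPowerSeries σ Lazard} {N : ℕ}
    (h0 : ∀ e : σ →₀ ℕ, e.degree < N → coeff e h = 0) {d : σ →₀ ℕ} (hd : d.degree = N) :
    coeff d (P * h) = constantCoeff P * coeff d h := by
  classical
  rw [coeff_mul, Finset.sum_eq_single (0, d)]
  · simp
  · rintro ⟨a, b⟩ hab hne
    have hab' : a + b = d := Finset.HasAntidiagonal.mem_antidiagonal.1 hab
    have ha : a ≠ 0 := by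
      rintro rfl
      exact hne (by rw [← hab', zero_add])
    have : a.degree ≠ 0 := fun h => ha ((Finsupp.degree_eq_zero_iff a).1 h)
    have hdeg : a.degree + b.degree = N := by rw [← hd, ← hab', map_add]
    rw [h0 b (by omega), mul_zero]
  · intro h
    exact absurd (Finset.HasAntidiagonal.mem_antidiagonal.2 (zero_add d)) h

theorem coeff_eq_zero_of_mul {σ : Type} {P h : MvPowerSeries σ Lazard} {N : ℕ}
    (hP : constantCoeff P ≠ 0) (h0 : ∀ e : σ →₀ ℕ, e.degree < N → coeff e (P * h) = 0)
    (d : σ →₀ ℕ) (hd : d.degree < N) : coeff d h = 0 := by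
  induction hm : d.degree using Nat.strong_induction_on generalizing d with
  | _ m ih =>
    have := coeff_mul_of_lowest (P := P) (h := h) (fun e he => ih _ he e (by omega) rfl) hm
    rw [h0 d hd] at this
    exact (mul_eq_zero.1 this.symm).resolve_left hP

/-- The quotient of the full part of a power series by `g(x_1) ⋯ g(x_n)`. -/
noncomputable def quotG (g : PowerSeries Lazard) (f : MvPowerSeries (Fin n) Lazard) :
    MvPowerSeries (Fin n) Lazard :=
  open Classical in if h : gProd g n ∣ partOn Finset.univ f then h.choose else 0

theorem partOn_eq_gProd_mul_quotG {f : MvPowerSeries (Fin n) Lazard}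
    (h : gProd g n ∣ partOn Finset.univ f) : partOn Finset.univ f = gProd g n * quotG g f := by
  rw [quotG, dif_pos h]
  exact h.choose_spec

theorem quotG_eq (hg : PowerSeries.coeff 1 g ≠ 0) {f w : MvPowerSeries (Fin n) Lazard}
    (h : partOn Finset.univ f = gProd g n * w) : quotG g f = w := by
  have h' := partOn_eq_gProd_mul_quotG (Dvd.intro _ h.symm)
  exact mul_left_cancel₀ (gProd_ne_zero hg n) (h'.symm.trans h)

variable {v : PowerSeries Lazard}

/-- The product `g(x_1) ⋯ g(x_n)` is `x_1 ⋯ x_n P` with `P(0) ≠ 0`, so in lowest degree the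
coefficients of a family and of its quotient differ by a nonzero scalar. -/
theorem IsRow.exists_coeff_add_ones (hg : IsRow g v) (n : ℕ) :
    ∃ P : MvPowerSeries (Fin n) Lazard, constantCoeff P = PowerSeries.coeff 1 g ^ n ∧
      constantCoeff P ≠ 0 ∧
      ∀ f : MvPowerSeries (Fin n) Lazard, gProd g n ∣ partOn Finset.univ f →
        ∀ k, coeff (ones n + k) f = coeff k (P * quotG g f) := by
  obtain ⟨P, hP, hG⟩ := exists_gProd_eq hg.constantCoeff_eq_zero n
  refine ⟨P, hP, by rw [hP]; exact pow_ne_zero _ hg.coeff_one_ne_zero, fun f hf k => ?_⟩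
  have h := congrArg (coeff (ones n + k)) (partOn_eq_gProd_mul_quotG hf)
  rw [coeff_partOn, if_pos (fun i _ => by simp), hG, mul_assoc, coeff_add_monomial_mul,
    one_mul] at h
  exact h

theorem IsRow.coeff_quotG_eq_zero (hg : IsRow g v) {f : MvPowerSeries (Fin n) Lazard}
    (hf : gProd g n ∣ partOn Finset.univ f) {N : ℕ}
    (h0 : ∀ d : Fin n →₀ ℕ, d.degree < N → coeff d f = 0) (k : Fin n →₀ ℕ)
    (hk : n + k.degree < N) : coeff k (quotG g f) = 0 := by
  obtain ⟨P, -, hP, h⟩ := hg.exists_coeff_add_ones n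
  refine coeff_eq_zero_of_mul (N := N - n) hP (fun e he => ?_) k (by omega)
  rw [← h f hf]
  exact h0 _ (by rw [map_add, degree_ones]; omega)

/-- The lowest coefficients of the image under the substitution of `x̄_i` for `x_j`. -/
theorem coeff_pairHom_of_lowest {f : MvPowerSeries (Fin n) Lazard} {i j : Fin n} {N : ℕ}
    (h0 : ∀ e : Fin n →₀ ℕ, e.degree < N → coeff e f = 0) {M : Fin n →₀ ℕ} (hM : M.degree = N) :
    coeff M (pairHom i j f) = finsum fun e : Fin n →₀ ℕ => coeff e f *
      if e.erase j + Finsupp.single i (e j) = M then (-1) ^ e j else 0 := by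
  classical
  -- As `x̄_i = x_i ω` with `ω(0) = -1`, the monomial `x ^ e` goes to a monomial of the same degree,
  -- with `e_j` moved to position `i`, times `ω ^ e_j`. In the lowest degree only the constant term
  -- of `ω ^ e_j` counts.
  obtain ⟨ω, hω, h⟩ := exists_finv_eq (constantCoeff_X_lazard i)
  rw [pairHom, coeff_evalHom]
  refine finsum_congr fun e => ?_
  by_cases he : e.degree < N
  · rw [h0 e he, zero_mul, zero_mul]
  congr 1
  have hprod : (e.prod fun s k => (if s = j then finv (X i) else X s :
      MvPowerSeries (Fin n) Lazard) ^ k) =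
      monomial (e.erase j + Finsupp.single i (e j)) 1 * ω ^ e j := by
    rw [← Finsupp.mul_prod_erase' e j _ (by simp), if_pos rfl, h, mul_pow, X_pow_eq,
      show (1 : Lazard) = 1 * 1 by rw [mul_one], ← monomial_mul_monomial, one_mul]
    have : ((e.erase j).prod fun s k => (if s = j then X i * ω else X s :
        MvPowerSeries (Fin n) Lazard) ^ k) = monomial (e.erase j) 1 := by
      rw [monomial_one_eq]
      refine Finsupp.prod_congr fun s hs => ?_
      rw [if_neg]
      rintro rfl
      simp at hs
    rw [this]
    ring
  have hdeg : (e.erase j + Finsupp.single i (e j)).degree = e.degree := by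
    conv_rhs => rw [← Finsupp.erase_add_single j e]
    rw [map_add, map_add, Finsupp.degree_single, Finsupp.degree_single]
  rw [hprod, coeff_monomial_mul, one_mul]
  by_cases heM : e.erase j + Finsupp.single i (e j) = M
  · rw [if_pos heM.le, if_pos heM, heM, tsub_self, coeff_zero_eq_constantCoeff_apply, map_pow, hω]
  · rw [if_neg heM, if_neg]
    intro hle
    obtain ⟨c, hc⟩ := exists_add_of_le hle
    have hc0 : c.degree = 0 := by
      have := congrArg Finsupp.degree hc
      rw [map_add] at this
      omega
    rw [(Finsupp.degree_eq_zero_iff c).1 hc0, add_zero] at hc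
    exact heM hc.symm

theorem coeff_pairHom_eq_zero {i j : Fin n} (hij : i ≠ j) (f : MvPowerSeries (Fin n) Lazard)
    {M : Fin n →₀ ℕ} (hM : M j ≠ 0) : coeff M (pairHom i j f) = 0 := by
  have h : setZero j (pairHom i j f) = pairHom i j f := by
    rw [setZero, pairHom, evalHom_evalHom]
    refine evalHom_congr _ _ (fun s => ?_) f
    split_ifs with h
    · rw [evalHom_finv (constantCoeff_X_lazard i), evalHom_X, if_neg hij]
    · rw [evalHom_X, if_neg h]
  rw [← h, coeff_setZero, if_neg hM]

variable {f : ∀ n, MvPowerSeries (Fin n) Lazard}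

theorem IsGammaFamily.coeff_embDomain (hf : IsGammaFamily g f) (π : Equiv.Perm (Fin n))
    (d : Fin n →₀ ℕ) : coeff (d.embDomain π.toEmbedding) (f n) = coeff d (f n) := by
  conv_lhs => rw [← hf.symm n π]
  rw [coeff_permHom]

/-- With `e_i + e_j` fixed, the identity `2 (e_i ^ 2 + e_j ^ 2) = (e_i + e_j) ^ 2 + (e_i - e_j) ^ 2`
shows that the equal splitting is the strict minimum. -/
theorem sum_sq_lt_of_pair {i j : Fin n} (hij : i ≠ j) {d e : Fin n →₀ ℕ} (hd : d i = d j)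
    (h : e.erase j + Finsupp.single i (e j) = d.erase j + Finsupp.single i (d j)) (hne : e ≠ d) :
    ∑ s, d s ^ 2 < ∑ s, e s ^ 2 := by
  have hs : ∀ s, s ≠ i → s ≠ j → e s = d s := by
    intro s hsi hsj
    have := DFunLike.congr_fun h s
    simpa [Finsupp.erase_ne hsj, hsi.symm] using this
  have hi : e i + e j = d i + d j := by
    have := DFunLike.congr_fun h i
    simpa [Finsupp.erase_ne hij] using this
  have hj : j ∈ Finset.univ.erase i := Finset.mem_erase.2 ⟨hij.symm, Finset.mem_univ _⟩
  rw [← Finset.add_sum_erase _ _ (Finset.mem_univ i), ← Finset.add_sum_erase _ _ hj,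
    ← Finset.add_sum_erase _ (fun s => e s ^ 2) (Finset.mem_univ i),
    ← Finset.add_sum_erase _ (fun s => e s ^ 2) hj, ← add_assoc, ← add_assoc]
  have hrest : ∑ s ∈ (Finset.univ.erase i).erase j, e s ^ 2 =
      ∑ s ∈ (Finset.univ.erase i).erase j, d s ^ 2 := by
    refine Finset.sum_congr rfl fun s hs' => ?_
    obtain ⟨hsj, hs'⟩ := Finset.mem_erase.1 hs'
    rw [hs s (Finset.ne_of_mem_erase hs') hsj]
  rw [hrest]
  refine Nat.add_lt_add_right ?_ _
  have hne' : e i ≠ e j := by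
    intro h'
    apply hne
    ext s
    by_cases hsi : s = i
    · subst hsi; omega
    by_cases hsj : s = j
    · subst hsj; omega
    exact hs s hsi hsj
  zify at *
  have h1 : (0 : ℤ) < (e i - e j : ℤ) ^ 2 := by
    have : (e i - e j : ℤ) ≠ 0 := sub_ne_zero.2 hne'
    positivity
  have h2 : (d i : ℤ) ^ 2 + d j ^ 2 = 2 * d i ^ 2 := by rw [← hd]; ring
  have h3 : (e i + e j : ℤ) = 2 * d i := by rw [hi, ← hd]; ring
  nlinarith

theorem exists_perm_strictAnti {d : Fin n → ℕ} (hd : Function.Injective d) :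
    ∃ π : Equiv.Perm (Fin n), StrictAnti (d ∘ π) := by
  refine ⟨Tuple.sort (OrderDual.toDual ∘ d), ?_⟩
  have h := Tuple.monotone_sort (OrderDual.toDual ∘ d)
  have h' : Antitone (d ∘ Tuple.sort (OrderDual.toDual ∘ d)) := fun a b hab => h hab
  exact h'.strictAnti_of_injective (hd.comp (Equiv.injective _))

/-- Induction on the degree and then on the number of variables. Exponents with a zero entry reduce
to fewer variables by symmetry and stability. Positive distinct entries can be sorted and are
governed by a strict coefficient. Exponents with a repeated entry are excluded by the cancellation
law. -/
theorem IsGammaFamily.coeff_eq_zero (hg : IsRow g v) (hf : IsGammaFamily g f) {N : ℕ}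
    (hc : ∀ n (k : Fin n →₀ ℕ), StrictAnti k → n + k.degree ≤ N → coeff k (quotG g (f n)) = 0)
    (n : ℕ) (d : Fin n →₀ ℕ) (hd : d.degree ≤ N) : coeff d (f n) = 0 := by
  induction hm : d.degree using Nat.strong_induction_on generalizing n d with
  | _ m ihm =>
  induction n with
  | zero =>
    by_cases hm0 : m = 0
    · have hd0 : d = 0 := Subsingleton.elim _ _
      obtain ⟨P, -, hP, h⟩ := hg.exists_coeff_add_ones 0
      have h1 := h (f 0) (hf.dvd 0) 0
      rw [coeff_mul_of_lowest (N := 0) (fun e he => by omega) (by simp),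
        hc 0 0 (fun a => a.elim0) (by simp), mul_zero] at h1
      rw [← h1]
      exact congrArg (fun d => coeff d (f 0)) (Subsingleton.elim _ _)
    · have : d = 0 := Subsingleton.elim _ _
      rw [this, map_zero] at hm
      exact absurd hm.symm hm0
  | succ n ihn =>
  have hlow : ∀ e : Fin (n + 1) →₀ ℕ, e.degree < m → coeff e (f (n + 1)) = 0 :=
    fun e he => ihm _ he _ e (by omega) rfl
  by_contra hne
  let S : Set (Fin (n + 1) →₀ ℕ) := {e | e.degree = m ∧ coeff e (f (n + 1)) ≠ 0}
  have hS : S.Finite := by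
    have : (S ⊆ {e | e.degree ≤ m}) := fun e he => he.1.le
    exact (Finsupp.finite_of_degree_le m).subset this
  -- Maximality of the sum of squares serves the case of a repeated entry: all other exponents with
  -- the same merged exponent have a larger sum of squares, hence zero coefficient.
  obtain ⟨d, hdS, hmax⟩ := Set.exists_max_image S (fun e => ∑ s, e s ^ 2) hS ⟨d, hm, hne⟩
  obtain ⟨hm, hne⟩ := hdS
  have hpos : ∀ s, d s ≠ 0 := by
    intro s hs
    let π := Equiv.swap s (Fin.last n)
    have h1 := hf.coeff_embDomain π d
    have h2 : ∃ e : Fin n →₀ ℕ, e.embDomain Fin.castSuccEmb = d.embDomain π.toEmbedding := by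
      refine ⟨(d.embDomain π.toEmbedding).comapDomain Fin.castSuccEmb
        Fin.castSuccEmb.injective.injOn, Finsupp.embDomain_comapDomain ?_⟩
      intro t ht
      induction t using Fin.lastCases with
      | last =>
        exfalso
        have h3 : Fin.last n = π.toEmbedding s := by simp [π]
        rw [Finset.mem_coe, Finsupp.mem_support_iff, h3, Finsupp.embDomain_apply_self] at ht
        exact ht hs
      | cast t => exact ⟨t, rfl⟩
    obtain ⟨e, he⟩ := h2
    have hdeg : e.degree = m := by
      have : (e.embDomain Fin.castSuccEmb).degree = (d.embDomain π.toEmbedding).degree := by rw [he]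
      simpa [Finsupp.embDomain_eq_mapDomain, Finsupp.degree_mapDomain, hm] using this
    rw [← he, ← coeff_killLast, hf.stable] at h1
    exact hne (h1.symm.trans (ihn e (by omega) hdeg))
  by_cases hinj : Function.Injective d
  · obtain ⟨π, hπ⟩ := exists_perm_strictAnti hinj
    set e := d.embDomain π.symm.toEmbedding with hedef
    have hes : ∀ s, e s = d (π s) := by
      intro s
      have := Finsupp.embDomain_apply_self π.symm.toEmbedding d (π s)
      simpa using this
    have hdeg : e.degree = m := by
      rw [hedef, Finsupp.embDomain_eq_mapDomain, Finsupp.degree_mapDomain, hm]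
    set k := e - ones (n + 1) with hk
    have hek : ones (n + 1) + k = e := by
      ext s
      have := hpos (π s)
      simp only [hk, Finsupp.add_apply, Finsupp.tsub_apply, ones_apply, hes]
      omega
    have hkdeg : n + 1 + k.degree = m := by
      rw [← hdeg, ← hek, map_add, degree_ones]
    obtain ⟨P, -, hP, h⟩ := hg.exists_coeff_add_ones (n + 1)
    have h1 := h (f (n + 1)) (hf.dvd _) k
    have h2 := hg.coeff_quotG_eq_zero (hf.dvd (n + 1)) hlow
    rw [coeff_mul_of_lowest (N := k.degree) (fun e he => h2 e (by omega)) rfl, hc _ k ?_ (by omega),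
      mul_zero, hek, hedef, hf.coeff_embDomain] at h1
    · exact hne h1
    · intro a b hab
      have h3 := hπ hab
      simp only [Function.comp_apply] at h3
      simp only [hk, Finsupp.tsub_apply, ones_apply, hes]
      have := hpos (π b)
      omega
  · obtain ⟨i, j, hd', hij⟩ : ∃ i j, d i = d j ∧ i ≠ j := by
      simpa [Function.Injective] using hinj
    set M := d.erase j + Finsupp.single i (d j) with hMdef
    have hMdeg : M.degree = m := by
      rw [← hm, hMdef]
      conv_rhs => rw [← Finsupp.erase_add_single j d]
      rw [map_add, map_add, Finsupp.degree_single, Finsupp.degree_single]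
    have hMi : M i ≠ 0 := by
      have := hpos i
      rw [hMdef, Finsupp.add_apply, Finsupp.erase_ne hij]
      omega
    -- The left side vanishes, because by the cancellation law the substituted series is free of
    -- `x_i` while `M i ≠ 0`. On the right only `e = d` survives, and its coefficient appears up to
    -- sign.
    have h1 := coeff_pairHom_of_lowest (i := i) (j := j) hlow hMdeg
    rw [hf.cancel _ i j hij, coeff_pairHom_eq_zero hij.symm _ hMi, finsum_eq_single _ d,
      if_pos rfl] at h1
    · have : ((-1 : Lazard) ^ d j) ≠ 0 := pow_ne_zero _ (neg_ne_zero.2 one_ne_zero)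
      exact (mul_ne_zero hne this) h1.symm
    · intro e hed
      by_cases heM : e.erase j + Finsupp.single i (e j) = M
      · have hdeg : e.degree = m := by
          rw [← hMdeg, ← heM]
          conv_lhs => rw [← Finsupp.erase_add_single j e]
          rw [map_add, map_add, Finsupp.degree_single, Finsupp.degree_single]
        have hlt := sum_sq_lt_of_pair hij hd' heM hed
        have : coeff e (f (n + 1)) = 0 := by
          by_contra h
          exact absurd (hmax e ⟨hdeg, h⟩) (not_le.2 hlt)
        rw [this, zero_mul]
      · rw [if_neg heM, mul_zero]

end Coefficients

/-! ### Leading terms of the universal Schur functions -/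

section Weight

variable {n : ℕ}

/-- The weight `∑ i d_i` of an exponent. -/
def wt (d : Fin n →₀ ℕ) : ℕ := ∑ i, (i.val + 1) * d i

theorem wt_add (d e : Fin n →₀ ℕ) : wt (d + e) = wt d + wt e := by
  simp [wt, mul_add, Finset.sum_add_distrib]

@[simp] theorem wt_zero : wt (0 : Fin n →₀ ℕ) = 0 := by simp [wt]

@[simp] theorem wt_single (i : Fin n) (k : ℕ) : wt (Finsupp.single i k) = (i.val + 1) * k := by
  classical
  rw [wt, Finset.sum_eq_single i]
  · simp
  · intro j _ hj
    simp [Finsupp.single_eq_of_ne hj]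
  · simp

theorem degree_le_wt (d : Fin n →₀ ℕ) : d.degree ≤ wt d := by
  rw [Finsupp.degree_eq_sum, wt]
  exact Finset.sum_le_sum fun i _ => Nat.le_mul_of_pos_left _ (Nat.succ_pos _)

/-- All monomials of `f` have weight at least `N`. -/
def WtGE (f : MvPowerSeries (Fin n) Lazard) (N : ℕ) : Prop := ∀ e, wt e < N → coeff e f = 0

/-- The lowest weight part of `f` is the monomial `a x ^ d`. -/
def IsLead (f : MvPowerSeries (Fin n) Lazard) (d : Fin n →₀ ℕ) (a : Lazard) : Prop :=
  ∀ e, wt e ≤ wt d → coeff e f = if e = d then a else 0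

variable {f h : MvPowerSeries (Fin n) Lazard} {d e : Fin n →₀ ℕ} {a b : Lazard} {M N : ℕ}

theorem WtGE.mono (hf : WtGE f N) (hMN : M ≤ N) : WtGE f M := fun e he => hf e (he.trans_le hMN)

theorem WtGE.zero (N : ℕ) : WtGE (0 : MvPowerSeries (Fin n) Lazard) N := fun _ _ => rfl

theorem WtGE.add (hf : WtGE f N) (hh : WtGE h N) : WtGE (f + h) N := fun e he => by
  rw [map_add, hf e he, hh e he, add_zero]

theorem WtGE.mul (hf : WtGE f N) (hh : WtGE h M) : WtGE (f * h) (N + M) := fun e he => by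
  rw [coeff_mul]
  refine Finset.sum_eq_zero fun p hp => ?_
  have hp' : wt p.1 + wt p.2 = wt e := by
    rw [← wt_add, Finset.HasAntidiagonal.mem_antidiagonal.1 hp]
  by_cases h1 : wt p.1 < N
  · rw [hf _ h1, zero_mul]
  · rw [hh _ (by omega), mul_zero]

theorem WtGE.sum {ι : Type*} {s : Finset ι} {f : ι → MvPowerSeries (Fin n) Lazard}
    (hf : ∀ i ∈ s, WtGE (f i) N) : WtGE (∑ i ∈ s, f i) N := fun e he => by
  rw [map_sum]
  exact Finset.sum_eq_zero fun i hi => hf i hi e he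

theorem IsLead.wtGE (hf : IsLead f d a) : WtGE f (wt d) := fun e he => by
  rw [hf e he.le, if_neg]
  rintro rfl
  exact lt_irrefl _ he

theorem IsLead.coeff_eq (hf : IsLead f d a) : coeff d f = a := by
  rw [hf d le_rfl, if_pos rfl]

theorem IsLead.add (hf : IsLead f d a) (hh : WtGE h (wt d + 1)) : IsLead (f + h) d a :=
  fun e he => by rw [map_add, hf e he, hh e (by omega), add_zero]

theorem IsLead.coeff_add_mul (hf : IsLead f d a) (hh : WtGE h N) (he : wt e ≤ N) :
    coeff (d + e) (f * h) = a * coeff e h := by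
  rw [coeff_mul, Finset.sum_eq_single (d, e)]
  · rw [hf.coeff_eq]
  · rintro ⟨p, q⟩ hp hne
    have hp' : p + q = d + e := Finset.HasAntidiagonal.mem_antidiagonal.1 hp
    have hw : wt p + wt q = wt d + wt e := by rw [← wt_add, hp', wt_add]
    by_cases hq : wt q < N
    · rw [hh q hq, mul_zero]
    · have hpd : p ≠ d := by
        rintro rfl
        exact hne (by rw [add_left_cancel hp'])
      rw [hf p (by omega), if_neg hpd, zero_mul]
  · intro h
    exact absurd (Finset.HasAntidiagonal.mem_antidiagonal.2 (show d + e = d + e from rfl)) h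

theorem IsLead.mul (hf : IsLead f d a) (hh : IsLead h e b) : IsLead (f * h) (d + e) (a * b) := by
  intro c hc
  by_cases hcd : ∃ c', c = d + c'
  · obtain ⟨c', rfl⟩ := hcd
    rw [wt_add, wt_add] at hc
    rw [hf.coeff_add_mul hh.wtGE (by omega), hh c' (by omega)]
    simp
  · have : c ≠ d + e := fun h => hcd ⟨e, h⟩
    rw [if_neg this, coeff_mul]
    refine Finset.sum_eq_zero fun p hp => ?_
    have hp' : p.1 + p.2 = c := Finset.HasAntidiagonal.mem_antidiagonal.1 hp
    have hw : wt p.1 + wt p.2 ≤ wt d + wt e := by rw [← wt_add, hp', ← wt_add]; exact hc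
    by_cases h1 : wt p.1 ≤ wt d
    · rw [hf _ h1, if_neg, zero_mul]
      intro h
      exact hcd ⟨p.2, by rw [← hp', h]⟩
    · rw [hh.wtGE p.2 (by omega), mul_zero]

theorem isLead_of_constantCoeff (f : MvPowerSeries (Fin n) Lazard) :
    IsLead f 0 (constantCoeff f) := by
  intro e he
  have : e = 0 := by
    have := degree_le_wt e
    rw [wt_zero] at he
    exact (Finsupp.degree_eq_zero_iff e).1 (by omega)
  rw [if_pos this, this, coeff_zero_eq_constantCoeff_apply]

theorem IsLead.prod {ι : Type*} {s : Finset ι} {f : ι → MvPowerSeries (Fin n) Lazard}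
    {d : ι → Fin n →₀ ℕ} {a : ι → Lazard} (hf : ∀ i ∈ s, IsLead (f i) (d i) (a i)) :
    IsLead (∏ i ∈ s, f i) (∑ i ∈ s, d i) (∏ i ∈ s, a i) := by
  classical
  induction s using Finset.induction_on with
  | empty => simpa using isLead_of_constantCoeff (1 : MvPowerSeries (Fin n) Lazard)
  | insert i s hi ih =>
    rw [Finset.prod_insert hi, Finset.sum_insert hi, Finset.prod_insert hi]
    exact (hf i (Finset.mem_insert_self _ _)).mul
      (ih fun j hj => hf j (Finset.mem_insert_of_mem hj))

theorem WtGE.of_mul {ε : Lazard} (hε : ε ≠ 0) (hf : IsLead f d ε)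
    (hfh : WtGE (f * h) (wt d + N)) : WtGE h N := by
  induction N with
  | zero => exact fun c hc => absurd hc (Nat.not_lt_zero _)
  | succ M ih =>
    intro c hc
    have hM := ih (hfh.mono (by omega))
    by_cases hcM : wt c < M
    · exact hM c hcM
    · have h1 := hf.coeff_add_mul hM (e := c) (by omega)
      rw [hfh _ (by rw [wt_add]; omega)] at h1
      exact (mul_eq_zero.1 h1.symm).resolve_left hε

/-- Division of leading terms. -/
theorem IsLead.of_mul {ε : Lazard} (hε : ε ≠ 0) (hf : IsLead f d ε)
    (hfh : IsLead (f * h) (d + e) (ε * b)) : IsLead h e b := by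
  have hlb : WtGE h (wt e) := WtGE.of_mul hε hf (by rw [← wt_add]; exact hfh.wtGE)
  intro c hc
  have h1 := hf.coeff_add_mul hlb hc
  rw [hfh _ (by rw [wt_add, wt_add]; omega)] at h1
  by_cases h2 : c = e
  · rw [h2, if_pos rfl] at h1
    rw [h2, if_pos rfl]
    exact (mul_left_cancel₀ hε h1).symm
  · rw [if_neg fun h => h2 (add_left_cancel h)] at h1
    rw [if_neg h2]
    exact (mul_eq_zero.1 h1.symm).resolve_left hε

end Weight

/-! ### Lowest weight terms of numerators, denominators and rows -/

section Factors

variable {n : ℕ} {a b : Fin n}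

theorem isLead_X (a : Fin n) : IsLead (X a) (Finsupp.single a 1) 1 := fun _ _ => coeff_X _ _

/-- The weight of a variable increases with its index, so in `x_a - x_b` the term `x_a` is the
lighter one, and the unit cofactor has constant term `1`. -/
theorem isLead_den (hab : a < b) : IsLead (den a b) (Finsupp.single a 1) 1 := by
  obtain ⟨u, hu, h⟩ := exists_den_eq a b
  have h2 : IsLead (X a - X b) (Finsupp.single a 1) 1 := by
    rw [sub_eq_add_neg]
    refine (isLead_X a).add fun e he => ?_
    rw [map_neg, (isLead_X b).wtGE e, neg_zero]
    simp only [wt_single] at he ⊢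
    have : a.val < b.val := hab
    omega
  have := h2.mul (isLead_of_constantCoeff u)
  rwa [hu, mul_one, add_zero, ← h] at this

theorem isLead_den' (hab : a < b) : IsLead (den b a) (Finsupp.single a 1) (-1) := by
  obtain ⟨u, hu, h⟩ := exists_den_eq b a
  have h2 : IsLead (X b - X a) (Finsupp.single a 1) (-1) := by
    rw [sub_eq_neg_add]
    refine IsLead.add (fun e he => ?_) fun e he => ?_
    · rw [map_neg, isLead_X a e he]
      split_ifs <;> simp
    · rw [(isLead_X b).wtGE e]
      simp only [wt_single] at he ⊢
      have : a.val < b.val := hab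
      omega
  have := h2.mul (isLead_of_constantCoeff u)
  rwa [hu, mul_one, add_zero, ← h] at this

theorem isLead_num (hab : a < b) : IsLead (num a b) (Finsupp.single a 1) 1 := by
  obtain ⟨c, hc⟩ := exists_fadd_eq (constantCoeff_X_lazard a) (constantCoeff_X_lazard b)
  rw [num, hc, add_assoc]
  have hab' : a.val < b.val := hab
  have hb : WtGE (X b : MvPowerSeries (Fin n) Lazard) (wt (Finsupp.single a 1) + 1) :=
    (isLead_X b).wtGE.mono (by simp only [wt_single]; omega)
  refine (isLead_X a).add (hb.add ?_)
  have h0 : WtGE (X a * c : MvPowerSeries (Fin n) Lazard) 0 :=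
    fun e he => absurd he (Nat.not_lt_zero _)
  rw [mul_right_comm]
  simpa using h0.mul hb

theorem num_comm (a b : Fin n) : num a b = num b a :=
  fadd_comm (constantCoeff_X_lazard a) (constantCoeff_X_lazard b)

/-- The sign of the leading coefficient of `den a b`. -/
noncomputable def leadSign (a b : Fin n) : Lazard := if a < b then 1 else -1

theorem isLead_den_min (hab : a ≠ b) :
    IsLead (den a b) (Finsupp.single (min a b) 1) (leadSign a b) := by
  rcases lt_or_gt_of_ne hab with h | h
  · rw [leadSign, if_pos h, min_eq_left h.le]
    exact isLead_den h
  · rw [leadSign, if_neg h.not_gt, min_eq_right h.le]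
    exact isLead_den' h

theorem isLead_num_min (hab : a ≠ b) : IsLead (num a b) (Finsupp.single (min a b) 1) 1 := by
  rcases lt_or_gt_of_ne hab with h | h
  · rw [min_eq_left h.le]
    exact isLead_num h
  · rw [min_eq_right h.le, num_comm]
    exact isLead_num h

theorem isLead_row {g : PowerSeries Lazard} (hg : PowerSeries.constantCoeff g = 0) {k : ℕ}
    (hk : 0 < k) (a : Fin n) :
    IsLead (row g k (X a)) (Finsupp.single a k) (PowerSeries.coeff 1 g) := by
  have h1 : IsLead (PowerSeries.subst (X a : MvPowerSeries (Fin n) Lazard) g) (Finsupp.single a 1)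
      (PowerSeries.coeff 1 g) := by
    intro e he
    rw [coeff_psubst_X]
    by_cases h : e = Finsupp.single a (e a)
    · rw [if_pos h]
      rw [h, wt_single, wt_single] at he
      have h2 := Nat.le_of_mul_le_mul_left he (Nat.succ_pos _)
      have : e a = 0 ∨ e a = 1 := by omega
      rcases this with h' | h'
      · rw [h', if_neg, PowerSeries.coeff_zero_eq_constantCoeff_apply, hg]
        rw [h, h']
        intro h''
        have := DFunLike.congr_fun h'' a
        simp at this
      · rw [h', if_pos (by rw [h, h'])]
    · rw [if_neg h, if_neg]
      rintro rfl
      simp at h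
  have h2 : IsLead (X a ^ (k - 1) : MvPowerSeries (Fin n) Lazard) (Finsupp.single a (k - 1)) 1 :=
    fun e _ => by rw [coeff_X_pow]
  have := h1.mul h2
  rwa [← Finsupp.single_add, Nat.add_sub_cancel' hk, mul_one] at this

end Factors

/-! ### Minimal assignments -/

section MinCost

variable {n : ℕ}

/-- The minimal weight of a product of row factors with distinct variables from `S`. -/
noncomputable def minCost : List ℕ → Finset (Fin n) → ℕ
  | [], _ => 0
  | k :: L, S => sInf ((fun a : Fin n => (a.val + 1) * k + minCost L (S.erase a)) '' S)

theorem minCost_cons_le {k : ℕ} (L : List ℕ) {S : Finset (Fin n)} {a : Fin n} (ha : a ∈ S) :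
    minCost (k :: L) S ≤ (a.val + 1) * k + minCost L (S.erase a) :=
  Nat.sInf_le ⟨a, ha, rfl⟩

theorem exists_minCost_cons_eq (k : ℕ) (L : List ℕ) {S : Finset (Fin n)} (hS : S.Nonempty) :
    ∃ a ∈ S, minCost (k :: L) S = (a.val + 1) * k + minCost L (S.erase a) := by
  obtain ⟨a, ha, h⟩ := Nat.sInf_mem
    (s := (fun a : Fin n => (a.val + 1) * k + minCost L (S.erase a)) '' S)
    ((Finset.coe_nonempty.2 hS).image _)
  exact ⟨a, ha, h.symm⟩

/-- In an optimal assignment that may use `m`, the index `a` can take over the part given to `m`;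
this raises the weight by at most `K * (a - m)`. -/
theorem minCost_insert_le {L : List ℕ} {K : ℕ} (hK : ∀ k ∈ L, k ≤ K) {m a : Fin n} (hma : m < a)
    {T : Finset (Fin n)} (hm : m ∉ T) (ha : a ∉ T) :
    minCost L (insert a T) ≤ minCost L (insert m T) + K * (a.val - m.val) := by
  induction L generalizing T with
  | nil => exact Nat.zero_le _
  | cons k L ih =>
    obtain ⟨b, hb, h⟩ := exists_minCost_cons_eq k L (Finset.insert_nonempty m T)
    rw [h]
    have hma' : m.val < a.val := hma
    rcases Finset.mem_insert.1 hb with rfl | hbT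
    · refine (minCost_cons_le L (Finset.mem_insert_self a T)).trans ?_
      rw [Finset.erase_insert ha, Finset.erase_insert hm]
      have h1 : (a.val + 1) * k = (b.val + 1) * k + k * (a.val - b.val) := by
        obtain ⟨c, hc⟩ := Nat.exists_eq_add_of_lt hma'
        rw [hc, show b.val + c + 1 - b.val = c + 1 by omega]
        ring
      have h2 := Nat.mul_le_mul_right (a.val - b.val) (hK k List.mem_cons_self)
      omega
    · have hbm : m ≠ b := fun h => hm (h ▸ hbT)
      have hba : a ≠ b := fun h => ha (h ▸ hbT)
      refine (minCost_cons_le L (Finset.mem_insert_of_mem hbT)).trans ?_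
      rw [Finset.erase_insert_of_ne hba, Finset.erase_insert_of_ne hbm]
      have := ih (fun k hk => hK k (List.mem_cons_of_mem _ hk))
        (fun h => hm (Finset.mem_of_mem_erase h)) (fun h => ha (Finset.mem_of_mem_erase h))
        (T := T.erase b)
      omega

/-- Giving the largest part `k` to `a` instead of `m` costs `k * (a - m)`, while freeing `m` saves
at most `(k - 1) * (a - m)` on the smaller parts. This strict rearrangement inequality makes the
leading term unique. -/
theorem minCost_lt {k : ℕ} {L : List ℕ} (hk : ∀ k' ∈ L, k' < k) (hk0 : 0 < k)
    {S : Finset (Fin n)} {m a : Fin n} (hm : m ∈ S) (ha : a ∈ S) (hma : m < a) :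
    (m.val + 1) * k + minCost L (S.erase m) < (a.val + 1) * k + minCost L (S.erase a) := by
  have h := minCost_insert_le (L := L) (K := k - 1) (fun k' hk' => Nat.le_sub_one_of_lt (hk k' hk'))
    hma (T := (S.erase m).erase a) (fun h => Finset.notMem_erase m S (Finset.mem_of_mem_erase h))
    (Finset.notMem_erase a _)
  rw [Finset.insert_erase (Finset.mem_erase.2 ⟨hma.ne', ha⟩), Finset.erase_right_comm,
    Finset.insert_erase (Finset.mem_erase.2 ⟨hma.ne, hm⟩)] at h
  obtain ⟨c, hc⟩ := Nat.exists_eq_add_of_lt (show m.val < a.val from hma)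
  rw [show a.val - m.val = c + 1 by omega] at h
  have h1 : (a.val + 1) * k = (m.val + 1) * k + (k - 1) * (c + 1) + (c + 1) := by
    obtain ⟨k, rfl⟩ := Nat.exists_eq_add_of_lt hk0
    rw [hc, show 0 + k + 1 - 1 = k by omega]
    ring
  omega

/-- The weight `∑ (j + i) L_i`. -/
def listWt : ℕ → List ℕ → ℕ
  | _, [] => 0
  | j, k :: L => (j + 1) * k + listWt (j + 1) L

/-- The indices at least `j`. -/
def upper (n j : ℕ) : Finset (Fin n) := Finset.univ.filter fun i => j ≤ i.val

theorem mem_upper {j : ℕ} {i : Fin n} : i ∈ upper n j ↔ j ≤ i.val := by simp [upper]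

theorem upper_erase {j : ℕ} (hj : j < n) : (upper n j).erase ⟨j, hj⟩ = upper n (j + 1) := by
  ext i
  rw [Finset.mem_erase, mem_upper, mem_upper, Ne, Fin.ext_iff]
  dsimp only
  omega

theorem minCost_upper {L : List ℕ} (hL : L.Pairwise (· > ·)) (hpos : ∀ k ∈ L, 0 < k) {j : ℕ}
    (hn : j + L.length ≤ n) : minCost L (upper n j) = listWt j L := by
  induction L generalizing j with
  | nil => rfl
  | cons k L ih =>
    rw [List.length_cons] at hn
    have hj : j < n := by omega
    rw [List.pairwise_cons] at hL
    have hm : (⟨j, hj⟩ : Fin n) ∈ upper n j := mem_upper.2 le_rfl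
    have hih := ih hL.2 (fun k hk => hpos k (List.mem_cons_of_mem _ hk)) (j := j + 1) (by omega)
    refine le_antisymm ?_ ?_
    · refine (minCost_cons_le L hm).trans ?_
      rw [upper_erase, hih, listWt]
    · obtain ⟨a, ha, h⟩ := exists_minCost_cons_eq k L ⟨_, hm⟩
      rw [h, listWt, ← hih, ← upper_erase hj]
      rcases (mem_upper.1 ha).eq_or_lt with h' | h'
      · rw [show a = ⟨j, hj⟩ from Fin.ext h'.symm]
      · exact (minCost_lt hL.1 (hpos k List.mem_cons_self) hm ha h').le

/-- The exponent with entries `L` from position `j` on. -/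
noncomputable def listExp (n j : ℕ) (L : List ℕ) : Fin n →₀ ℕ :=
  Finsupp.equivFunOnFinite.symm fun i => if j ≤ i.val then L.getD (i.val - j) 0 else 0

theorem listExp_apply (j : ℕ) (L : List ℕ) (i : Fin n) :
    listExp n j L i = if j ≤ i.val then L.getD (i.val - j) 0 else 0 := rfl

theorem listExp_cons {j : ℕ} (hj : j < n) (k : ℕ) (L : List ℕ) :
    listExp n j (k :: L) = Finsupp.single ⟨j, hj⟩ k + listExp n (j + 1) L := by
  ext i
  rw [Finsupp.add_apply, listExp_apply, listExp_apply]
  by_cases h : (⟨j, hj⟩ : Fin n) = i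
  · subst h
    simp
  · have h' : j ≠ i.val := fun h' => h (Fin.ext h')
    rw [Finsupp.single_eq_of_ne (Ne.symm h), zero_add]
    by_cases hji : j ≤ i.val
    · rw [if_pos hji, if_pos (by omega), show i.val - j = i.val - (j + 1) + 1 by omega,
        List.getD_cons_succ]
    · rw [if_neg hji, if_neg (by omega)]

theorem wt_listExp {L : List ℕ} {j : ℕ} (hn : j + L.length ≤ n) :
    wt (listExp n j L) = listWt j L := by
  induction L generalizing j with
  | nil => simp [listWt, wt, listExp]
  | cons k L ih =>
    rw [List.length_cons] at hn
    rw [listExp_cons (by omega), wt_add, wt_single, ih (by omega), listWt]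

end MinCost

/-! ### Lowest weight term of the symmetrization -/

section LeadSchur

variable {n : ℕ} {g : PowerSeries Lazard}

/-- The sum of `δ a b` over all pairs `a ≠ b` in `S`. -/
def pairSum {M : Type*} [AddCommMonoid M] (δ : Fin n → Fin n → M) (S : Finset (Fin n)) : M :=
  ∑ a ∈ S, ∑ b ∈ S.erase a, δ a b

theorem pairSum_eq_add_erase {M : Type*} [AddCommMonoid M] (δ : Fin n → Fin n → M)
    {S : Finset (Fin n)} {a : Fin n} (ha : a ∈ S) :
    pairSum δ S = (∑ b ∈ S.erase a, (δ a b + δ b a)) + pairSum δ (S.erase a) := by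
  have h : ∀ x ∈ S.erase a,
      ∑ b ∈ S.erase x, δ x b = δ x a + ∑ b ∈ (S.erase a).erase x, δ x b := by
    intro x hx
    rw [← Finset.add_sum_erase _ _
      (Finset.mem_erase.2 ⟨(Finset.ne_of_mem_erase hx).symm, ha⟩ : a ∈ S.erase x),
      Finset.erase_right_comm]
  rw [pairSum, ← Finset.add_sum_erase _ _ ha, Finset.sum_congr rfl h, Finset.sum_add_distrib,
    Finset.sum_add_distrib, add_assoc, pairSum]

/-- The leading exponent of the product of all denominators. -/
noncomputable def denExp (S : Finset (Fin n)) : Fin n →₀ ℕ :=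
  pairSum (fun a b => Finsupp.single (min a b) 1) S

theorem isLead_pairProd_den (S : Finset (Fin n)) :
    IsLead (pairProd den S) (denExp S) (pairProd leadSign S) :=
  IsLead.prod fun _ _ => IsLead.prod fun _ hb => isLead_den_min (Finset.ne_of_mem_erase hb).symm

theorem pairProd_leadSign_ne_zero (S : Finset (Fin n)) : pairProd (leadSign (n := n)) S ≠ 0 := by
  refine Finset.prod_ne_zero_iff.2 fun a _ => Finset.prod_ne_zero_iff.2 fun b _ => ?_
  rw [leadSign]
  split_ifs
  exacts [one_ne_zero, neg_ne_zero.2 one_ne_zero]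

/-- The common numerators of the symmetrizations over the variables in `S`. -/
noncomputable def numSumOn (g : PowerSeries Lazard) (L : List ℕ) (S : Finset (Fin n)) :
    MvPowerSeries (Fin n) Lazard :=
  schurSum (pairProd den) (fun a b => num a b * den b a) (fun k a => row g k (X a)) L S

theorem isLead_factor (a : Fin n) (S : Finset (Fin n)) :
    IsLead (∏ b ∈ S.erase a, num a b * den b a)
      (∑ b ∈ S.erase a, (Finsupp.single (min a b) 1 + Finsupp.single (min b a) 1))
      (∏ b ∈ S.erase a, leadSign b a) := by
  refine IsLead.prod fun b hb => ?_
  have hab := (Finset.ne_of_mem_erase hb).symm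
  have := (isLead_num_min hab).mul (isLead_den_min hab.symm)
  rwa [one_mul] at this

theorem wtGE_numSumOn (hg : PowerSeries.constantCoeff g = 0) {L : List ℕ}
    (hpos : ∀ k ∈ L, 0 < k) (S : Finset (Fin n)) :
    WtGE (numSumOn g L S) (wt (denExp S) + minCost L S) := by
  induction L generalizing S with
  | nil => exact (isLead_pairProd_den S).wtGE
  | cons k L ih =>
    refine WtGE.sum fun a ha => ?_
    have h1 := (isLead_row hg (hpos k List.mem_cons_self) a).wtGE
    have h2 := (isLead_factor a S).wtGE
    have h3 := ih (fun k hk => hpos k (List.mem_cons_of_mem _ hk)) (S.erase a)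
    refine ((h1.mul h2).mul h3).mono ?_
    have h4 := minCost_cons_le (k := k) L ha
    rw [denExp, pairSum_eq_add_erase _ ha, wt_add, ← denExp, wt_single]
    omega

/-- Giving the first part to the smallest available index has the least weight, and every other
choice is strictly heavier by `minCost_lt`. The signs agree because `leadSign m b = 1` for the
minimal index `m`. -/
theorem isLead_numSumOn (hg : PowerSeries.constantCoeff g = 0) {L : List ℕ}
    (hL : L.Pairwise (· > ·)) (hpos : ∀ k ∈ L, 0 < k) {j : ℕ} (hn : j + L.length ≤ n) :
    IsLead (numSumOn g L (upper n j)) (denExp (upper n j) + listExp n j L)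
      (pairProd leadSign (upper n j) * PowerSeries.coeff 1 g ^ L.length) := by
  induction L generalizing j with
  | nil =>
    have : listExp n j [] = 0 := by ext i; simp [listExp_apply]
    rw [this, add_zero, List.length_nil, pow_zero, mul_one]
    exact isLead_pairProd_den _
  | cons k L ih =>
    rw [List.length_cons] at hn
    have hj : j < n := by omega
    set m : Fin n := ⟨j, hj⟩ with hm
    have hmS : m ∈ upper n j := mem_upper.2 le_rfl
    have hL' := List.pairwise_cons.1 hL
    have hpos' : ∀ k ∈ L, 0 < k := fun k hk => hpos k (List.mem_cons_of_mem _ hk)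
    have hwt : wt (denExp (upper n j) + listExp n j (k :: L)) =
        wt (denExp (upper n j)) + ((j + 1) * k + minCost L (upper n (j + 1))) := by
      rw [wt_add, wt_listExp (by rw [List.length_cons]; omega), listWt,
        minCost_upper hL'.2 hpos' (by omega)]
    rw [numSumOn, schurSum, ← Finset.add_sum_erase _ _ hmS]
    refine IsLead.add ?_ (WtGE.sum fun a ha => ?_)
    · have h1 := isLead_row hg (hpos k List.mem_cons_self) m
      have h2 := isLead_factor m (upper n j)
      have h3 := ih hL'.2 hpos' (j := j + 1) (by omega)
      rw [← upper_erase hj] at h3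
      have h4 := (h1.mul h2).mul h3
      convert h4 using 1
      · rfl
      · rw [listExp_cons hj, denExp, pairSum_eq_add_erase _ hmS, ← denExp]
        abel
      · rw [pairProd_eq_mul_erase _ hmS, List.length_cons, pow_succ]
        have : ∀ b ∈ (upper n j).erase m, leadSign m b * leadSign b m = leadSign b m := by
          intro b hb
          rw [upper_erase hj, mem_upper] at hb
          rw [leadSign, if_pos (show m < b from hb), one_mul]
        rw [Finset.prod_congr rfl this]
        ring
    · obtain ⟨ham, ha⟩ := Finset.mem_erase.1 ha
      have hma : m < a := lt_of_le_of_ne (mem_upper.1 ha) (Ne.symm ham)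
      have h1 := (isLead_row hg (hpos k List.mem_cons_self) a).wtGE
      have h2 := (isLead_factor a (upper n j)).wtGE
      have h3 := wtGE_numSumOn hg hpos' ((upper n j).erase a)
      refine ((h1.mul h2).mul h3).mono ?_
      have h4 := minCost_lt hL'.1 (hpos k List.mem_cons_self) hmS ha hma
      rw [upper_erase hj] at h4
      rw [hwt, denExp, pairSum_eq_add_erase _ ha, wt_add, ← denExp, wt_single]
      have : m.val = j := rfl
      rw [this] at h4
      omega

/-- The lowest weight part of a universal Schur function. -/
theorem isLead_schurFn (hg : PowerSeries.constantCoeff g = 0) {L : List ℕ}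
    (hL : L.Pairwise (· > ·)) (hpos : ∀ k ∈ L, 0 < k) (hn : L.length ≤ n) :
    IsLead (schurFn g L n) (listExp n 0 L) (PowerSeries.coeff 1 g ^ L.length) := by
  have h0 : upper n 0 = Finset.univ := by ext i; simp [upper]
  have h := isLead_numSumOn hg hL hpos (n := n) (j := 0) (by omega)
  rw [h0, numSumOn, ← numSum, ← pairProd_mul_schurFn] at h
  exact IsLead.of_mul (pairProd_leadSign_ne_zero _) (isLead_pairProd_den _) h

theorem wtGE_schurFn (hg : PowerSeries.constantCoeff g = 0) {L : List ℕ}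
    (hL : L.Pairwise (· > ·)) (hpos : ∀ k ∈ L, 0 < k) (n : ℕ) :
    WtGE (schurFn g L n) (listWt 0 L) := by
  by_cases hn : L.length ≤ n
  · have := (isLead_schurFn hg hL hpos hn).wtGE
    rwa [wt_listExp (by omega)] at this
  · rw [schurFn_eq_zero_of_lt g (not_le.1 hn)]
    exact WtGE.zero _

end LeadSchur

/-! ### The triangular matrix of strict coefficients -/

namespace StrictPartition

/-- The weight `∑ i λ_i` of a strict partition. -/
def weight (l : StrictPartition) : ℕ := listWt 0 l.parts

theorem ext_parts {l m : StrictPartition} (h : l.parts = m.parts) : l = m := by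
  cases l; cases m; cases h; rfl

theorem eq_of_perm {l m : StrictPartition} (h : l.parts.Perm m.parts) : l = m :=
  ext_parts (h.eq_of_pairwise (fun _ _ _ _ h1 h2 => absurd h1 (not_lt.2 (le_of_lt h2)))
    l.strict m.strict)

theorem nodup (l : StrictPartition) : l.parts.Nodup :=
  l.strict.imp fun h => ne_of_gt h

theorem le_listWt {k : ℕ} {L : List ℕ} (hk : k ∈ L) (j : ℕ) : k ≤ listWt j L := by
  induction L generalizing j with
  | nil => simp at hk
  | cons k' L ih =>
    rw [listWt]
    rcases List.mem_cons.1 hk with rfl | hk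
    · exact (Nat.le_mul_of_pos_left _ (Nat.succ_pos j)).trans (Nat.le_add_right _ _)
    · exact (ih hk _).trans (Nat.le_add_left _ _)

theorem finite_weight_le (N : ℕ) : {l : StrictPartition | l.weight ≤ N}.Finite := by
  refine Set.Finite.of_finite_image (f := fun l : StrictPartition => l.parts.toFinset)
    ((Finset.finite_toSet (Finset.range (N + 1)).powerset).subset ?_) ?_
  · rintro _ ⟨l, hl, rfl⟩
    rw [Finset.mem_coe, Finset.mem_powerset]
    intro k hk
    have := le_listWt (List.mem_toFinset.1 hk) 0
    exact Finset.mem_range.2 (Nat.lt_succ_of_le (this.trans hl))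
  · intro l _ m _ h
    exact eq_of_perm (List.perm_of_nodup_nodup_toFinset_eq l.nodup m.nodup h)

/-- The strict partitions of weight at most `N`. -/
noncomputable def weightLE (N : ℕ) : Finset StrictPartition := (finite_weight_le N).toFinset

@[simp] theorem mem_weightLE {N : ℕ} {l : StrictPartition} : l ∈ weightLE N ↔ l.weight ≤ N := by
  simp [weightLE]

/-- The exponent `λ - (1, …, 1)` in as many variables as there are parts. -/
noncomputable def expo (l : StrictPartition) : Fin l.length →₀ ℕ :=
  listExp l.length 0 l.parts - ones l.length

theorem ones_add_expo (l : StrictPartition) :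
    ones l.length + l.expo = listExp l.length 0 l.parts := by
  ext i
  have h : (i : ℕ) < l.parts.length := i.2
  have := l.pos _ (List.getElem_mem h)
  have h2 : l.parts.getD i 0 = l.parts[(i : ℕ)] := by simp [h]
  simp only [expo, Finsupp.add_apply, Finsupp.tsub_apply, ones_apply, listExp_apply, Nat.zero_le,
    if_true, Nat.sub_zero, h2]
  omega

/-- The strict partition with parts `k_i + 1`. -/
def ofStrictAnti {n : ℕ} (k : Fin n → ℕ) (hk : StrictAnti k) : StrictPartition where
  parts := List.ofFn fun i => k i + 1
  strict := by
    rw [List.pairwise_ofFn]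
    intro i j hij
    exact Nat.succ_lt_succ (hk hij)
  pos := by
    intro a ha
    obtain ⟨i, rfl⟩ := List.mem_ofFn.1 ha
    exact Nat.succ_pos _

theorem listWt_le (j : ℕ) (L : List ℕ) : listWt j L ≤ (j + L.length) * L.sum := by
  induction L generalizing j with
  | nil => simp [listWt]
  | cons k L ih =>
    have := ih (j + 1)
    rw [listWt, List.length_cons, List.sum_cons, mul_add]
    have h1 : (j + 1) * k ≤ (j + (L.length + 1)) * k := Nat.mul_le_mul_right _ (by omega)
    have h2 : j + 1 + L.length = j + (L.length + 1) := by omega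
    rw [h2] at this
    omega

/-- There are at most `N` parts and their sum is at most `N`. This is the origin of the bounds `N *
N` that convert degree into weight. -/
theorem weight_ofStrictAnti_le {n : ℕ} (k : Fin n →₀ ℕ) (hk : StrictAnti k) {N : ℕ}
    (hN : n + k.degree ≤ N) : (ofStrictAnti k hk).weight ≤ N * N := by
  refine (listWt_le _ _).trans ?_
  have : (ofStrictAnti k hk).parts.sum = n + k.degree := by
    simp [ofStrictAnti, List.sum_ofFn, Finset.sum_add_distrib, Finsupp.degree_eq_sum, add_comm]
  rw [this]
  refine Nat.mul_le_mul ?_ hN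
  simp only [ofStrictAnti, List.length_ofFn]
  omega

theorem listExp_injective {l m : StrictPartition} (hml : m.length ≤ l.length)
    (h : listExp l.length 0 l.parts = listExp l.length 0 m.parts) : l = m := by
  have hget : ∀ i, i < l.length → l.parts.getD i 0 = m.parts.getD i 0 := by
    intro i hi
    have := DFunLike.congr_fun h ⟨i, hi⟩
    simpa [listExp_apply] using this
  have hlen : l.length = m.length := by
    by_contra hne
    have hlt : m.length < l.length := lt_of_le_of_ne hml (Ne.symm hne)
    have h1 := hget m.length hlt
    have h2 : m.parts.getD m.length 0 = 0 := by simp [length]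
    have h3 : m.length < l.parts.length := hlt
    have h4 := l.pos _ (List.getElem_mem h3)
    have h5 : l.parts.getD m.length 0 = l.parts[m.length] := by simp [h3]
    omega
  refine ext_parts (List.ext_getElem hlen fun i h1 h2 => ?_)
  have := hget i h1
  simpa [h1, h2] using this

end StrictPartition

/-- The strict coefficient of a family indexed by `m`. -/
noncomputable def strictCoeff (g : PowerSeries Lazard) (m : StrictPartition)
    (f : ∀ n, MvPowerSeries (Fin n) Lazard) : Lazard :=
  coeff m.expo (quotG g (f m.length))

section Matrix

variable {g v : PowerSeries Lazard}

theorem IsRow.coeff_schurFn_listExp (hg : IsRow g v) {l m : StrictPartition}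
    (h : m.weight ≤ l.weight) :
    open Classical in coeff (listExp m.length 0 m.parts) (schurFn g l.parts m.length) =
      if m = l then PowerSeries.coeff 1 g ^ m.length else 0 := by
  have hm : wt (listExp m.length 0 m.parts) = m.weight := wt_listExp (Nat.zero_add _).le
  by_cases hlen : l.length ≤ m.length
  · have h1 := isLead_schurFn hg.constantCoeff_eq_zero l.strict l.pos hlen
    have h2 := h1 (listExp m.length 0 m.parts) (by
      rw [hm, wt_listExp (by rw [Nat.zero_add]; exact hlen)]; exact h)
    rw [h2]
    by_cases hml : m = l
    · subst hml
      rw [if_pos rfl, if_pos rfl, StrictPartition.length]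
    · rw [if_neg hml, if_neg]
      exact fun h => hml (StrictPartition.listExp_injective hlen h)
  · rw [schurFn_eq_zero_of_lt g (not_le.1 hlen), map_zero, if_neg]
    rintro rfl
    exact hlen le_rfl

/-- The leading coefficient `g_1 ^ ℓ` of the Schur function is the one of `g(x_1) ⋯ g(x_ℓ)`, so the
quotient has diagonal entry exactly `1`. The matrix is thus unitriangular over `𝕃` even for `t +_F
t`, where `g_1 = 2` is not invertible. -/
theorem IsRow.strictCoeff_schurFn (hg : IsRow g v) {l m : StrictPartition}
    (h : m.weight ≤ l.weight) :
    open Classical in strictCoeff g m (schurFn g l.parts) = if m = l then 1 else 0 := by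
  obtain ⟨P, hP, hP0, hc⟩ := hg.exists_coeff_add_ones m.length
  have hdvd := (hg.isGammaFamily_schurFn l.parts).dvd m.length
  have hc' := hc _ hdvd
  have hlead := isLead_of_constantCoeff P
  have hwt : wt (ones m.length) + wt m.expo = m.weight := by
    rw [← wt_add, m.ones_add_expo]
    exact wt_listExp (Nat.zero_add _).le
  have hge : WtGE (quotG g (schurFn g l.parts m.length)) (wt m.expo) := by
    refine WtGE.of_mul hP0 hlead fun e he => ?_
    rw [← hc']
    refine wtGE_schurFn hg.constantCoeff_eq_zero l.strict l.pos _ _ ?_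
    rw [wt_add]
    rw [wt_zero, zero_add] at he
    have : m.weight ≤ listWt 0 l.parts := h
    omega
  have h1 := hlead.coeff_add_mul hge (e := m.expo) le_rfl
  rw [zero_add, ← hc', m.ones_add_expo, hg.coeff_schurFn_listExp h, hP] at h1
  refine mul_left_cancel₀ (pow_ne_zero m.length hg.coeff_one_ne_zero) (h1.symm.trans ?_)
  split_ifs <;> simp

theorem IsGammaFamily.coeff_eq_zero_of_strictCoeff (hg : IsRow g v)
    {f : ∀ n, MvPowerSeries (Fin n) Lazard} (hf : IsGammaFamily g f) {N : ℕ}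
    (hc : ∀ m : StrictPartition, m.weight ≤ N * N → strictCoeff g m f = 0)
    (n : ℕ) (d : Fin n →₀ ℕ) (hd : d.degree ≤ N) : coeff d (f n) = 0 := by
  refine hf.coeff_eq_zero hg (fun n k hk hN => ?_) n d hd
  have h := hc (StrictPartition.ofStrictAnti k hk)
    (StrictPartition.weight_ofStrictAnti_le k hk hN)
  have hlen : (StrictPartition.ofStrictAnti k hk).length = n := by
    simp [StrictPartition.length, StrictPartition.ofStrictAnti]
  have key : ∀ (m : StrictPartition) (hm : m.length = n),
      (∀ i : Fin m.length, m.parts.getD i 0 = k (Fin.cast hm i) + 1) →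
      strictCoeff g m f = coeff k (quotG g (f n)) := by
    intro m hm hk
    subst hm
    rw [strictCoeff]
    congr 1
    have : m.expo = k := by
      ext i
      have := hk i
      simp only [StrictPartition.expo, Finsupp.tsub_apply, listExp_apply, Nat.zero_le, if_true,
        Nat.sub_zero, ones_apply, this, Nat.add_sub_cancel]
      rfl
    rw [this]
  rwa [key _ hlen fun i => ?_] at h
  have hi : (i : ℕ) < (List.ofFn fun i => k i + 1).length := i.2
  simp only [StrictPartition.ofStrictAnti, List.getD_eq_getElem _ _ hi, List.getElem_ofFn]
  rfl

end Matrix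

/-! ### Linear combinations of families -/

section Linear

variable {g v : PowerSeries Lazard} {f f' : ∀ n, MvPowerSeries (Fin n) Lazard}

theorem partOn_sub {n : ℕ} (T : Finset (Fin n)) (f f' : MvPowerSeries (Fin n) Lazard) :
    partOn T (f - f') = partOn T f - partOn T f' := by
  ext d
  simp only [map_sub, coeff_partOn]
  split_ifs <;> simp

theorem partOn_sum_smul {n : ℕ} (T : Finset (Fin n)) {ι : Type*} (s : Finset ι) (a : ι → Lazard)
    (f : ι → MvPowerSeries (Fin n) Lazard) :
    partOn T (∑ i ∈ s, a i • f i) = ∑ i ∈ s, a i • partOn T (f i) := by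
  ext d
  simp only [map_sum, coeff_smul, coeff_partOn]
  split_ifs <;> simp

theorem partOn_sub_sum_smul (hf : IsGammaFamily g f) {ι : Type*}
    (s : Finset ι) (a : ι → Lazard) {F : ι → ∀ n, MvPowerSeries (Fin n) Lazard}
    (hF : ∀ i ∈ s, IsGammaFamily g (F i)) (n : ℕ) :
    partOn Finset.univ (f n - ∑ i ∈ s, a i • F i n) =
      gProd g n * (quotG g (f n) - ∑ i ∈ s, a i • quotG g (F i n)) := by
  rw [partOn_sub, partOn_sum_smul, partOn_eq_gProd_mul_quotG (hf.dvd n), mul_sub, Finset.mul_sum]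
  congr 1
  refine Finset.sum_congr rfl fun i hi => ?_
  rw [partOn_eq_gProd_mul_quotG ((hF i hi).dvd n), mul_smul_comm]

theorem IsGammaFamily.sub_sum_smul (hf : IsGammaFamily g f) {ι : Type*} (s : Finset ι)
    (a : ι → Lazard) {F : ι → ∀ n, MvPowerSeries (Fin n) Lazard}
    (hF : ∀ i ∈ s, IsGammaFamily g (F i)) :
    IsGammaFamily g fun n => f n - ∑ i ∈ s, a i • F i n where
  symm n π := by
    rw [map_sub, hf.symm, map_sum]
    congr 1
    exact Finset.sum_congr rfl fun i hi => by rw [map_smul, (hF i hi).symm]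
  stable n := by
    rw [map_sub, hf.stable, map_sum]
    congr 1
    exact Finset.sum_congr rfl fun i hi => by rw [map_smul, (hF i hi).stable]
  cancel n i j hij := by
    rw [map_sub, map_sub, hf.cancel n i j hij, map_sum, map_sum]
    refine congrArg _ (Finset.sum_congr rfl fun k hk => ?_)
    rw [map_smul, map_smul, (hF k hk).cancel n i j hij]
  dvd n := Dvd.intro _ (partOn_sub_sum_smul hf s a hF n).symm

theorem quotG_sub_sum_smul (hg : PowerSeries.coeff 1 g ≠ 0) (hf : IsGammaFamily g f) {ι : Type*}
    (s : Finset ι) (a : ι → Lazard) {F : ι → ∀ n, MvPowerSeries (Fin n) Lazard}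
    (hF : ∀ i ∈ s, IsGammaFamily g (F i)) (n : ℕ) :
    quotG g (f n - ∑ i ∈ s, a i • F i n) = quotG g (f n) - ∑ i ∈ s, a i • quotG g (F i n) :=
  quotG_eq hg (partOn_sub_sum_smul hf s a hF n)

end Linear

/-! ### The Cauchy kernel as a power series in `y` -/

section Swap

variable {σ τ R : Type*} [CommRing R]

/-- Interchanging two sets of variables, as a function. -/
noncomputable def swapVars (f : MvPowerSeries σ (MvPowerSeries τ R)) :
    MvPowerSeries τ (MvPowerSeries σ R) :=
  fun e => (fun d => coeff e (coeff d f) : MvPowerSeries σ R)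

theorem coeff_coeff_swapVars (f : MvPowerSeries σ (MvPowerSeries τ R)) (e : τ →₀ ℕ)
    (d : σ →₀ ℕ) : coeff d (coeff e (swapVars f)) = coeff e (coeff d f) := rfl

/-- Interchanging two sets of variables. -/
noncomputable def swapHom :
    MvPowerSeries σ (MvPowerSeries τ R) →+* MvPowerSeries τ (MvPowerSeries σ R) where
  toFun := swapVars
  map_zero' := by
    refine MvPowerSeries.ext fun e => MvPowerSeries.ext fun d => ?_
    simp [coeff_coeff_swapVars]
  map_add' f g := by
    refine MvPowerSeries.ext fun e => MvPowerSeries.ext fun d => ?_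
    simp [coeff_coeff_swapVars]
  map_one' := by
    classical
    refine MvPowerSeries.ext fun e => MvPowerSeries.ext fun d => ?_
    rw [coeff_coeff_swapVars, coeff_one, coeff_one, apply_ite (coeff e), apply_ite (coeff d),
      coeff_one, coeff_one]
    by_cases h1 : d = 0 <;> by_cases h2 : e = 0 <;> simp [h1, h2]
  map_mul' f g := by
    classical
    refine MvPowerSeries.ext fun e => MvPowerSeries.ext fun d => ?_
    rw [coeff_coeff_swapVars, coeff_mul, coeff_mul, map_sum, map_sum]
    simp_rw [coeff_mul, coeff_coeff_swapVars]
    rw [Finset.sum_comm]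

theorem coeff_coeff_swapHom (f : MvPowerSeries σ (MvPowerSeries τ R)) (e : τ →₀ ℕ) (d : σ →₀ ℕ) :
    coeff d (coeff e (swapHom f)) = coeff e (coeff d f) := rfl

theorem swapHom_injective :
    Function.Injective (swapHom : MvPowerSeries σ (MvPowerSeries τ R) →+* _) := by
  intro f g h
  ext d e
  rw [← coeff_coeff_swapHom, h, coeff_coeff_swapHom]

theorem swapHom_map_C (f : MvPowerSeries σ R) :
    swapHom (f.map (C : R →+* MvPowerSeries τ R)) = C f := by
  classical
  ext e d
  rw [coeff_coeff_swapHom, coeff_map, coeff_C, coeff_C, apply_ite (coeff d), map_zero]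

theorem swapHom_C (f : MvPowerSeries τ R) :
    swapHom (C f : MvPowerSeries σ (MvPowerSeries τ R)) = f.map C := by
  classical
  ext e d
  rw [coeff_coeff_swapHom, coeff_map, coeff_C, coeff_C, apply_ite (coeff e), map_zero]

/-- The coefficients of a product of one-variable series in different variables. -/
theorem coeff_prod_psubst_X [DecidableEq σ] (s : Finset σ) (p : σ → PowerSeries R) (e : σ →₀ ℕ) :
    coeff e (∏ j ∈ s, PowerSeries.subst (X j : MvPowerSeries σ R) (p j)) =
      if e.support ⊆ s then ∏ j ∈ s, PowerSeries.coeff (e j) (p j) else 0 := by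
  induction s using Finset.induction_on generalizing e with
  | empty =>
    rw [Finset.prod_empty, Finset.prod_empty, coeff_one]
    simp [Finset.subset_empty]
  | insert a s ha ih =>
    rw [Finset.prod_insert ha, Finset.prod_insert ha, coeff_mul,
      Finset.sum_eq_single (Finsupp.single a (e a), e.erase a)]
    · rw [coeff_psubst_X, if_pos (by simp), ih, Finsupp.single_eq_same, Finsupp.support_erase,
        mul_ite, mul_zero]
      refine if_congr Finset.subset_insert_iff.symm (congrArg _ (Finset.prod_congr rfl fun j hj => ?_)) rfl
      rw [Finsupp.erase_ne]
      rintro rfl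
      exact ha hj
    · rintro ⟨x, y⟩ hxy hne
      have hxy' : x + y = e := Finset.HasAntidiagonal.mem_antidiagonal.1 hxy
      rw [coeff_psubst_X, ih]
      by_cases hx : x = Finsupp.single a (x a)
      · rw [if_neg (c := y.support ⊆ s), mul_zero]
        intro hy
        have hya : y a = 0 := by
          by_contra h
          exact ha (hy (Finsupp.mem_support_iff.2 h))
        apply hne
        have hea : e a = x a := by rw [← hxy', Finsupp.add_apply, hya, add_zero]
        refine Prod.ext ?_ ?_
        · rw [hea]
          exact hx
        · ext j
          by_cases hj : j = a
          · subst hj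
            simp [hya]
          · dsimp only
            rw [Finsupp.erase_ne hj, ← hxy', hx]
            simp [Ne.symm hj]
      · rw [if_neg hx, zero_mul]
    · intro h
      refine absurd (Finset.HasAntidiagonal.mem_antidiagonal.2 ?_) h
      exact Finsupp.single_add_erase a e

end Swap

section Kernel

variable {σ τ : Type} {t : MvPowerSeries σ Lazard}

/-- The series in `t` which is the coefficient of `y ^ e` in the kernel. -/
noncomputable def kerCoeff (e : ℕ →₀ ℕ) : PowerSeries Lazard :=
  ∏ j ∈ e.support, ((PowerSeries.X - finvSeries) * PowerSeries.X ^ (e j - 1))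

/-- The kernel as a power series in `y`. -/
noncomputable def kerSeries (t : MvPowerSeries σ Lazard) :
    MvPowerSeries ℕ (MvPowerSeries σ Lazard) := fun e => PowerSeries.subst t (kerCoeff e)

theorem coeff_kerSeries (t : MvPowerSeries σ Lazard) (e : ℕ →₀ ℕ) :
    coeff e (kerSeries t) = PowerSeries.subst t (kerCoeff e) := rfl

theorem psubst_kerCoeff (ht : constantCoeff t = 0) (e : ℕ →₀ ℕ) :
    PowerSeries.subst t (kerCoeff e) =
      ∏ j ∈ e.support, ((t - finv t) * t ^ (e j - 1)) := by
  have hs := pHasSubst ht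
  rw [← PowerSeries.coe_substAlgHom hs, kerCoeff, map_prod]
  refine Finset.prod_congr rfl fun j _ => ?_
  rw [map_mul, map_sub, map_pow, PowerSeries.coe_substAlgHom, PowerSeries.subst_X hs]
  rfl

/-- The coefficients of one factor of the kernel. -/
noncomputable def factorSeries (t : MvPowerSeries σ Lazard) : PowerSeries (MvPowerSeries σ Lazard) :=
  PowerSeries.mk fun k => if k = 0 then 1 else (t - finv t) * t ^ (k - 1)

/-- This is the expansion `(1 - t̄ y) / (1 - t y) = 1 + ∑_{k ≥ 1} (t - t̄) t ^ (k - 1) y ^ k`. -/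
theorem mul_factorSeries (t : MvPowerSeries σ Lazard) :
    (1 - t • PowerSeries.X) * factorSeries t = 1 - finv t • PowerSeries.X := by
  ext1 k
  rw [sub_mul, one_mul, smul_mul_assoc, map_sub, map_sub, PowerSeries.coeff_smul,
    PowerSeries.coeff_smul, factorSeries]
  cases k with
  | zero => simp
  | succ k =>
    rw [PowerSeries.coeff_succ_X_mul, PowerSeries.coeff_mk, PowerSeries.coeff_mk,
      if_neg (Nat.succ_ne_zero k), PowerSeries.coeff_one, if_neg (Nat.succ_ne_zero k),
      PowerSeries.coeff_X]
    cases k with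
    | zero => simp
    | succ k => simp [pow_succ]; ring

theorem swapHom_kernelFactor (ht : constantCoeff t = 0) (j : ℕ) :
    swapHom (kernelFactor t j) =
      PowerSeries.subst (X j : MvPowerSeries ℕ (MvPowerSeries σ Lazard)) (factorSeries t) := by
  have hu : (1 - liftX t * constY (X j)) * invOfUnit (1 - liftX t * constY (X j)) 1 = 1 := by
    apply mul_invOfUnit
    simp [liftX, constantCoeff_map, ht]
  have hs : PowerSeries.HasSubst (X j : MvPowerSeries ℕ (MvPowerSeries σ Lazard)) :=
    PowerSeries.HasSubst.X j
  have h1 := congrArg (PowerSeries.substAlgHom hs) (mul_factorSeries t)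
  simp only [map_mul, map_sub, map_one, map_smul, PowerSeries.coe_substAlgHom,
    PowerSeries.subst_X hs] at h1
  have hl : ∀ f : MvPowerSeries σ Lazard, swapHom (liftX f * constY (X j)) =
      f • (X j : MvPowerSeries ℕ (MvPowerSeries σ Lazard)) := by
    intro f
    rw [map_mul, liftX, swapHom_map_C, constY, swapHom_C, map_X, smul_eq_C_mul]
  have hu' := congrArg swapHom hu
  rw [map_mul, map_sub, map_one, hl] at hu'
  rw [kernelFactor, map_mul, map_sub, map_one, hl, ← h1, mul_right_comm, hu', one_mul]

/-- The coefficient of `y ^ e` only sees the factors with `j ∈ e.support`; it is constant along all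
partial products containing them, and limits are unique. -/
theorem coeff_coeff_kernel (ht : constantCoeff t = 0) (d : σ →₀ ℕ) (e : ℕ →₀ ℕ) :
    coeff e (coeff d (kernel t)) = coeff d (PowerSeries.subst t (kerCoeff e)) := by
  have hp := (multipliable_kernelFactor t ht).hasProd
  unfold HasProd at hp
  rw [SummationFilter.unconditional_filter] at hp
  rw [MvPowerSeries.WithPiTopology.tendsto_iff_coeff_tendsto] at hp
  have hp' := (MvPowerSeries.WithPiTopology.tendsto_iff_coeff_tendsto _ _ _).1 (hp d) e
  refine tendsto_nhds_unique hp' (tendsto_const_nhds.congr' ?_)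
  filter_upwards [Filter.eventually_ge_atTop e.support] with s hs
  have h1 : coeff e (coeff d (∏ j ∈ s, kernelFactor t j)) =
      coeff d (coeff e (swapHom (∏ j ∈ s, kernelFactor t j))) := rfl
  rw [h1, map_prod, Finset.prod_congr rfl fun j _ => swapHom_kernelFactor ht j,
    coeff_prod_psubst_X, if_pos hs, psubst_kerCoeff ht]
  congr 1
  rw [← Finset.prod_subset hs]
  · refine Finset.prod_congr rfl fun j hj => ?_
    rw [factorSeries, PowerSeries.coeff_mk, if_neg (Finsupp.mem_support_iff.1 hj)]
  · intro j _ hj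
    rw [Finsupp.notMem_support_iff.1 hj, factorSeries, PowerSeries.coeff_mk, if_pos rfl]

theorem swapHom_kernel (ht : constantCoeff t = 0) : swapHom (kernel t) = kerSeries t := by
  ext e d
  rw [coeff_coeff_swapHom, coeff_coeff_kernel ht, coeff_kerSeries]

/-- Since the formal inverse is an involution, replacing `t` by `t̄` inverts each factor. This gives
the cancellation law for the kernel. -/
theorem kernel_mul_kernel_finv (ht : constantCoeff t = 0) : kernel t * kernel (finv t) = 1 := by
  have h1 := multipliable_kernelFactor t ht
  have h2 := multipliable_kernelFactor (finv t) (constantCoeff_finv ht)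
  rw [kernel, kernel, ← h1.tprod_mul h2]
  have : ∀ j, kernelFactor t j * kernelFactor (finv t) j = 1 := by
    intro j
    have hu : ∀ s : MvPowerSeries σ Lazard, constantCoeff s = 0 →
        (1 - liftX s * constY (X j)) * invOfUnit (1 - liftX s * constY (X j)) 1 = 1 := by
      intro s hs
      apply mul_invOfUnit
      simp [liftX, constantCoeff_map, hs]
    have hu1 := hu t ht
    have hu2 := hu _ (constantCoeff_finv ht)
    rw [kernelFactor, kernelFactor, finv_finv ht]
    linear_combination hu1 * ((1 - liftX (finv t) * constY (X j)) *
      invOfUnit (1 - liftX (finv t) * constY (X j)) 1) + hu2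
  simp [this]

theorem kerSeries_mul_kerSeries_finv (ht : constantCoeff t = 0) :
    kerSeries t * kerSeries (finv t) = 1 := by
  rw [← swapHom_kernel ht, ← swapHom_kernel (constantCoeff_finv ht), ← map_mul,
    kernel_mul_kernel_finv ht, map_one]

theorem map_kerSeries [Finite σ] {z : σ → MvPowerSeries τ Lazard}
    (hz : ∀ s, constantCoeff (z s) = 0) (ht : constantCoeff t = 0) :
    MvPowerSeries.map (evalHom z hz).toRingHom (kerSeries t) = kerSeries (evalHom z hz t) := by
  ext1 e
  rw [coeff_map, coeff_kerSeries, coeff_kerSeries]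
  exact evalHom_psubst hz ht _

theorem kerSeries_zero : kerSeries (0 : MvPowerSeries σ Lazard) = 1 := by
  classical
  ext1 e
  rw [coeff_kerSeries, psubst_kerCoeff (map_zero _), finv_zero, sub_zero, coeff_one]
  split_ifs with h
  · simp [h]
  · obtain ⟨j, hj⟩ := Finsupp.support_nonempty_iff.2 h
    exact Finset.prod_eq_zero hj (zero_mul _)

end Kernel

/-! ### One-row functions -/

section OneRow

variable {g v : PowerSeries Lazard}

/-- The coefficient of `y ^ e` in the kernel without constant term, divided by `g`. -/
noncomputable def rowCoeff (v : PowerSeries Lazard) (e : ℕ →₀ ℕ) : PowerSeries Lazard :=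
  if e = 0 then 0 else
    v * (PowerSeries.X - finvSeries) ^ (e.support.card - 1) *
      PowerSeries.X ^ ∑ j ∈ e.support, (e j - 1)

theorem IsRow.kerCoeff_eq (hg : IsRow g v) (e : ℕ →₀ ℕ) :
    kerCoeff e = (if e = 0 then 1 else 0) + g * rowCoeff v e := by
  by_cases h : e = 0
  · simp [h, kerCoeff, rowCoeff]
  · rw [if_neg h, rowCoeff, if_neg h, zero_add, kerCoeff, Finset.prod_mul_distrib,
      Finset.prod_const, Finset.prod_pow_eq_pow_sum, ← mul_assoc, ← mul_assoc, ← hg.sub_finv_eq,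
      ← pow_succ', Nat.sub_add_cancel]
    exact Finset.card_pos.2 (Finsupp.support_nonempty_iff.2 h)

theorem exists_sub_finvSeries_eq : ∃ w : PowerSeries Lazard, PowerSeries.constantCoeff w = 2 ∧
    PowerSeries.X - finvSeries = PowerSeries.X * w := by
  obtain ⟨ω, hω, h⟩ := exists_finv_eq
    (PowerSeries.constantCoeff_X : constantCoeff (PowerSeries.X : PowerSeries Lazard) = 0)
  have h' : finv (PowerSeries.X : PowerSeries Lazard) = finvSeries :=
    congrFun (subst_self (σ := Unit) (R := Lazard)) finvSeries
  refine ⟨1 - ω, ?_, ?_⟩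
  · rw [map_sub, map_one]
    have : PowerSeries.constantCoeff ω = -1 := hω
    rw [this]
    norm_num
  · rw [← h', h]
    ring

theorem sum_sub_one_add_card (e : ℕ →₀ ℕ) :
    ∑ j ∈ e.support, (e j - 1) + e.support.card = e.degree := by
  rw [Finset.card_eq_sum_ones, ← Finset.sum_add_distrib, Finsupp.degree]
  refine Finset.sum_congr rfl fun j hj => ?_
  have := Finsupp.mem_support_iff.1 hj
  omega

/-- As `t - t̄ = t w` with `w(0) = 2`, the series starts in degree `e.degree - 1`. Hence the one-row
functions have bounded degree, and their top coefficients are `v(0)` times a power of `2`. -/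
theorem exists_rowCoeff_eq (v : PowerSeries Lazard) {e : ℕ →₀ ℕ} (he : e ≠ 0) :
    ∃ w : PowerSeries Lazard,
      PowerSeries.constantCoeff w = PowerSeries.constantCoeff v * 2 ^ (e.support.card - 1) ∧
      rowCoeff v e = PowerSeries.X ^ (e.degree - 1) * w := by
  obtain ⟨w, hw, h⟩ := exists_sub_finvSeries_eq
  refine ⟨v * w ^ (e.support.card - 1), by rw [map_mul, map_pow, hw], ?_⟩
  have h1 := sum_sub_one_add_card e
  have h2 := Finset.card_pos.2 (Finsupp.support_nonempty_iff.2 he)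
  rw [rowCoeff, if_neg he, h, mul_pow, show e.degree - 1 =
    (e.support.card - 1) + ∑ j ∈ e.support, (e j - 1) by omega, pow_add]
  ring

theorem rowCoeff_embDomain (v : PowerSeries Lazard) (s : ℕ ↪ ℕ) (e : ℕ →₀ ℕ) :
    rowCoeff v (e.embDomain s) = rowCoeff v e := by
  have h : e.embDomain s = 0 ↔ e = 0 := Finsupp.embDomain_eq_zero
  simp only [rowCoeff, h, Finsupp.support_embDomain, Finset.card_map, Finset.sum_map,
    Finsupp.embDomain_apply_self]

/-- The one-row function with index `k + 1`. -/
noncomputable def rowFn (v : PowerSeries Lazard) (k : ℕ) : SymY :=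
  ⟨fun e => PowerSeries.coeff k (rowCoeff v e), fun s => by
    ext e
    obtain ⟨e, rfl⟩ : ∃ e', e = Finsupp.embDomain s.toEmbedding e' :=
      ⟨e.equivMapDomain s.symm, by
        ext i; simp [Finsupp.embDomain_eq_mapDomain, Finsupp.mapDomain_equiv_apply]⟩
    refine (coeff_embDomain_rename s.toEmbedding _ e).trans ?_
    change PowerSeries.coeff k (rowCoeff v e) =
      PowerSeries.coeff k (rowCoeff v (e.embDomain s.toEmbedding))
    rw [rowCoeff_embDomain], k + 1, fun e he => by
    change PowerSeries.coeff k (rowCoeff v e) = 0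
    have h0 : e ≠ 0 := by rintro rfl; simp at he
    obtain ⟨w, -, hw⟩ := exists_rowCoeff_eq v h0
    exact PowerSeries.X_pow_dvd_iff.1 ⟨w, hw⟩ k (by omega)⟩

theorem coeff_rowFn (v : PowerSeries Lazard) (k : ℕ) (e : ℕ →₀ ℕ) :
    coeff e (rowFn v k : MvPowerSeries ℕ Lazard) = PowerSeries.coeff k (rowCoeff v e) := rfl

theorem coeff_rowFn_of_degree_eq {k : ℕ} {e : ℕ →₀ ℕ} (he : e.degree = k + 1) :
    coeff e (rowFn v k : MvPowerSeries ℕ Lazard) =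
      PowerSeries.constantCoeff v * 2 ^ (e.support.card - 1) := by
  have h0 : e ≠ 0 := by rintro rfl; simp at he
  obtain ⟨w, hw', hw⟩ := exists_rowCoeff_eq v h0
  rw [coeff_rowFn, hw, he, Nat.add_sub_cancel, ← hw', ← PowerSeries.coeff_zero_eq_constantCoeff_apply]
  simpa using PowerSeries.coeff_X_pow_mul w k 0

theorem coeff_rowFn_of_lt {k : ℕ} {e : ℕ →₀ ℕ} (he : k + 1 < e.degree) :
    coeff e (rowFn v k : MvPowerSeries ℕ Lazard) = 0 := by
  have h0 : e ≠ 0 := by rintro rfl; simp at he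
  obtain ⟨w, -, hw⟩ := exists_rowCoeff_eq v h0
  exact PowerSeries.X_pow_dvd_iff.1 ⟨w, hw⟩ k (by omega)

theorem IsRow.kernelOne_eq (hg : IsRow g v) :
    kernelOne = 1 + liftX g * PowerSeries.mk fun k => (rowFn v k : MvPowerSeries ℕ Lazard) := by
  classical
  apply swapHom_injective
  have h1 : swapHom kernelOne = kerSeries (PowerSeries.X : PowerSeries Lazard) :=
    swapHom_kernel PowerSeries.constantCoeff_X
  rw [h1, map_add, map_one, map_mul, liftX, swapHom_map_C]
  ext1 e
  have h2 : coeff e (swapHom (PowerSeries.mk fun k => (rowFn v k : MvPowerSeries ℕ Lazard))) =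
      rowCoeff v e := by
    ext k
    change coeff e (PowerSeries.coeff k (PowerSeries.mk fun k => (rowFn v k :
      MvPowerSeries ℕ Lazard))) = _
    rw [PowerSeries.coeff_mk]
    rfl
  have h3 : PowerSeries.subst (PowerSeries.X : PowerSeries Lazard) (kerCoeff e) = kerCoeff e :=
    congrFun (subst_self (σ := Unit) (R := Lazard)) (kerCoeff e)
  rw [coeff_kerSeries, map_add, coeff_C_mul, h2, coeff_one]
  exact h3.trans (hg.kerCoeff_eq e)

end OneRow

/-! ### The coefficients of the kernel form a family -/

section DeltaFam

variable {g v : PowerSeries Lazard}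

/-- The coefficient of `y ^ e` in the kernel. -/
noncomputable def deltaFam (e : ℕ →₀ ℕ) (n : ℕ) : MvPowerSeries (Fin n) Lazard :=
  coeff e (∏ i : Fin n, kerSeries (X i))

theorem coeff_deltaFam (e : ℕ →₀ ℕ) (n : ℕ) (d : Fin n →₀ ℕ) :
    coeff d (deltaFam e n) = coeff e (coeff d (kernelX n)) := by
  rw [← coeff_coeff_swapHom, kernelX, map_prod, deltaFam]
  simp only [swapHom_kernel (constantCoeff_X_lazard _)]

theorem evalHom_deltaFam {n : ℕ} {τ : Type} {z : Fin n → MvPowerSeries τ Lazard}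
    (hz : ∀ s, constantCoeff (z s) = 0) (e : ℕ →₀ ℕ) :
    evalHom z hz (deltaFam e n) = coeff e (∏ i, kerSeries (z i)) := by
  have h : evalHom z hz (deltaFam e n) = coeff e (MvPowerSeries.map (evalHom z hz).toRingHom
      (∏ i : Fin n, kerSeries (X i))) := by
    rw [coeff_map]
    rfl
  rw [h, map_prod]
  simp only [map_kerSeries hz (constantCoeff_X_lazard _), evalHom_X]

/-- The kernel in one variable, without constant term and divided by `g`. -/
noncomputable def rowSeries (v : PowerSeries Lazard) {n : ℕ} (i : Fin n) :
    MvPowerSeries ℕ (MvPowerSeries (Fin n) Lazard) :=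
  fun e => PowerSeries.subst (X i) (rowCoeff v e)

theorem coeff_rowSeries {n : ℕ} (i : Fin n) (e : ℕ →₀ ℕ) :
    coeff e (rowSeries v i) = PowerSeries.subst (X i) (rowCoeff v e) := rfl

theorem IsRow.kerSeries_X (hg : IsRow g v) {n : ℕ} (i : Fin n) :
    kerSeries (X i) = 1 + C (gX g i) * rowSeries v i := by
  classical
  ext1 e
  have hs := pHasSubst (constantCoeff_X_lazard i)
  rw [coeff_kerSeries, hg.kerCoeff_eq, PowerSeries.subst_add hs, PowerSeries.subst_mul hs, map_add,
    coeff_C_mul, coeff_one, coeff_rowSeries, gX]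
  congr 1
  rw [← PowerSeries.coe_substAlgHom hs, apply_ite (PowerSeries.substAlgHom hs), map_one, map_zero]

theorem map_setZero_rowSeries {n : ℕ} {i j : Fin n} (hij : i ≠ j) :
    MvPowerSeries.map (setZero j).toRingHom (rowSeries v i) = rowSeries v i := by
  ext1 e
  rw [coeff_map, coeff_rowSeries]
  refine (evalHom_psubst _ (constantCoeff_X_lazard i) _).trans ?_
  rw [evalHom_X, if_neg hij]

/-- Each factor is `1 + g(x_i) r_i`. After expanding over subsets `T`, the term of `T` is free of
the variables outside `T`, so only the full subset meets monomials in all variables, and its term is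
divisible by every `g(x_i)`. -/
theorem IsRow.partOn_deltaFam (hg : IsRow g v) (e : ℕ →₀ ℕ) (n : ℕ) :
    partOn Finset.univ (deltaFam e n) = gProd g n * coeff e (∏ i, rowSeries v i) := by
  have hexp : deltaFam e n = ∑ T ∈ (Finset.univ : Finset (Fin n)).powerset,
      coeff e (∏ i ∈ T, C (gX g i) * rowSeries v i) := by
    rw [deltaFam]
    simp only [hg.kerSeries_X]
    rw [Finset.prod_one_add, map_sum]
  have hfull : coeff e (∏ i : Fin n, C (gX g i) * rowSeries v i) =
      gProd g n * coeff e (∏ i, rowSeries v i) := by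
    rw [Finset.prod_mul_distrib, ← map_prod, coeff_C_mul, gProd]
  ext d
  rw [coeff_partOn]
  split_ifs with h
  · rw [hexp, map_sum, Finset.sum_eq_single Finset.univ, hfull]
    · intro T _ hT
      obtain ⟨j, hj⟩ : ∃ j, j ∉ T := by
        by_contra! h
        exact hT (Finset.eq_univ_iff_forall.2 h)
      have hfix : setZero j (coeff e (∏ i ∈ T, C (gX g i) * rowSeries v i)) =
          coeff e (∏ i ∈ T, C (gX g i) * rowSeries v i) := by
        have h1 : setZero j (coeff e (∏ i ∈ T, C (gX g i) * rowSeries v i)) =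
            coeff e (MvPowerSeries.map (setZero j).toRingHom
              (∏ i ∈ T, C (gX g i) * rowSeries v i)) := by
          rw [coeff_map]
          rfl
        rw [h1, map_prod]
        congr 1
        refine Finset.prod_congr rfl fun i hi => ?_
        have hij : i ≠ j := fun h => hj (h ▸ hi)
        rw [map_mul, map_setZero_rowSeries hij, map_C]
        exact congrArg (fun f => C f * rowSeries v i) (setZero_gX hij)
      rw [← hfix, coeff_setZero, if_neg (h j (Finset.mem_univ _))]
    · intro h
      exact absurd (Finset.mem_powerset.2 subset_rfl) h
  · push Not at h
    obtain ⟨j, -, hj⟩ := h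
    have h0 : setZero j (gProd g n * coeff e (∏ i, rowSeries v i)) = 0 := by
      have h2 : setZero j (gX g j) = 0 := by
        rw [setZero, evalHom_gX, if_pos rfl]
        have := row_zero hg.constantCoeff_eq_zero (σ := Fin n) 1
        rwa [row, Nat.sub_self, pow_zero, mul_one] at this
      rw [map_mul, gProd, map_prod, Finset.prod_eq_zero (Finset.mem_univ j) h2, zero_mul]
    have := congrArg (coeff d) h0
    rw [coeff_setZero, if_pos hj, map_zero] at this
    exact this.symm

theorem IsRow.isGammaFamily_deltaFam (hg : IsRow g v) (e : ℕ →₀ ℕ) :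
    IsGammaFamily g (deltaFam e) where
  symm n π := by
    rw [permHom, evalHom_deltaFam, deltaFam]
    exact congrArg (coeff e)
      (Equiv.prod_comp π fun i => kerSeries (X i : MvPowerSeries (Fin n) Lazard))
  stable n := by
    rw [killLast, evalHom_deltaFam, Fin.prod_univ_castSucc]
    simp only [Fin.snoc_castSucc, Fin.snoc_last, kerSeries_zero, mul_one]
    rfl
  cancel n i j hij := by
    have key : ∀ i j : Fin n, i ≠ j → pairHom i j (deltaFam e n) =
        coeff e (∏ s ∈ (Finset.univ.erase i).erase j, kerSeries (X s)) := by
      intro i j hij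
      rw [pairHom, evalHom_deltaFam]
      refine congrArg (coeff e) ?_
      have hj : j ∈ Finset.univ.erase i := Finset.mem_erase.2 ⟨hij.symm, Finset.mem_univ _⟩
      rw [← Finset.mul_prod_erase _ _ (Finset.mem_univ i), ← Finset.mul_prod_erase _ _ hj,
        if_neg hij, if_pos rfl, ← mul_assoc,
        kerSeries_mul_kerSeries_finv (constantCoeff_X_lazard i), one_mul]
      refine Finset.prod_congr rfl fun s hs => ?_
      rw [if_neg (Finset.ne_of_mem_erase hs)]
    rw [key i j hij, key j i hij.symm, Finset.erase_right_comm]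
  dvd n := Dvd.intro _ (hg.partOn_deltaFam e n).symm

/-- The quotient is a product of series in separate variables `x_i`, so its coefficients are
products of one-row functions. -/
theorem IsRow.coeff_quotG_deltaFam (hg : IsRow g v) (e : ℕ →₀ ℕ) (n : ℕ) (k : Fin n →₀ ℕ) :
    coeff k (quotG g (deltaFam e n)) =
      coeff e ((∏ i, rowFn v (k i) : SymY) : MvPowerSeries ℕ Lazard) := by
  rw [quotG_eq hg.coeff_one_ne_zero (hg.partOn_deltaFam e n)]
  have h : ∀ i : Fin n, rowSeries v i = swapHom (PowerSeries.subst
      (X i : MvPowerSeries (Fin n) (MvPowerSeries ℕ Lazard))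
      (PowerSeries.mk fun k => (rowFn v k : MvPowerSeries ℕ Lazard))) := by
    intro i
    ext e d
    rw [coeff_coeff_swapHom, coeff_psubst_X, coeff_rowSeries, coeff_psubst_X, apply_ite (coeff e),
      map_zero, PowerSeries.coeff_mk, coeff_rowFn]
  simp only [h]
  rw [← map_prod, coeff_coeff_swapHom, coeff_prod_psubst_X, if_pos (Finset.subset_univ _)]
  simp only [PowerSeries.coeff_mk]
  have hprod := map_prod SymY.val (fun i => rowFn v (k i)) Finset.univ
  simp only [Subalgebra.coe_val] at hprod
  rw [hprod]

end DeltaFam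

/-! ### The dual family of a row -/

section Dual

open StrictPartition

variable {g v : PowerSeries Lazard}

/-- The product of the one-row functions of the parts. -/
noncomputable def rowProd (v : PowerSeries Lazard) (m : StrictPartition) : SymY :=
  ∏ i : Fin m.length, rowFn v (m.expo i)

/-- The strict partitions of weight less than `N`. -/
noncomputable def StrictPartition.weightLT (N : ℕ) : Finset StrictPartition :=
  (weightLE N).filter fun l => l.weight < N

@[simp] theorem StrictPartition.mem_weightLT {N : ℕ} {l : StrictPartition} :
    l ∈ weightLT N ↔ l.weight < N := by
  simp only [weightLT, Finset.mem_filter, mem_weightLE]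
  exact ⟨fun h => h.2, fun h => ⟨h.le, h⟩⟩

/-- The family dual to the functions `schurFn g`, by recursion on the weight. -/
noncomputable def dualFam (g v : PowerSeries Lazard) (m : StrictPartition) : SymY :=
  rowProd v m - ∑ l ∈ (weightLT m.weight).attach,
    strictCoeff g m (schurFn g l.1.parts) • dualFam g v l.1
termination_by m.weight
decreasing_by exact mem_weightLT.1 l.2

theorem dualFam_eq (m : StrictPartition) :
    dualFam g v m = rowProd v m - ∑ l ∈ weightLT m.weight,
      strictCoeff g m (schurFn g l.parts) • dualFam g v l := by
  rw [dualFam, Finset.sum_attach (weightLT m.weight)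
    fun l => strictCoeff g m (schurFn g l.parts) • dualFam g v l]

theorem IsRow.sum_strictCoeff_smul_dualFam (hg : IsRow g v) {m : StrictPartition} {N : ℕ}
    (h : m.weight ≤ N) :
    ∑ l ∈ weightLE N, strictCoeff g m (schurFn g l.parts) • dualFam g v l = rowProd v m := by
  classical
  have hm : m ∈ (weightLE N).filter (fun l => ¬ l.weight < m.weight) := by
    simp [h]
  have hlt : (weightLE N).filter (fun l => l.weight < m.weight) = weightLT m.weight := by
    ext l
    simp only [Finset.mem_filter, mem_weightLE, mem_weightLT]
    exact ⟨fun h => h.2, fun h' => ⟨h'.le.trans h, h'⟩⟩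
  rw [← Finset.sum_filter_add_sum_filter_not (weightLE N) (fun l => l.weight < m.weight), hlt,
    Finset.sum_eq_single_of_mem m hm, hg.strictCoeff_schurFn le_rfl, if_pos rfl, one_smul,
    dualFam_eq m, add_sub_cancel]
  intro l hl hlm
  rw [hg.strictCoeff_schurFn (not_lt.1 (Finset.mem_filter.1 hl).2), if_neg (Ne.symm hlm), zero_smul]

/-- The error of the partial sums of the Cauchy identity. -/
noncomputable def cauchyError (g v : PowerSeries Lazard) (e : ℕ →₀ ℕ) (N n : ℕ) :
    MvPowerSeries (Fin n) Lazard :=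
  deltaFam e n - ∑ l ∈ weightLE N,
    coeff e (dualFam g v l : MvPowerSeries ℕ Lazard) • schurFn g l.parts n

theorem coeff_sum_smul (s : Finset StrictPartition) (c : StrictPartition → Lazard)
    (p : StrictPartition → SymY) (e : ℕ →₀ ℕ) :
    coeff e ((∑ l ∈ s, c l • p l : SymY) : MvPowerSeries ℕ Lazard) =
      ∑ l ∈ s, c l * coeff e (p l : MvPowerSeries ℕ Lazard) := by
  have h := map_sum SymY.val (fun l => c l • p l) s
  simp only [Subalgebra.coe_val] at h
  rw [h, map_sum]
  rfl

theorem IsRow.isGammaFamily_cauchyError (hg : IsRow g v) (e : ℕ →₀ ℕ) (N : ℕ) :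
    IsGammaFamily g (cauchyError g v e N) :=
  (hg.isGammaFamily_deltaFam e).sub_sum_smul (weightLE N) _
    fun l _ => hg.isGammaFamily_schurFn l.parts

theorem IsRow.quotG_cauchyError (hg : IsRow g v) (e : ℕ →₀ ℕ) (N n : ℕ) :
    quotG g (cauchyError g v e N n) = quotG g (deltaFam e n) - ∑ l ∈ weightLE N,
      coeff e (dualFam g v l : MvPowerSeries ℕ Lazard) • quotG g (schurFn g l.parts n) :=
  quotG_sub_sum_smul hg.coeff_one_ne_zero (hg.isGammaFamily_deltaFam e) (weightLE N) _
    (fun l _ => hg.isGammaFamily_schurFn l.parts) n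

theorem IsRow.coeff_quotG_cauchyError (hg : IsRow g v) (e : ℕ →₀ ℕ) (N n : ℕ) (k : Fin n →₀ ℕ) :
    coeff k (quotG g (cauchyError g v e N n)) =
      coeff e ((∏ i, rowFn v (k i) : SymY) : MvPowerSeries ℕ Lazard) -
      coeff e ((∑ l ∈ weightLE N, coeff k (quotG g (schurFn g l.parts n)) • dualFam g v l : SymY) :
        MvPowerSeries ℕ Lazard) := by
  rw [hg.quotG_cauchyError, map_sub, hg.coeff_quotG_deltaFam, coeff_sum_smul, map_sum]
  refine congrArg _ (Finset.sum_congr rfl fun l _ => ?_)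
  rw [coeff_smul, mul_comm]

/-- The recursion defining `dualFam` says precisely that the strict coefficients of the error vanish
up to weight `M`, and a family with this property vanishes in low degree. -/
theorem IsRow.coeff_cauchyError (hg : IsRow g v) (e : ℕ →₀ ℕ) {M N n : ℕ} (hM : N * N ≤ M)
    {d : Fin n →₀ ℕ} (hd : d.degree ≤ N) : coeff d (cauchyError g v e M n) = 0 := by
  refine (hg.isGammaFamily_cauchyError e M).coeff_eq_zero_of_strictCoeff hg (fun m hm => ?_) n d hd
  rw [strictCoeff, hg.coeff_quotG_cauchyError, sub_eq_zero]
  exact congrArg (fun f : SymY => coeff e (f : MvPowerSeries ℕ Lazard))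
    (hg.sum_strictCoeff_smul_dualFam (hm.trans hM)).symm

/-- The Cauchy identity for the functions `schurFn g`. -/
def IsDualFam (g : PowerSeries Lazard) (p : StrictPartition → SymY) : Prop :=
  ∀ n : ℕ, HasSum (fun l => liftX (schurFn g l.parts n) * constY (p l : MvPowerSeries ℕ Lazard))
    (kernelX n)

theorem coeff_liftX_mul_constY {σ : Type} (f : MvPowerSeries σ Lazard) (p : MvPowerSeries ℕ Lazard)
    (d : σ →₀ ℕ) (e : ℕ →₀ ℕ) :
    coeff e (coeff d (liftX f * constY p)) = coeff d f * coeff e p := by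
  rw [liftX, constY, coeff_mul_C, coeff_map, coeff_C_mul]

theorem IsRow.coeff_schurFn_eq_zero (hg : IsRow g v) {n : ℕ} {d : Fin n →₀ ℕ}
    {l : StrictPartition} (h : wt d < l.weight) : coeff d (schurFn g l.parts n) = 0 :=
  wtGE_schurFn hg.constantCoeff_eq_zero l.strict l.pos n d h

/-- A Schur function has no monomial lighter than its partition, and there are finitely many
partitions of bounded weight. So each coefficient of the infinite sum is a finite sum. -/
theorem IsRow.isDualFam_iff (hg : IsRow g v) {p : StrictPartition → SymY} :
    IsDualFam g p ↔ ∀ (n : ℕ) (d : Fin n →₀ ℕ) (e : ℕ →₀ ℕ) (N : ℕ), wt d ≤ N →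
      ∑ l ∈ weightLE N, coeff d (schurFn g l.parts n) * coeff e (p l : MvPowerSeries ℕ Lazard) =
        coeff e (coeff d (kernelX n)) := by
  have key : ∀ (n : ℕ) (d : Fin n →₀ ℕ) (e : ℕ →₀ ℕ) (N : ℕ), wt d ≤ N →
      HasSum (fun l : StrictPartition =>
        coeff d (schurFn g l.parts n) * coeff e (p l : MvPowerSeries ℕ Lazard))
      (∑ l ∈ weightLE N, coeff d (schurFn g l.parts n) *
        coeff e (p l : MvPowerSeries ℕ Lazard)) := by
    intro n d e N hN
    refine hasSum_sum_of_ne_finset_zero fun l hl => ?_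
    rw [mem_weightLE, not_le] at hl
    rw [hg.coeff_schurFn_eq_zero (hN.trans_lt hl), zero_mul]
  have h1 : IsDualFam g p ↔ ∀ (n : ℕ) (d : Fin n →₀ ℕ) (e : ℕ →₀ ℕ),
      HasSum (fun l : StrictPartition =>
        coeff d (schurFn g l.parts n) * coeff e (p l : MvPowerSeries ℕ Lazard))
        (coeff e (coeff d (kernelX n))) := by
    refine forall_congr' fun n => ?_
    rw [MvPowerSeries.WithPiTopology.hasSum_iff_hasSum_coeff]
    refine forall_congr' fun d => ?_
    rw [MvPowerSeries.WithPiTopology.hasSum_iff_hasSum_coeff]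
    simp only [coeff_liftX_mul_constY]
  rw [h1]
  refine forall_congr' fun n => forall_congr' fun d => forall_congr' fun e =>
    ⟨fun h N hN => (key n d e N hN).unique h, fun h => ?_⟩
  rw [← h _ le_rfl]
  exact key n d e _ le_rfl

theorem IsRow.isDualFam_dualFam (hg : IsRow g v) : IsDualFam g (dualFam g v) := by
  rw [hg.isDualFam_iff]
  intro n d e N hN
  have key : ∀ M, N ≤ M → ∑ l ∈ weightLE M, coeff d (schurFn g l.parts n) *
      coeff e (dualFam g v l : MvPowerSeries ℕ Lazard) =
      ∑ l ∈ weightLE N, coeff d (schurFn g l.parts n) *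
      coeff e (dualFam g v l : MvPowerSeries ℕ Lazard) := by
    intro M hM
    refine (Finset.sum_subset ?_ ?_).symm
    · intro l hl
      rw [mem_weightLE] at hl ⊢
      exact hl.trans hM
    · intro l _ hl
      rw [mem_weightLE, not_le] at hl
      rw [hg.coeff_schurFn_eq_zero (hN.trans_lt hl), zero_mul]
  set K := max N d.degree with hK
  have h0 := hg.coeff_cauchyError e (n := n) (d := d) le_rfl (le_max_right N d.degree)
  rw [cauchyError, map_sub, map_sum, sub_eq_zero, coeff_deltaFam] at h0
  rw [h0, ← key (K * K) ((le_max_left _ _).trans (Nat.le_mul_self _))]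
  refine Finset.sum_congr rfl fun l _ => ?_
  rw [coeff_smul, mul_comm]

/-- Induction on the weight of `m`: comparing the coefficients of the leading monomial of `m` in
`ℓ(m)` variables leaves `g_1 ^ ℓ(m) (p m - p' m) = 0`, and `𝕃` is a domain. -/
theorem IsRow.eq_of_isDualFam (hg : IsRow g v) {p p' : StrictPartition → SymY}
    (hp : IsDualFam g p) (hp' : IsDualFam g p') : p = p' := by
  classical
  rw [hg.isDualFam_iff] at hp hp'
  have main : ∀ (N : ℕ) (m : StrictPartition), m.weight = N → p m = p' m := by
    intro N
    induction N using Nat.strong_induction_on with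
    | _ N ih =>
      intro m hm
      refine Subtype.ext (MvPowerSeries.ext fun e => ?_)
      have hwt : wt (listExp m.length 0 m.parts) = m.weight := wt_listExp (Nat.zero_add _).le
      have h := (hp m.length _ e N (hwt.trans hm).le).trans
        (hp' m.length _ e N (hwt.trans hm).le).symm
      rw [← sub_eq_zero, ← Finset.sum_sub_distrib, Finset.sum_eq_single_of_mem m
        (mem_weightLE.2 hm.le), hg.coeff_schurFn_listExp le_rfl, if_pos rfl, ← mul_sub] at h
      · exact sub_eq_zero.1 ((mul_eq_zero.1 h).resolve_left
          (pow_ne_zero _ hg.coeff_one_ne_zero))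
      · intro l hl hlm
        rcases lt_or_ge l.weight m.weight with hlt | hge
        · rw [ih l.weight (hm ▸ hlt) l rfl, sub_self]
        · rw [hg.coeff_schurFn_listExp hge, if_neg (Ne.symm hlm), zero_mul, zero_mul, sub_zero]
  exact funext fun m => main _ m rfl

/-- Here `k` is arbitrary, not strict: the product is a coefficient of the kernel divided by `g(x_1)
⋯ g(x_n)`. The error of the Cauchy sum vanishes through degree `n + k.degree`, which suffices to
kill the coefficient at `k` of its quotient. -/
theorem IsRow.exists_prod_rowFn_eq (hg : IsRow g v) {n : ℕ} (k : Fin n →₀ ℕ) :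
    ∃ N, ∏ i, rowFn v (k i) =
      ∑ l ∈ weightLE N, coeff k (quotG g (schurFn g l.parts n)) • dualFam g v l := by
  set K := n + k.degree with hK
  refine ⟨K * K, Subtype.ext (MvPowerSeries.ext fun e => ?_)⟩
  rw [← sub_eq_zero, ← hg.coeff_quotG_cauchyError]
  refine hg.coeff_quotG_eq_zero ((hg.isGammaFamily_cauchyError e _).dvd n) (N := K + 1) ?_ k
    (Nat.lt_succ_self _)
  intro d hd
  exact hg.coeff_cauchyError e le_rfl (Nat.lt_succ_iff.1 hd)

theorem IsRow.span_range_dualFam (hg : IsRow g v) :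
    Submodule.span Lazard (Set.range (dualFam g v)) =
      Subalgebra.toSubmodule (Algebra.adjoin Lazard (Set.range (rowFn v))) := by
  apply le_antisymm
  · rw [Submodule.span_le]
    have main : ∀ (N : ℕ) (m : StrictPartition), m.weight = N →
        dualFam g v m ∈ Algebra.adjoin Lazard (Set.range (rowFn v)) := by
      intro N
      induction N using Nat.strong_induction_on with
      | _ N ih =>
        intro m hm
        rw [dualFam_eq]
        refine Subalgebra.sub_mem _ (Subalgebra.prod_mem _ fun i _ =>
          Algebra.subset_adjoin ⟨_, rfl⟩) (Subalgebra.sum_mem _ fun l hl =>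
          Subalgebra.smul_mem _ (ih l.weight ?_ l rfl) _)
        rw [← hm]
        exact mem_weightLT.1 hl
    rintro _ ⟨m, rfl⟩
    exact main _ m rfl
  · rw [Algebra.adjoin_eq_span, Submodule.span_le]
    intro x hx
    obtain ⟨L, hL, rfl⟩ := Submonoid.exists_list_of_mem_closure hx
    choose! k hk using hL
    have hprod : L.prod = ∏ i : Fin L.length, rowFn v (Finsupp.equivFunOnFinite.symm
        (fun i : Fin L.length => k L[i]) i) := by
      conv_lhs => rw [← List.ofFn_getElem (xs := L), List.prod_ofFn]
      refine Finset.prod_congr rfl fun i _ => ?_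
      simp [hk]
    obtain ⟨N, hN⟩ := hg.exists_prod_rowFn_eq (Finsupp.equivFunOnFinite.symm
        (fun i : Fin L.length => k L[i]))
    rw [hprod, hN]
    exact Submodule.sum_mem _ fun l _ => Submodule.smul_mem _ _
      (Submodule.subset_span ⟨l, rfl⟩)

theorem linearIndependent_of_triangular {ι R M : Type*} [CommRing R] [AddCommGroup M] [Module R M]
    {a b : ι → M} (hb : LinearIndependent R b) (w : ι → ℕ)
    (h : ∀ m, a m - b m ∈ Submodule.span R (b '' {l | w l < w m})) : LinearIndependent R a := by
  simp only [Finsupp.mem_span_image_iff_linearCombination] at h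
  choose z hz hzb using h
  rw [linearIndependent_iff]
  intro c hc
  by_contra hne
  obtain ⟨m, hm, hmax⟩ := c.support.exists_max_image w (Finsupp.support_nonempty_iff.2 hne)
  have h0 : (c.sum fun l r => r • (Finsupp.single l 1 + z l)) = 0 := by
    refine linearIndependent_iff.1 hb _ ?_
    rw [map_finsuppSum, ← hc, Finsupp.linearCombination_apply]
    refine Finsupp.sum_congr fun l _ => ?_
    rw [map_smul, map_add, hzb, Finsupp.linearCombination_single, one_smul, add_sub_cancel]
  have h1 := DFunLike.congr_fun h0 m
  rw [Finsupp.sum, Finsupp.finsetSum_apply, Finset.sum_eq_single_of_mem m hm] at h1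
  · have h2 : z m m = 0 := by
      by_contra h
      have := (Finsupp.mem_supported R (z m)).1 (hz m) (Finsupp.mem_support_iff.2 h)
      exact lt_irrefl (w m) this
    simp only [Finsupp.smul_apply, Finsupp.add_apply, Finsupp.single_eq_same, h2, add_zero,
      smul_eq_mul, mul_one, Finsupp.zero_apply] at h1
    exact Finsupp.mem_support_iff.1 hm h1
  · intro l hl hlm
    have h2 : z l m = 0 := by
      by_contra h
      have := (Finsupp.mem_supported R (z l)).1 (hz l) (Finsupp.mem_support_iff.2 h)
      exact absurd (hmax l hl) (not_le.2 this)
    rw [Finsupp.smul_apply, Finsupp.add_apply, h2, Finsupp.single_eq_of_ne (Ne.symm hlm), add_zero,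
      smul_zero]

theorem span_dualFam_le (N : ℕ) :
    Submodule.span Lazard (dualFam g v '' {l | l.weight < N}) ≤
      Submodule.span Lazard (rowProd v '' {l | l.weight < N}) := by
  rw [Submodule.span_le]
  have main : ∀ (W : ℕ) (m : StrictPartition), m.weight = W → W < N →
      dualFam g v m ∈ Submodule.span Lazard (rowProd v '' {l | l.weight < N}) := by
    intro W
    induction W using Nat.strong_induction_on with
    | _ W ih =>
      intro m hm hW
      rw [dualFam_eq]
      refine Submodule.sub_mem _ (Submodule.subset_span ⟨m, hm.trans_lt hW, rfl⟩)
        (Submodule.sum_mem _ fun l hl => Submodule.smul_mem _ _ ?_)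
      have hl' : l.weight < W := hm ▸ mem_weightLT.1 hl
      exact ih _ hl' l rfl (hl'.trans hW)
  rintro _ ⟨m, hm, rfl⟩
  exact main _ m rfl hm

theorem linearIndependent_dualFam (h : LinearIndependent Lazard (rowProd v)) :
    LinearIndependent Lazard (dualFam g v) := by
  refine linearIndependent_of_triangular h weight fun m => ?_
  rw [dualFam_eq, sub_sub_cancel_left]
  exact Submodule.neg_mem _ (Submodule.sum_mem _ fun l hl => Submodule.smul_mem _ _
    (span_dualFam_le _ (Submodule.subset_span ⟨l, mem_weightLT.1 hl, rfl⟩)))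

end Dual

/-! ### Linear independence of the products of one-row functions -/

section TopDegree

variable {σ ι R : Type*} [CommRing R]

theorem coeff_prod_congr (s : Finset ι) {f f' : ι → MvPowerSeries σ R} {e : σ →₀ ℕ}
    (h : ∀ i ∈ s, ∀ d ≤ e, coeff d (f i) = coeff d (f' i)) :
    coeff e (∏ i ∈ s, f i) = coeff e (∏ i ∈ s, f' i) := by
  classical
  induction s using Finset.induction_on generalizing e with
  | empty => simp
  | insert a s ha ih =>
    rw [Finset.prod_insert ha, Finset.prod_insert ha, coeff_mul, coeff_mul]
    refine Finset.sum_congr rfl fun p hp => ?_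
    have hp' : p.1 + p.2 = e := Finset.HasAntidiagonal.mem_antidiagonal.1 hp
    rw [h a (Finset.mem_insert_self _ _) p.1 (hp' ▸ le_self_add),
      ih fun i hi d hd => h i (Finset.mem_insert_of_mem hi) d
        (hd.trans (hp' ▸ le_add_self))]

/-- The integral model of the top degree part of a one-row function. -/
noncomputable def topRow (k : ℕ) : MvPowerSeries ℕ ℤ :=
  fun e => if e.degree = k + 1 then 2 ^ (e.support.card - 1) else 0

theorem coeff_topRow (k : ℕ) (e : ℕ →₀ ℕ) :
    coeff e (topRow k) = if e.degree = k + 1 then 2 ^ (e.support.card - 1) else 0 := rfl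

variable {v : PowerSeries Lazard}

theorem coeff_prod_rowFn_of_lt (s : Finset ι) (k : ι → ℕ) {e : ℕ →₀ ℕ}
    (he : ∑ i ∈ s, (k i + 1) < e.degree) :
    coeff e (∏ i ∈ s, (rowFn v (k i) : MvPowerSeries ℕ Lazard)) = 0 := by
  classical
  induction s using Finset.induction_on generalizing e with
  | empty =>
    rw [Finset.prod_empty, coeff_one, if_neg]
    rintro rfl
    simp at he
  | insert a s ha ih =>
    rw [Finset.sum_insert ha] at he
    rw [Finset.prod_insert ha, coeff_mul]
    refine Finset.sum_eq_zero fun p hp => ?_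
    have hp' : p.1 + p.2 = e := Finset.HasAntidiagonal.mem_antidiagonal.1 hp
    have hdeg : p.1.degree + p.2.degree = e.degree := by rw [← hp', map_add]
    by_cases h : k a + 1 < p.1.degree
    · rw [coeff_rowFn_of_lt h, zero_mul]
    · rw [ih (by omega), mul_zero]

theorem coeff_prod_rowFn (s : Finset ι) (k : ι → ℕ) {e : ℕ →₀ ℕ}
    (he : e.degree = ∑ i ∈ s, (k i + 1)) :
    coeff e (∏ i ∈ s, (rowFn v (k i) : MvPowerSeries ℕ Lazard)) =
      PowerSeries.constantCoeff v ^ s.card * (coeff e (∏ i ∈ s, topRow (k i)) : ℤ) := by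
  classical
  induction s using Finset.induction_on generalizing e with
  | empty =>
    rw [Finset.prod_empty, Finset.prod_empty, coeff_one, coeff_one]
    split_ifs <;> simp
  | insert a s ha ih =>
    rw [Finset.sum_insert ha] at he
    rw [Finset.prod_insert ha, Finset.prod_insert ha, coeff_mul, coeff_mul, Int.cast_sum,
      Finset.mul_sum, Finset.card_insert_of_notMem ha]
    refine Finset.sum_congr rfl fun p hp => ?_
    have hp' : p.1 + p.2 = e := Finset.HasAntidiagonal.mem_antidiagonal.1 hp
    have hdeg : p.1.degree + p.2.degree = e.degree := by rw [← hp', map_add]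
    rcases lt_trichotomy p.1.degree (k a + 1) with h | h | h
    · rw [coeff_prod_rowFn_of_lt s k (by omega), coeff_topRow, if_neg h.ne]
      simp
    · rw [ih (by omega), coeff_rowFn_of_degree_eq h, coeff_topRow, if_pos h]
      push_cast
      ring
    · rw [coeff_rowFn_of_lt h, coeff_topRow, if_neg h.ne']
      simp

/-- Modulo `2` the coefficient `2 ^ (d.support.card - 1)` survives only for exponents supported at
one index, so `topRow k` reduces to the power sum of exponent `k + 1`, here in `J` variables. -/
theorem intCast_coeff_topRow {J k : ℕ} {d : ℕ →₀ ℕ} (hd : d.support ⊆ Finset.range J) :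
    coeff d ((topRow k).map (Int.castRingHom (ZMod 2))) =
      coeff d (∑ j ∈ Finset.range J, (X j : MvPowerSeries ℕ (ZMod 2)) ^ (k + 1)) := by
  classical
  rw [coeff_map, coeff_topRow, map_sum]
  simp only [coeff_X_pow]
  by_cases h : ∃ j, d = Finsupp.single j (k + 1)
  · obtain ⟨j, rfl⟩ := h
    rw [Finset.sum_eq_single j]
    · rw [Finsupp.degree_single, if_pos rfl, if_pos rfl, Finsupp.support_single _
        (Nat.succ_ne_zero k)]
      simp
    · intro i _ hij
      rw [if_neg fun h => hij ?_]
      exact ((Finsupp.single_left_inj (Nat.succ_ne_zero k)).1 h).symm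
    · intro hj
      refine absurd (hd ?_) hj
      simp
  · rw [Finset.sum_eq_zero fun j _ => if_neg fun hj => h ⟨j, hj⟩]
    split_ifs with hk
    · have hcard : d.support.card - 1 ≠ 0 := by
        intro h1
        have h0 : d ≠ 0 := by rintro rfl; simp at hk
        have h2 := Finset.card_pos.2 (Finsupp.support_nonempty_iff.2 h0)
        obtain ⟨j, b, -, hjb⟩ := Finsupp.card_support_eq_one'.1
          (show d.support.card = 1 by omega)
        subst hjb
        rw [Finsupp.degree_single] at hk
        exact h ⟨j, by rw [hk]⟩
      rw [map_pow]
      exact (congrArg (· ^ _) (show (Int.castRingHom (ZMod 2)) 2 = 0 from rfl)).trans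
        (zero_pow hcard)
    · exact map_zero _

theorem coeff_prod_sum_X_pow {n : ℕ} (J : ℕ) (k : Fin n → ℕ) (e : ℕ →₀ ℕ) :
    coeff e (∏ i, ∑ j ∈ Finset.range J, (X j : MvPowerSeries ℕ R) ^ (k i + 1)) =
      (((Fintype.piFinset fun _ : Fin n => Finset.range J).filter fun φ =>
        e = ∑ i, Finsupp.single (φ i) (k i + 1)).card : R) := by
  classical
  rw [Finset.prod_univ_sum, map_sum, Finset.card_filter, Nat.cast_sum]
  refine Finset.sum_congr rfl fun φ _ => ?_
  have : ∏ i, (X (φ i) : MvPowerSeries ℕ R) ^ (k i + 1) =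
      monomial (∑ i, Finsupp.single (φ i) (k i + 1)) 1 := by
    simp only [X_pow_eq]
    induction (Finset.univ : Finset (Fin n)) using Finset.induction_on with
    | empty => simp [monomial_zero_one]
    | insert a s ha ih =>
      rw [Finset.prod_insert ha, Finset.sum_insert ha, ih, monomial_mul_monomial, one_mul]
  rw [this, coeff_monomial, Nat.cast_ite, Nat.cast_one, Nat.cast_zero]

theorem sum_single_val_apply {n : ℕ} (k : Fin n → ℕ) (i : Fin n) :
    (∑ i : Fin n, Finsupp.single (i : ℕ) (k i)) (i : ℕ) = k i := by
  rw [Finsupp.finsetSum_apply, Finset.sum_eq_single i]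
  · simp
  · intro j _ hj
    exact Finsupp.single_eq_of_ne fun h => hj (Fin.ext h.symm)
  · simp

theorem exists_apply_eq_of_sum_single {n n' : ℕ} {k : Fin n → ℕ} {k' : Fin n' → ℕ}
    {φ : Fin n → ℕ} (h : ∑ i : Fin n', Finsupp.single (i : ℕ) (k' i + 1) =
      ∑ i, Finsupp.single (φ i) (k i + 1)) (i : Fin n') : ∃ j, φ j = i := by
  by_contra! hne
  have h1 := sum_single_val_apply (fun i => k' i + 1) i
  rw [h, Finsupp.finsetSum_apply, Finset.sum_eq_zero fun j _ =>
    Finsupp.single_eq_of_ne fun h => hne j h.symm] at h1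
  omega

theorem le_of_sum_single {n n' : ℕ} {k : Fin n → ℕ} {k' : Fin n' → ℕ}
    {φ : Fin n → ℕ} (h : ∑ i : Fin n', Finsupp.single (i : ℕ) (k' i + 1) =
      ∑ i, Finsupp.single (φ i) (k i + 1)) : n' ≤ n := by
  choose ψ hψ using exists_apply_eq_of_sum_single h
  have hinj : Function.Injective ψ := fun i j hij => Fin.ext (by rw [← hψ, hij, hψ])
  simpa using Fintype.card_le_of_injective ψ hinj

/-- With equally many parts on both sides no two parts can be merged, so `φ` comes from a
permutation; both sequences being strictly decreasing, the permutation is the identity. -/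
theorem eq_of_sum_single {n : ℕ} {k k' : Fin n → ℕ} (hk : StrictAnti k) (hk' : StrictAnti k')
    {φ : Fin n → ℕ} (h : ∑ i : Fin n, Finsupp.single (i : ℕ) (k' i + 1) =
      ∑ i, Finsupp.single (φ i) (k i + 1)) : k' = k ∧ φ = Fin.val := by
  choose ψ hψ using exists_apply_eq_of_sum_single h
  have hinj : Function.Injective ψ := fun i j hij => Fin.ext (by rw [← hψ, hij, hψ])
  have hsurj := Finite.injective_iff_surjective.1 hinj
  have hφ : Function.Injective φ := by
    intro a b hab
    obtain ⟨i, rfl⟩ := hsurj a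
    obtain ⟨j, rfl⟩ := hsurj b
    rw [hψ, hψ] at hab
    rw [Fin.ext hab]
  have hval : ∀ i, k' i = k (ψ i) := by
    intro i
    have h1 := sum_single_val_apply (fun i => k' i + 1) i
    rw [h, Finsupp.finsetSum_apply, Finset.sum_eq_single (ψ i)] at h1
    · rw [hψ, Finsupp.single_eq_same] at h1
      omega
    · intro j _ hj
      refine Finsupp.single_eq_of_ne fun h => hj (hφ ?_)
      rw [← h, hψ]
    · simp
  have hmono : StrictMono ψ := by
    intro i j hij
    have := hk' hij
    rw [hval, hval] at this
    exact hk.lt_iff_gt.1 this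
  have hid : ψ = id := (StrictMono.range_inj hmono strictMono_id).1
    (by rw [hsurj.range_eq, Set.range_id])
  subst hid
  exact ⟨funext hval, funext hψ⟩

end TopDegree

theorem det_ne_zero_of_triangular {ι K : Type*} [Fintype ι] [DecidableEq ι] [CommRing K]
    [IsDomain K] (M : Matrix ι ι K) (w : ι → ℕ) (hM : ∀ i j, M i j ≠ 0 → i = j ∨ w j < w i)
    (hd : ∀ i, M i i ≠ 0) : M.det ≠ 0 := by
  classical
  intro h
  obtain ⟨x, hx, hx0⟩ := Matrix.exists_vecMul_eq_zero_iff.2 h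
  have hne : (Finset.univ.filter fun i => x i ≠ 0).Nonempty := by
    obtain ⟨i, hi⟩ := Function.ne_iff.1 hx
    exact ⟨i, by simpa using hi⟩
  obtain ⟨m, hm, hmax⟩ := Finset.exists_max_image _ w hne
  have h1 := congrFun hx0 m
  rw [Matrix.vecMul, dotProduct, Finset.sum_eq_single m] at h1
  · exact (mul_ne_zero (Finset.mem_filter.1 hm).2 (hd m)) h1
  · intro i _ him
    by_contra hne0
    rcases hM i m (right_ne_zero_of_mul hne0) with h2 | h2
    · exact him h2
    · exact absurd (hmax i (Finset.mem_filter.2 ⟨Finset.mem_univ _, left_ne_zero_of_mul hne0⟩))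
        (not_le.2 h2)
  · simp

namespace StrictPartition

theorem expo_add_one (m : StrictPartition) (i : Fin m.length) :
    m.expo i + 1 = m.parts[(i : ℕ)]'i.2 := by
  have h := DFunLike.congr_fun m.ones_add_expo i
  have h2 : m.parts.getD i 0 = m.parts[(i : ℕ)]'i.2 := by
    exact List.getD_eq_getElem _ _ i.2
  simp only [Finsupp.add_apply, ones_apply, listExp_apply, Nat.zero_le, if_true,
    Nat.sub_zero, h2] at h
  omega

theorem strictAnti_expo (m : StrictPartition) : StrictAnti m.expo := by
  intro i j hij
  have h := List.pairwise_iff_getElem.1 m.strict i j i.2 j.2 hij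
  rw [← m.expo_add_one i, ← m.expo_add_one j] at h
  omega

/-- The partition as an exponent of the variables `y`. -/
noncomputable def natExp (m : StrictPartition) : ℕ →₀ ℕ :=
  ∑ i : Fin m.length, Finsupp.single (i : ℕ) (m.expo i + 1)

theorem degree_natExp (m : StrictPartition) : m.natExp.degree = ∑ i, (m.expo i + 1) := by
  rw [natExp, map_sum]
  simp only [Finsupp.degree_single]

theorem eq_of_natExp {l m : StrictPartition} (hlm : l.length = m.length) {φ : Fin m.length → ℕ}
    (h : l.natExp = ∑ i, Finsupp.single (φ i) (m.expo i + 1)) : l = m ∧ φ = Fin.val := by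
  have key : ∀ (n : ℕ) (hn : n = m.length) (k : Fin n → ℕ), StrictAnti k →
      ∑ i : Fin n, Finsupp.single (i : ℕ) (k i + 1) =
        ∑ i, Finsupp.single (φ i) (m.expo i + 1) →
      (∀ i : Fin n, k i = m.expo (Fin.cast hn i)) ∧ φ = Fin.val := by
    rintro n rfl k hk h
    obtain ⟨h1, h2⟩ := eq_of_sum_single m.strictAnti_expo hk h
    exact ⟨congrFun h1, h2⟩
  obtain ⟨h1, h2⟩ := key _ hlm _ l.strictAnti_expo h
  refine ⟨ext_parts (List.ext_getElem hlm fun i hi hi' => ?_), h2⟩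
  have h3 := h1 ⟨i, hi⟩
  have h4 := l.expo_add_one ⟨i, hi⟩
  have h5 := m.expo_add_one ⟨i, hi'⟩
  exact h4.symm.trans ((congrArg (· + 1) h3).trans h5)

end StrictPartition

section Independence

open StrictPartition

/-- The coefficients of the integral model of the top degree part of `rowProd`. -/
noncomputable def topCoeff (m l : StrictPartition) : ℤ :=
  coeff l.natExp (∏ i : Fin m.length, topRow (m.expo i))

theorem intCast_topCoeff (m l : StrictPartition) : ∃ J : ℕ, l.natExp.support ⊆ Finset.range J ∧
    m.length ≤ J ∧
    (topCoeff m l : ZMod 2) =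
      (((Fintype.piFinset fun _ : Fin m.length => Finset.range J).filter fun φ =>
        l.natExp = ∑ i, Finsupp.single (φ i) (m.expo i + 1)).card : ZMod 2) := by
  obtain ⟨J₀, hJ₀⟩ := l.natExp.support.exists_nat_subset_range
  have hJ : l.natExp.support ⊆ Finset.range (max J₀ m.length) :=
    hJ₀.trans (Finset.range_mono (le_max_left _ _))
  refine ⟨max J₀ m.length, hJ, le_max_right _ _, ?_⟩
  rw [← coeff_prod_sum_X_pow]
  have h1 : (topCoeff m l : ZMod 2) = coeff l.natExp
      (∏ i : Fin m.length, (topRow (m.expo i)).map (Int.castRingHom (ZMod 2))) := by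
    rw [← map_prod, coeff_map]
    rfl
  rw [h1]
  exact coeff_prod_congr _ fun i _ d hd =>
    intCast_coeff_topRow ((Finsupp.support_mono hd).trans hJ)

theorem topCoeff_self (m : StrictPartition) : (topCoeff m m : ZMod 2) = 1 := by
  obtain ⟨J, -, hJ, h⟩ := intCast_topCoeff m m
  rw [h]
  have : ((Fintype.piFinset fun _ : Fin m.length => Finset.range J).filter fun φ =>
      m.natExp = ∑ i, Finsupp.single (φ i) (m.expo i + 1)) = {Fin.val} := by
    ext φ
    rw [Finset.mem_filter, Finset.mem_singleton]
    refine ⟨fun h => (eq_of_natExp rfl h.2).2, ?_⟩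
    rintro rfl
    exact ⟨Fintype.mem_piFinset.2 fun i => Finset.mem_range.2 (i.2.trans_le hJ), rfl⟩
  rw [this, Finset.card_singleton, Nat.cast_one]

theorem eq_or_lt_of_topCoeff {m l : StrictPartition} (h : (topCoeff m l : ZMod 2) ≠ 0) :
    m = l ∨ l.length < m.length := by
  obtain ⟨J, -, -, hJ⟩ := intCast_topCoeff m l
  rw [hJ] at h
  obtain ⟨φ, hφ⟩ := Finset.card_pos.1 (Nat.pos_of_ne_zero fun h0 => h (by rw [h0, Nat.cast_zero]))
  have hφ' := (Finset.mem_filter.1 hφ).2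
  rcases (le_of_sum_single hφ').eq_or_lt with hlm | hlm
  · exact Or.inl (eq_of_natExp hlm hφ').1.symm
  · exact Or.inr hlm

/-- Modulo `2` the entries count the ways to merge the parts of `m` into those of `l`. Merging
shortens, so the matrix is triangular for the length, with diagonal `1` because the parts are
distinct. The determinant is odd. -/
theorem det_topCoeff_ne_zero (F : Finset StrictPartition) [DecidableEq F] :
    (Matrix.of fun m l : F => topCoeff m.1 l.1).det ≠ 0 := by
  intro h
  have h1 := congrArg (Int.castRingHom (ZMod 2)) h
  rw [RingHom.map_det, map_zero] at h1
  refine det_ne_zero_of_triangular _ (fun m : F => m.1.length) (fun m l hml => ?_) (fun m => ?_) h1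
  · rcases eq_or_lt_of_topCoeff hml with h | h
    · exact Or.inl (Subtype.ext h)
    · exact Or.inr h
  · change (topCoeff m.1 m.1 : ZMod 2) ≠ 0
    rw [topCoeff_self]
    exact one_ne_zero

variable {v : PowerSeries Lazard}

theorem coe_rowProd (m : StrictPartition) : (rowProd v m : MvPowerSeries ℕ Lazard) =
    ∏ i : Fin m.length, (rowFn v (m.expo i) : MvPowerSeries ℕ Lazard) := by
  have h := map_prod SymY.val (fun i : Fin m.length => rowFn v (m.expo i)) Finset.univ
  simp only [Subalgebra.coe_val] at h
  exact h

/-- In a nontrivial relation, the partitions of maximal size among those with nonzero coefficient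
are compared at the monomials `y ^ l` of that degree. Smaller partitions do not contribute there,
and the nonsingular integral matrix forces the coefficients, scaled by `v(0) ^ ℓ`, to vanish. -/
theorem linearIndependent_rowProd (hv : PowerSeries.constantCoeff v ≠ 0) :
    LinearIndependent Lazard (rowProd v) := by
  classical
  rw [linearIndependent_iff']
  intro s c hc
  by_contra! hne
  have hs : (s.filter fun m => c m ≠ 0).Nonempty := by
    obtain ⟨m, hm, hcm⟩ := hne
    exact ⟨m, Finset.mem_filter.2 ⟨hm, hcm⟩⟩
  obtain ⟨m₀, hm₀, hmax⟩ := Finset.exists_max_image _ (fun m => m.natExp.degree) hs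
  set F := s.filter fun m => c m ≠ 0 ∧ m.natExp.degree = m₀.natExp.degree with hF
  have hzero : (fun m : F => c m.1 * PowerSeries.constantCoeff v ^ m.1.length) = 0 := by
    refine Matrix.eq_zero_of_vecMul_eq_zero
      (M := (Matrix.of fun m l : F => topCoeff m.1 l.1).map (Int.castRingHom Lazard)) ?_ ?_
    · rw [← RingHom.mapMatrix_apply, ← RingHom.map_det]
      exact fun h => det_topCoeff_ne_zero F (Int.cast_eq_zero.1 h)
    · funext l
      have hl : l.1.natExp.degree = m₀.natExp.degree := ((Finset.mem_filter.1 l.2).2).2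
      have h1 := congrArg (fun f : SymY => coeff l.1.natExp (f : MvPowerSeries ℕ Lazard)) hc
      replace h1 := (coeff_sum_smul _ _ _ _).symm.trans h1
      rw [Matrix.vecMul, dotProduct, Pi.zero_apply]
      refine Eq.trans ?_ h1
      refine (Finset.sum_coe_sort F fun m => c m * PowerSeries.constantCoeff v ^ m.length *
        (topCoeff m l.1 : Lazard)).trans ?_
      refine (Finset.sum_congr rfl fun m hm => ?_).trans
        (Finset.sum_subset (Finset.filter_subset _ _) fun m hm hmF => ?_)
      · have hm' : m.natExp.degree = m₀.natExp.degree := ((Finset.mem_filter.1 hm).2).2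
        rw [coe_rowProd, coeff_prod_rowFn _ _ (hl.trans (hm'.symm.trans m.degree_natExp)),
          Finset.card_univ, Fintype.card_fin, mul_assoc]
        rfl
      · by_cases hcm : c m = 0
        · rw [hcm, zero_mul]
        · have h2 := hmax m (Finset.mem_filter.2 ⟨hm, hcm⟩)
          have h3 : m.natExp.degree ≠ m₀.natExp.degree := fun h =>
            hmF (Finset.mem_filter.2 ⟨hm, hcm, h⟩)
          rw [coe_rowProd, coeff_prod_rowFn_of_lt, mul_zero]
          rw [← m.degree_natExp, hl]
          exact lt_of_le_of_ne h2 h3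
  have hm₀' := Finset.mem_filter.1 hm₀
  have := congrFun hzero ⟨m₀, Finset.mem_filter.2 ⟨hm₀'.1, hm₀'.2, rfl⟩⟩
  exact mul_ne_zero hm₀'.2 (pow_ne_zero _ hv) this

end Independence

/-! ### The two rows -/

theorem finv_X : finv (PowerSeries.X : PowerSeries Lazard) = finvSeries :=
  congrFun (subst_self (σ := Unit) (R := Lazard)) finvSeries

theorem exists_isRow_X : ∃ v : PowerSeries Lazard, IsRow PowerSeries.X v := by
  obtain ⟨w, hw, h⟩ := exists_sub_finvSeries_eq
  refine ⟨w, PowerSeries.constantCoeff_X, ?_, ?_, h, ?_⟩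
  · rw [PowerSeries.coeff_one_X]
    exact one_ne_zero
  · rw [hw]
    exact two_ne_zero
  · intro n i j hij f hf
    have hX : ∀ a : Fin n, gX PowerSeries.X a = X a := fun a =>
      PowerSeries.subst_X (pHasSubst (constantCoeff_X_lazard a))
    rw [hX, hX] at hf
    rw [hX]
    refine ((prime_X_var i).dvd_or_dvd hf).resolve_left fun h => ?_
    rw [X_dvd_iff_setZero, setZero, evalHom_X, if_neg hij.symm] at h
    exact (prime_X_var (R := Lazard) j).ne_zero h

/-- Division in the `x_j`-adic topology: iterating the step gives `f = q (w_0 + x_j w_1 + ⋯)`, a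
convergent series. -/
theorem dvd_of_step {σ R : Type*} [CommRing R] {q : MvPowerSeries σ R} (j : σ)
    {P : MvPowerSeries σ R → Prop} (h : ∀ f, P f → ∃ w f', f = q * w + X j * f' ∧ P f')
    {f : MvPowerSeries σ R} (hf : P f) : q ∣ f := by
  classical
  choose! w f' hstep hP using h
  have hPk : ∀ k, P (f'^[k] f) := by
    intro k
    induction k with
    | zero => exact hf
    | succ k ih =>
      rw [Function.iterate_succ_apply']
      exact hP _ ih
  set S : ℕ → MvPowerSeries σ R := fun N => ∑ k ∈ Finset.range N, X j ^ k * w (f'^[k] f) with hS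
  have hexp : ∀ N, f = q * S N + X j ^ N * f'^[N] f := by
    intro N
    induction N with
    | zero => simp [hS]
    | succ N ih =>
      have h1 := hstep _ (hPk N)
      have h2 : S (N + 1) = S N + X j ^ N * w (f'^[N] f) := Finset.sum_range_succ _ _
      rw [h2, Function.iterate_succ_apply', pow_succ]
      linear_combination ih + X j ^ N * h1
  -- Terms beyond `k = d j` carry a higher power of `x_j`, so the coefficient at `d` is already
  -- final after `d j + 1` terms.
  let W : MvPowerSeries σ R := fun d => coeff d (S (d j + 1))
  have hW : ∀ (d : σ →₀ ℕ) (N : ℕ), d j < N → coeff d W = coeff d (S N) := by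
    intro d N hN
    change coeff d (S (d j + 1)) = _
    rw [hS, map_sum, map_sum]
    refine Finset.sum_subset (Finset.range_mono hN) fun k _ hk => ?_
    rw [Finset.mem_range, not_lt] at hk
    exact X_pow_dvd_iff.1 (Dvd.intro _ rfl) d hk
  refine ⟨W, ?_⟩
  ext d
  have h0 := congrArg (coeff d) (hexp (d j + 1))
  rw [map_add, X_pow_dvd_iff.1 (Dvd.intro (f'^[d j + 1] f) rfl) d (Nat.lt_succ_self _), add_zero]
    at h0
  rw [h0, coeff_mul, coeff_mul]
  refine Finset.sum_congr rfl fun p hp => ?_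
  have hp' : p.1 + p.2 = d := Finset.HasAntidiagonal.mem_antidiagonal.1 hp
  rw [hW p.2 (d j + 1)]
  rw [← hp', Finsupp.add_apply]
  omega

theorem prime_C {σ R : Type*} [CommRing R] {p : R} (hp : Prime p) :
    Prime (C p : MvPowerSeries σ R) := by
  have : IsDomain (R ⧸ Ideal.span {p}) := by
    rw [Ideal.Quotient.isDomain_iff_prime, Ideal.span_singleton_prime hp.ne_zero]
    exact hp
  have hdvd : ∀ f : MvPowerSeries σ R, C p ∣ f ↔
      MvPowerSeries.map (Ideal.Quotient.mk (Ideal.span {p})) f = 0 := by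
    intro f
    constructor
    · rintro ⟨f, rfl⟩
      rw [map_mul, map_C, Ideal.Quotient.eq_zero_iff_mem.2 (Ideal.mem_span_singleton_self p),
        map_zero, zero_mul]
    · intro h
      have h1 : ∀ d, p ∣ coeff d f := by
        intro d
        have := congrArg (coeff d) h
        rw [coeff_map, map_zero, Ideal.Quotient.eq_zero_iff_mem, Ideal.mem_span_singleton] at this
        exact this
      choose a ha using h1
      refine ⟨(a : MvPowerSeries σ R), MvPowerSeries.ext fun d => ?_⟩
      exact (ha d).trans (coeff_C_mul d (a : MvPowerSeries σ R) p).symm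
  refine ⟨fun h => hp.ne_zero ?_, fun h => hp.not_isUnit ?_, fun f f' h => ?_⟩
  · have := congrArg constantCoeff h
    simpa using this
  · have := h.map (constantCoeff (σ := σ) (R := R))
    simpa using this
  · rw [hdvd, map_mul, mul_eq_zero] at h
    rwa [hdvd, hdvd]

/-- The series `t +_F t`. -/
noncomputable def doubleSeries : PowerSeries Lazard :=
  fadd (PowerSeries.X : PowerSeries Lazard) PowerSeries.X

theorem psubst_doubleSeries {σ : Type} {t : MvPowerSeries σ Lazard} (ht : constantCoeff t = 0) :
    PowerSeries.subst t doubleSeries = fadd t t := by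
  have hz : HasSubst fun _ : Unit => t := (pHasSubst ht).const
  have h := subst_fadd (a := (PowerSeries.X : PowerSeries Lazard)) (b := PowerSeries.X)
    PowerSeries.constantCoeff_X PowerSeries.constantCoeff_X hz
  have h1 : MvPowerSeries.subst (fun _ : Unit => t) (PowerSeries.X : PowerSeries Lazard) = t :=
    PowerSeries.subst_X (pHasSubst ht)
  rw [h1] at h
  exact h

theorem coeff_two_doubleSeries :
    PowerSeries.coeff 2 doubleSeries = coeff (bideg 1 1) lazardFGL.toPowerSeries := by
  have hs : HasSubst ![(PowerSeries.X : PowerSeries Lazard), PowerSeries.X] :=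
    hasSubst_pair PowerSeries.constantCoeff_X PowerSeries.constantCoeff_X
  have hterm : ∀ d : Fin 2 →₀ ℕ, PowerSeries.coeff 2 (d.prod fun s e =>
      (![(PowerSeries.X : PowerSeries Lazard), PowerSeries.X] s) ^ e) =
      if d 0 + d 1 = 2 then 1 else 0 := by
    intro d
    rw [Finsupp.prod_fintype _ _ (by simp), Fin.prod_univ_two]
    change PowerSeries.coeff 2 (PowerSeries.X ^ d 0 * PowerSeries.X ^ d 1) = _
    rw [← pow_add, PowerSeries.coeff_X_pow]
    exact if_congr eq_comm rfl rfl
  have h : PowerSeries.coeff 2 doubleSeries = finsum fun d => coeff d lazardFGL.toPowerSeries •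
      PowerSeries.coeff 2 (d.prod fun s e =>
        (![(PowerSeries.X : PowerSeries Lazard), PowerSeries.X] s) ^ e) :=
    coeff_subst hs _ _
  rw [h, finsum_eq_single _ (bideg 1 1)]
  · have : (bideg 1 1) 0 + (bideg 1 1) 1 = 2 := by simp [bideg]
    rw [hterm, if_pos this, smul_eq_mul, mul_one]
  · intro d hd
    rw [hterm]
    split_ifs with h2
    · have h3 : d 0 = 0 ∨ d 1 = 0 := by
        by_contra! h
        refine hd ?_
        rw [← bideg_self d, show d 0 = 1 by omega, show d 1 = 1 by omega]
      rw [lazardFGL_coeff]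
      simp [genericSeries, h3, h2]
    · rw [smul_zero]

/-- `t +_F t` is `t - t̄` times a unit, and the cofactor `v` is the inverse of that unit. For the
cancellation property write `g(x_j) = x_j W`, where `W` becomes `2` at `x_j = 0`. The prime `x_j`
does not divide `g(x_i)`, and the prime `2` does not either, because `a_{1,1}` is the coefficient of
`t ^ 2` in `g`. -/
theorem exists_isRow_doubleSeries : ∃ v : PowerSeries Lazard, IsRow doubleSeries v := by
  obtain ⟨u, hu, hu'⟩ := exists_fadd_self_eq
    (PowerSeries.constantCoeff_X : constantCoeff (PowerSeries.X : PowerSeries Lazard) = 0)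
  obtain ⟨c, hc⟩ := exists_fadd_eq
    (PowerSeries.constantCoeff_X : constantCoeff (PowerSeries.X : PowerSeries Lazard) = 0)
    (PowerSeries.constantCoeff_X : constantCoeff (PowerSeries.X : PowerSeries Lazard) = 0)
  rw [finv_X] at hu'
  have hinv : u * invOfUnit u 1 = 1 := mul_invOfUnit u 1 (by simpa using hu)
  set w : PowerSeries Lazard := 2 + PowerSeries.X * c with hw
  have hc' : doubleSeries = PowerSeries.X * w := by
    rw [doubleSeries, hc, hw]
    ring
  have hw0 : PowerSeries.constantCoeff w = 2 := by
    rw [hw, map_add, map_mul, PowerSeries.constantCoeff_X, zero_mul, add_zero, map_ofNat]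
  have h0 : PowerSeries.constantCoeff doubleSeries = 0 := by
    rw [hc', map_mul, PowerSeries.constantCoeff_X, zero_mul]
  have h1 : PowerSeries.coeff 1 doubleSeries ≠ 0 := by
    have : PowerSeries.coeff 1 doubleSeries = 2 := by
      rw [hc', ← hw0, ← PowerSeries.coeff_zero_eq_constantCoeff_apply]
      exact PowerSeries.coeff_succ_X_mul 0 w
    rw [this]
    exact two_ne_zero
  refine ⟨invOfUnit u 1, h0, h1, ?_, ?_, ?_⟩
  · have := congrArg constantCoeff hinv
    rw [map_mul, hu, one_mul, map_one] at this
    exact ne_of_eq_of_ne this one_ne_zero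
  · rw [doubleSeries, hu', mul_assoc, hinv, mul_one]
  · intro n i j hij f hf
    have hs := pHasSubst (constantCoeff_X_lazard j)
    set W : MvPowerSeries (Fin n) Lazard := PowerSeries.subst (X j) w with hW
    have hgj : gX doubleSeries j = X j * W := by
      rw [gX, hc', PowerSeries.subst_mul hs, PowerSeries.subst_X hs]
    set q := gX doubleSeries i with hq
    have hsq : setZero j q = q := setZero_gX hij
    have hXq : ¬ X j ∣ q := by
      rw [X_dvd_iff_setZero, hsq]
      exact gX_ne_zero h1 i
    have hsW : setZero j W = C 2 := by
      rw [hW, setZero, evalHom_psubst _ (constantCoeff_X_lazard j), evalHom_X, if_pos rfl]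
      have hs0 : PowerSeries.HasSubst (0 : MvPowerSeries (Fin n) Lazard) := pHasSubst (map_zero _)
      rw [hw, PowerSeries.subst_add hs0, PowerSeries.subst_mul hs0, PowerSeries.subst_X hs0,
        zero_mul, add_zero, ← PowerSeries.coe_substAlgHom hs0, map_ofNat, map_ofNat]
    have h2q : ¬ C 2 ∣ q := by
      rintro ⟨q', hq'⟩
      have h2 := congrArg (coeff (Finsupp.single i 2)) hq'
      rw [coeff_C_mul, hq, gX, PowerSeries.coeff_subst_single] at h2
      rw [Finsupp.single_eq_same, if_pos rfl, coeff_two_doubleSeries] at h2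
      exact not_two_dvd_coeff_lazardFGL (Dvd.intro _ h2.symm)
    have hcancel : ∀ f', q ∣ X j * W * f' → q ∣ W * f' := by
      intro f' h
      refine dvd_of_prime_mul_dvd (prime_X_var j) isUnit_one hXq (f := W * f') ?_
      rwa [mul_one, ← mul_assoc]
    rw [hgj] at hf
    -- `W` itself is not prime in general, so it is cancelled one power of `x_j` at a time: at `x_j
    -- = 0` it is the prime `2`, which gives the constant term `q * y` of `f`, and the remainder is
    -- again `x_j f'` with `q ∣ W * f'`.
    refine dvd_of_step j (P := fun f => q ∣ W * f) (fun f hf => ?_) (hcancel f hf)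
    have hf0 : q ∣ setZero j f := by
      refine dvd_of_prime_mul_dvd (prime_C prime_two_lazard) isUnit_one h2q ?_
      have := map_dvd (setZero j) hf
      rwa [map_mul, hsq, hsW, ← mul_one (C (2 : Lazard))] at this
    obtain ⟨y, hy⟩ := hf0
    have hX : X j ∣ f - q * y := by
      rw [X_dvd_iff_setZero, map_sub, ← hy, sub_eq_zero]
      ext d
      simp only [coeff_setZero]
      split_ifs <;> rfl
    obtain ⟨f', hf'⟩ := hX
    refine ⟨y, f', by rw [← hf']; ring, hcancel f' ?_⟩
    have : X j * W * f' = W * f - q * (W * y) := by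
      linear_combination -W * hf'
    rw [this]
    exact dvd_sub hf (Dvd.intro _ rfl)

/-! ### The universal Schur functions and their dual families -/

theorem eq_invFun_algebraMap {n : ℕ} {f : MvPowerSeries (Fin n) Lazard}
    {x : FractionRing (MvPowerSeries (Fin n) Lazard)} (h : algebraMap _ _ f = x) :
    Function.invFun (algebraMap (MvPowerSeries (Fin n) Lazard)
      (FractionRing (MvPowerSeries (Fin n) Lazard))) x = f := by
  rw [← h]
  exact Function.leftInverse_invFun (IsFractionRing.injective _ _) f

theorem rowP_eq_row {n : ℕ} (k : ℕ) (hk : k > 0) (a : Fin n) :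
    rowP k (X a) = row PowerSeries.X k (X a) := by
  rw [rowP, row, PowerSeries.subst_X (pHasSubst (constantCoeff_X_lazard a)), ← pow_succ',
    Nat.sub_add_cancel hk]

theorem rowQ_eq_row {n : ℕ} (k : ℕ) (hk : k > 0) (a : Fin n) :
    rowQ k (X a) = row doubleSeries k (X a) := by
  rw [rowQ, row, if_neg hk.ne', psubst_doubleSeries (constantCoeff_X_lazard a)]

theorem schurP_eq (l : StrictPartition) (n : ℕ) :
    schurP l n = schurFn PowerSeries.X l.parts n := by
  rw [schurP]
  split_ifs with h
  · exact eq_invFun_algebraMap (algebraMap_schurFn_eq_symmetrization rowP_eq_row h)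
  · exact (schurFn_eq_zero_of_lt _ (not_le.1 h)).symm

theorem schurQ_eq (l : StrictPartition) (n : ℕ) :
    schurQ l n = schurFn doubleSeries l.parts n := by
  rw [schurQ]
  split_ifs with h
  · exact eq_invFun_algebraMap (algebraMap_schurFn_eq_symmetrization rowQ_eq_row h)
  · exact (schurFn_eq_zero_of_lt _ (not_le.1 h)).symm

theorem isDualP_iff {p : StrictPartition → SymY} : IsDualP p ↔ IsDualFam doubleSeries p := by
  simp only [IsDualP, IsDualFam, schurQ_eq]

theorem isDualQ_iff {q : StrictPartition → SymY} : IsDualQ q ↔ IsDualFam PowerSeries.X q := by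
  simp only [IsDualQ, IsDualFam, schurP_eq]

/-- The sequence `1, r_0, r_1, …`. -/
noncomputable def consRow (r : ℕ → SymY) : ℕ → SymY
  | 0 => 1
  | k + 1 => r k

theorem liftX_X : liftX (PowerSeries.X : PowerSeries Lazard) =
    (PowerSeries.X : PowerSeries (MvPowerSeries ℕ Lazard)) :=
  map_X _ _

theorem mk_eq_consRow (r : ℕ → SymY) :
    (PowerSeries.mk fun k => (consRow r k : MvPowerSeries ℕ Lazard)) =
      1 + PowerSeries.X * PowerSeries.mk fun k => (r k : MvPowerSeries ℕ Lazard) := by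
  ext1 k
  rcases k with _ | k
  · rw [PowerSeries.coeff_mk, map_add, PowerSeries.coeff_zero_X_mul, add_zero,
      PowerSeries.coeff_zero_one]
    rfl
  · rw [PowerSeries.coeff_mk, map_add, PowerSeries.coeff_succ_X_mul, PowerSeries.coeff_mk,
      PowerSeries.coeff_one, if_neg (Nat.succ_ne_zero k), zero_add]
    rfl

theorem IsRow.isOneRowQ_consRow {v : PowerSeries Lazard} (hg : IsRow PowerSeries.X v) :
    IsOneRowQ (consRow (rowFn v)) := by
  rw [IsOneRowQ, mk_eq_consRow, hg.kernelOne_eq, liftX_X]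

theorem IsOneRowQ.unique {q q' : ℕ → SymY} (h : IsOneRowQ q) (h' : IsOneRowQ q') : q = q' := by
  funext k
  have := congrArg (PowerSeries.coeff k) (h.symm.trans h')
  rw [PowerSeries.coeff_mk, PowerSeries.coeff_mk] at this
  exact Subtype.ext this

theorem IsRow.isOneRowP_consRow {v : PowerSeries Lazard} (hg : IsRow doubleSeries v) :
    IsOneRowP (consRow (rowFn v)) :=
  ⟨rfl, hg.kernelOne_eq⟩

theorem liftX_injective {σ : Type} : Function.Injective (liftX (σ := σ)) :=
  fun f f' h => MvPowerSeries.ext fun d => C_injective (σ := ℕ) (R := Lazard) <| by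
    rw [← coeff_map, ← coeff_map]
    exact congrArg (coeff d) h

theorem IsOneRowP.unique {p p' : ℕ → SymY} (h : IsOneRowP p) (h' : IsOneRowP p') : p = p' := by
  obtain ⟨v, hg⟩ := exists_isRow_doubleSeries
  have hne : liftX doubleSeries ≠ 0 := by
    intro h
    have h0 : doubleSeries = 0 := liftX_injective (h.trans (map_zero _).symm)
    refine hg.coeff_one_ne_zero ?_
    rw [h0, map_zero]
  have h2 := mul_left_cancel₀ hne (add_left_cancel (h.2.symm.trans h'.2))
  funext k
  rcases k with _ | k
  · rw [h.1, h'.1]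
  · have := congrArg (PowerSeries.coeff k) h2
    rw [PowerSeries.coeff_mk, PowerSeries.coeff_mk] at this
    exact Subtype.ext this

theorem adjoin_consRow (r : ℕ → SymY) :
    Algebra.adjoin Lazard {f | ∃ k ≥ 1, consRow r k = f} =
      Algebra.adjoin Lazard (Set.range r) := by
  congr 1
  ext f
  constructor
  · rintro ⟨k, hk, rfl⟩
    obtain ⟨k, rfl⟩ := Nat.exists_eq_succ_of_ne_zero (Nat.one_le_iff_ne_zero.1 hk)
    exact ⟨k, rfl⟩
  · rintro ⟨k, rfl⟩
    exact ⟨k + 1, Nat.succ_le_succ (Nat.zero_le k), rfl⟩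

end UnivSchur

theorem mainTheorem8 :
    ((∀ (l : UnivSchur.StrictPartition) (n : ℕ), l.length ≤ n →
        algebraMap _ _ (UnivSchur.schurP l n) = UnivSchur.symmetrization n UnivSchur.rowP l ∧
        algebraMap _ _ (UnivSchur.schurQ l n) = UnivSchur.symmetrization n UnivSchur.rowQ l) ∧
      (∃! p : ℕ → UnivSchur.SymY, UnivSchur.IsOneRowP p) ∧
      (∃! q : ℕ → UnivSchur.SymY, UnivSchur.IsOneRowQ q) ∧
      (∃! p : UnivSchur.StrictPartition → UnivSchur.SymY, UnivSchur.IsDualP p) ∧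
      (∃! q : UnivSchur.StrictPartition → UnivSchur.SymY, UnivSchur.IsDualQ q)) ∧
    (LinearIndependent UnivSchur.Lazard UnivSchur.dualP ∧
      Submodule.span UnivSchur.Lazard (Set.range UnivSchur.dualP) =
        Subalgebra.toSubmodule UnivSchur.GammaY) ∧
    (LinearIndependent UnivSchur.Lazard UnivSchur.dualQ ∧
      Submodule.span UnivSchur.Lazard (Set.range UnivSchur.dualQ) =
        Subalgebra.toSubmodule UnivSchur.GammaPlusY) := by
  open UnivSchur in
  obtain ⟨v, hg⟩ := exists_isRow_doubleSeries
  obtain ⟨u, hX⟩ := exists_isRow_X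
  have hp : IsOneRowP oneRowP := Classical.epsilon_spec ⟨_, hg.isOneRowP_consRow⟩
  have hq : IsOneRowQ oneRowQ := Classical.epsilon_spec ⟨_, hX.isOneRowQ_consRow⟩
  have hdp' : IsDualP (dualFam doubleSeries v) := isDualP_iff.2 hg.isDualFam_dualFam
  have hdq' : IsDualQ (dualFam PowerSeries.X u) := isDualQ_iff.2 hX.isDualFam_dualFam
  have hdp : IsDualP dualP := Classical.epsilon_spec ⟨_, hdp'⟩
  have hdq : IsDualQ dualQ := Classical.epsilon_spec ⟨_, hdq'⟩
  have hup : ∀ {p p'}, IsDualP p → IsDualP p' → p = p' := fun h h' =>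
    hg.eq_of_isDualFam (isDualP_iff.1 h) (isDualP_iff.1 h')
  have huq : ∀ {q q'}, IsDualQ q → IsDualQ q' → q = q' := fun h h' =>
    hX.eq_of_isDualFam (isDualQ_iff.1 h) (isDualQ_iff.1 h')
  refine ⟨⟨fun l n hl => ⟨?_, ?_⟩, ⟨_, hp, fun p h => h.unique hp⟩, ⟨_, hq, fun q h => h.unique hq⟩,
    ⟨_, hdp, fun p h => hup h hdp⟩, ⟨_, hdq, fun q h => huq h hdq⟩⟩, ⟨?_, ?_⟩, ⟨?_, ?_⟩⟩
  · rw [schurP_eq]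
    exact algebraMap_schurFn_eq_symmetrization rowP_eq_row hl
  · rw [schurQ_eq]
    exact algebraMap_schurFn_eq_symmetrization rowQ_eq_row hl
  · rw [hup hdp hdp']
    exact linearIndependent_dualFam (linearIndependent_rowProd hg.constantCoeff_cofactor_ne_zero)
  · rw [hup hdp hdp', hg.span_range_dualFam, GammaY, hp.unique hg.isOneRowP_consRow,
      adjoin_consRow]
  · rw [huq hdq hdq']
    exact linearIndependent_dualFam (linearIndependent_rowProd hX.constantCoeff_cofactor_ne_zero)
  · rw [huq hdq hdq', hX.span_range_dualFam, GammaPlusY, hq.unique hX.isOneRowQ_consRow,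
      adjoin_consRow]
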